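/- A metric graph $\mathcal G$ is obtained from a countable family of compact intervals (edges) $[0,\ell_e]$, $0<\ell_e<\infty$, $e\in E$, by identifying endpoints according to an arbitrary equivalence relation on the set of all edge endpoints; the classes of endpoints form the vertex set $V$. Its distance is the infimum of the lengths of finite chains of segments, each contained in one edge, leading from one point to the other; $\mathcal G$ is connected if all distances are finite, and locally finite if every vertex has finite degree. An end of $\mathcal G$ is an equivalence class of decreasing sequences $(U_n)$ of nonempty open connected subsets with compact boundary and $\bigcap_n\overline{U_n}=\emptyset$, where $(U_n)\sim(U_n')$ if every $U_n$ contains some $U_j'$ and every $U_n'$ contains some $U_k$; $\mathfrak C(\mathcal G)$ is the set of ends. $H^1(\mathcal G)$ is the space of continuous real functions $f$ on $\mathcal G$ that are absolutely continuous on each edge and satisfy $\sum_e\int_0^{\ell_e}(|f_e|^2+|f_e'|^2)\,dx<\infty$; such functions extend continuously to the ends. For $\mathfrak V\subset V\cup\mathfrak C(\mathcal G)$ let $H^1_0(\mathcal G;\mathfrak V)$ be the space of $f\in H^1(\mathcal G)$ that vanish at every vertex and end in $\mathfrak V$, and let $\mathcal H_{\mathfrak V}$ be the operator in $L^2(\mathcal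 G)$ associated with the quadratic form $f\mapsto\int_{\mathcal G}|f'|^2\,dx$ with domain $H^1_0(\mathcal G;\mathfrak V)$. **Theorem.** Let $\mathcal G$ be a locally finite, connected metric graph of finite total length $L=\sum_e\ell_e>0$, and let $\emptyset\neq\mathfrak V\subset V\cup\mathfrak C(\mathcal G)$. Then $\mathcal H_{\mathfrak V}$ has a lowest eigenvalue $\lambda_1(\mathcal G,\mathfrak V)$, and $$\lambda_1(\mathcal G,\mathfrak V)\ \ge\ \frac{\pi^2}{4L^2}.$$ Equality holds if and only if $\mathcal G$ is isometric to an interval of length $L$ (which may lack one or both of its endpoints, a missing endpoint being an end of $\mathcal G$) with mixed Dirichlet–Neumann conditions, that is, $\mathfrak V$ consists of exactly one element, and this is the vertex or end located at one of the two endpoints of the interval. -/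

import Mathlib

open MeasureTheory Filter Topology Set
open scoped ENNReal NNReal

/-- A metric graph on the edge set `E`: every edge `e` is the compact interval `[0, ℓ_e]` with
`0 < ℓ_e < ∞`, and `glue` is an arbitrary equivalence relation on the set of all edge endpoints.
The endpoint `0` of `e` is encoded as `(e, false)` and the endpoint `ℓ_e` as `(e, true)`.
Loops and parallel edges are allowed. -/
structure MetricGraph (E : Type*) where
  length : E → ℝ
  length_pos : ∀ e, 0 < length e
  glue : Setoid (E × Bool)

/-- A sequence of nonempty open connected sets with compact boundaries, decreasing, whose closures
have empty intersection: a representative of a topological end. -/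
structure EndSeq (X : Type*) [TopologicalSpace X] where
  U : ℕ → Set X
  isOpen : ∀ n, IsOpen (U n)
  isConnected : ∀ n, IsConnected (U n)
  compact_frontier : ∀ n, IsCompact (frontier (U n))
  mono : ∀ n, U (n + 1) ⊆ U n
  iInter_closure : ⋂ n, closure (U n) = ∅

namespace EndSeq

/-- Two sequences represent the same end if every member of either one contains a member of the
other one. -/
def setoid (X : Type*) [TopologicalSpace X] : Setoid (EndSeq X) where
  r A B := (∀ n, ∃ j, B.U j ⊆ A.U n) ∧ ∀ n, ∃ k, A.U k ⊆ B.U n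
  iseqv :=
    { refl := fun _ => ⟨fun n => ⟨n, subset_rfl⟩, fun n => ⟨n, subset_rfl⟩⟩
      symm := fun h => ⟨h.2, h.1⟩
      trans := fun {A B C} h h' => by
        refine ⟨fun n => ?_, fun n => ?_⟩
        · obtain ⟨j, hj⟩ := h.1 n
          obtain ⟨k, hk⟩ := h'.1 j
          exact ⟨k, hk.trans hj⟩
        · obtain ⟨j, hj⟩ := h'.2 n
          obtain ⟨k, hk⟩ := h.2 j
          exact ⟨k, hk.trans hj⟩ }

/-- The filter generated by the sets `U n`. -/
def filter {X : Type*} [TopologicalSpace X] (A : EndSeq X) : Filter X := ⨅ n, 𝓟 (A.U n)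

theorem filter_eq {X : Type*} [TopologicalSpace X] {A B : EndSeq X}
    (h : (setoid X).r A B) : A.filter = B.filter := by
  apply le_antisymm
  · refine le_iInf fun n => ?_
    obtain ⟨k, hk⟩ := h.2 n
    exact (iInf_le _ k).trans (principal_mono.2 hk)
  · refine le_iInf fun n => ?_
    obtain ⟨k, hk⟩ := h.1 n
    exact (iInf_le _ k).trans (principal_mono.2 hk)

end EndSeq

/-- The set of topological ends of `X`. -/
def TopEnd (X : Type*) [TopologicalSpace X] : Type _ := Quotient (EndSeq.setoid X)

/-- The filter of approach to an end. -/
def TopEnd.filter {X : Type*} [TopologicalSpace X] (γ : TopEnd X) : Filter X :=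
  Quotient.lift (s := EndSeq.setoid X) EndSeq.filter (fun _ _ h => EndSeq.filter_eq h) γ

namespace MetricGraph

variable {E : Type*} (G : MetricGraph E)

/-- The disjoint union of the edges `[0, ℓ_e]`. -/
abbrev PrePoint : Type _ := Σ e : E, Icc (0 : ℝ) (G.length e)

/-- The point of the disjoint union of edges that an edge endpoint is. -/
def endpoint (a : E × Bool) : G.PrePoint :=
  match a with
  | (e, false) => ⟨e, ⟨0, le_rfl, (G.length_pos e).le⟩⟩
  | (e, true) => ⟨e, ⟨G.length e, (G.length_pos e).le, le_rfl⟩⟩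

theorem endpoint_injective : Function.Injective G.endpoint := by
  rintro ⟨e, b⟩ ⟨e', b'⟩ h
  have he : e = e' := by
    have := congrArg Sigma.fst h
    cases b <;> cases b' <;> simpa [endpoint] using this
  subst he
  have hp := (G.length_pos e).ne
  cases b <;> cases b'
  · rfl
  · exact absurd (congrArg Subtype.val (eq_of_heq (Sigma.mk.inj h).2)) hp
  · exact absurd (congrArg Subtype.val (eq_of_heq (Sigma.mk.inj h).2)) hp.symm
  · rfl

/-- The extension of the gluing relation from the edge endpoints to the disjoint union of all
edges: nothing but endpoints is identified. -/
def pointSetoid : Setoid G.PrePoint where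
  r p q := p = q ∨ ∃ a b, G.endpoint a = p ∧ G.endpoint b = q ∧ G.glue.r a b
  iseqv :=
    { refl := fun _ => Or.inl rfl
      symm := by
        rintro p q (h | ⟨a, b, ha, hb, h⟩)
        · exact Or.inl h.symm
        · exact Or.inr ⟨b, a, hb, ha, G.glue.symm h⟩
      trans := by
        rintro p q r (rfl | ⟨a, b, ha, hb, h⟩) h'
        · exact h'
        · rcases h' with rfl | ⟨c, d, hc, hd, h'⟩
          · exact Or.inr ⟨a, b, ha, hb, h⟩
          · have : b = c := G.endpoint_injective (hb.trans hc.symm)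
            subst this
            exact Or.inr ⟨a, d, ha, hd, G.glue.trans h h'⟩ }

/-- The points of the metric graph. -/
def Point : Type _ := Quotient G.pointSetoid

/-- The vertices: classes of identified edge endpoints. -/
def Vertex : Type _ := Quotient G.glue

/-- The point at position `t` on the edge `e`. -/
def pt (e : E) (t : Icc (0 : ℝ) (G.length e)) : G.Point :=
  Quotient.mk G.pointSetoid ⟨e, t⟩

/-- A vertex as a point of the graph. -/
def vertexPoint (v : G.Vertex) : G.Point :=
  Quotient.lift (s := G.glue) (fun a => Quotient.mk G.pointSetoid (G.endpoint a))
    (fun a b h => Quotient.sound (s := G.pointSetoid) (Or.inr ⟨a, b, rfl, rfl, h⟩)) v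

/-- `G.Chain x y c`: there is a finite chain of segments, each inside one edge and each starting at
the point where the previous one stops, that leads from `x` to `y` and has total length `c`. -/
inductive Chain : G.Point → G.Point → ℝ≥0 → Prop
  | nil (x : G.Point) : Chain x x 0
  | cons (e : E) (s t : Icc (0 : ℝ) (G.length e)) (y : G.Point) (c : ℝ≥0)
      (h : Chain (G.pt e t) y c) : Chain (G.pt e s) y (nndist s t + c)

variable {G}

theorem Chain.trans {x y z : G.Point} {c d : ℝ≥0} (h : G.Chain x y c) (h' : G.Chain y z d) :
    G.Chain x z (c + d) := by
  induction h with
  | nil x => simpa using h'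
  | cons e s t y c _ ih => rw [add_assoc]; exact Chain.cons e s t z _ (ih h')

theorem Chain.symm {x y : G.Point} {c : ℝ≥0} (h : G.Chain x y c) : G.Chain y x c := by
  induction h with
  | nil x => exact Chain.nil x
  | cons e s t y c _ ih =>
    have h1 : G.Chain (G.pt e t) (G.pt e s) (nndist t s + 0) :=
      Chain.cons e t s _ 0 (Chain.nil _)
    have h2 := ih.trans h1
    rwa [add_zero, nndist_comm, add_comm] at h2

variable (G)

/-- The distance of two points: the infimum of the lengths of the chains that connect them
(`∞` if there is none). -/
noncomputable instance : PseudoEMetricSpace G.Point where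
  edist x y := ⨅ (c : ℝ≥0) (_ : G.Chain x y c), (c : ℝ≥0∞)
  edist_self x := le_antisymm (iInf₂_le_of_le 0 (Chain.nil x) (by simp)) bot_le
  edist_comm x y := by
    apply le_antisymm <;>
      exact le_iInf₂ fun c h => iInf₂_le_of_le c h.symm le_rfl
  edist_triangle x y z := by
    simp only [ENNReal.iInf_add, ENNReal.add_iInf]
    refine le_iInf fun c => le_iInf fun h => le_iInf fun d => le_iInf fun h' => ?_
    exact iInf₂_le_of_le _ (h'.trans h) (by simp)

/-- Every vertex has finite degree (a loop counts twice). -/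
def LocallyFinite : Prop := ∀ v : G.Vertex, {a : E × Bool | Quotient.mk G.glue a = v}.Finite

/-- Any two points have finite distance. -/
def Connected : Prop := ∀ x y : G.Point, edist x y ≠ ∞

/-- The ends of the graph, with respect to the topology of the graph metric. -/
abbrev End : Type _ := TopEnd G.Point

/-- The restriction of `f` to the edge `e`, as a function on `[0, ℓ_e]` (extended to `ℝ` by
constants, which is irrelevant below). -/
noncomputable def onEdge (f : G.Point → ℝ) (e : E) (t : ℝ) : ℝ :=
  f (G.pt e (projIcc 0 (G.length e) (G.length_pos e).le t))

/-- `g` is a square integrable function on the graph. -/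
def MemL2 (g : G.Point → ℝ) : Prop :=
  (∀ e, MemLp (G.onEdge g e) 2 (volume.restrict (Icc 0 (G.length e)))) ∧
    Summable fun e => ∫ t in (0 : ℝ)..G.length e, G.onEdge g e t ^ 2

/-- The Sobolev space `H¹`: continuous functions on the graph that are absolutely continuous on
every edge, with square integrable derivative there, and whose squared `H¹`-norms on the edges are
summable. -/
def MemH1 (f : G.Point → ℝ) : Prop :=
  Continuous f ∧
  (∀ e, AbsolutelyContinuousOnInterval (G.onEdge f e) 0 (G.length e) ∧
    MemLp (deriv (G.onEdge f e)) 2 (volume.restrict (Icc 0 (G.length e)))) ∧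
  Summable fun e =>
    ∫ t in (0 : ℝ)..G.length e, (G.onEdge f e t ^ 2 + deriv (G.onEdge f e) t ^ 2)

/-- `f` takes the value `c` at a vertex or (in the sense of its extension by continuity) at an
end. -/
def HasValueAt (f : G.Point → ℝ) (p : G.Vertex ⊕ G.End) (c : ℝ) : Prop :=
  match p with
  | Sum.inl v => f (G.vertexPoint v) = c
  | Sum.inr γ => Tendsto f γ.filter (𝓝 c)

/-- The form domain `H¹₀(G; 𝔙)`: functions in `H¹` that vanish at each vertex and end in `D`. -/
def MemH10 (D : Set (G.Vertex ⊕ G.End)) (f : G.Point → ℝ) : Prop :=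
  G.MemH1 f ∧ ∀ p ∈ D, G.HasValueAt f p 0

/-- The `L²` inner product. -/
noncomputable def innerL2 (f g : G.Point → ℝ) : ℝ :=
  ∑' e, ∫ t in (0 : ℝ)..G.length e, G.onEdge f e t * G.onEdge g e t

/-- The Dirichlet form `∫ f' g'`. -/
noncomputable def dirichletForm (f g : G.Point → ℝ) : ℝ :=
  ∑' e, ∫ t in (0 : ℝ)..G.length e, deriv (G.onEdge f e) t * deriv (G.onEdge g e) t

/-- The graph of the operator that the Dirichlet form with domain `H¹₀(G; 𝔙)` induces in `L²`, the
Laplacian with mixed conditions: `f` is in its domain and is mapped to `g` if and only if `f` is in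
the form domain, `g` is in `L²`, and `∫ f' h' = ∫ g h` for all `h` in the form domain. -/
def MixedLaplacian (D : Set (G.Vertex ⊕ G.End)) (f g : G.Point → ℝ) : Prop :=
  G.MemH10 D f ∧ G.MemL2 g ∧ ∀ h, G.MemH10 D h → G.dirichletForm f h = G.innerL2 g h

/-- The eigenvalues of the Laplacian with mixed conditions. -/
def mixedEigenvalues (D : Set (G.Vertex ⊕ G.End)) : Set ℝ :=
  {lam | ∃ f : G.Point → ℝ, f ≠ 0 ∧ G.MixedLaplacian D f (fun x => lam * f x)}

/-- The graph is isometric to an interval of length `L` (which may lack one or both of its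
endpoints), with a Dirichlet condition at exactly one of the two endpoints `0`, `L` and nowhere
else: `D` consists of a single vertex or end, and this one sits at the endpoint `0` (after a
reflection, if necessary). -/
def IsDirichletNeumannInterval (D : Set (G.Vertex ⊕ G.End)) (L : ℝ) : Prop :=
  ∃ (I : Set ℝ) (φ : G.Point ≃ᵢ I) (p : G.Vertex ⊕ G.End),
    Ioo 0 L ⊆ I ∧ I ⊆ Icc 0 L ∧ D = {p} ∧ G.HasValueAt (fun x => (φ x : ℝ)) p 0

end MetricGraph

/-! Let M(t) be the volume of {|f| > t}, S = sup |f|, and l = M(0) ≤ L. Since f is continuous, the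
graph is connected and 0 is a value or a limit value of f, |f| takes every value in (0, S). Hence
the push-forward of |f'| dx under |f| dominates Lebesgue measure on (0, S): a coarea inequality in
which each level counts at least once (`restrict_Ioo_le_variation`).

On the model interval the ground state, as a function of the volume m of its superlevel set, is
cos(km) with k = π/(2l), and its slope at level t is c(t) = t · k tan(k M(t)). This c calibrates
every f: integrating 2 c(|f|)|f'| ≤ |f'|² + c(|f|)² and using the coarea inequality gives 2∫₀^S c dt
≤ ∫|f'|² + ∫c(|f|)². As g(m) = k tan(km) solves g' = k² + g², Tonelli and the decreasing
rearrangement q turn the left side into ∫₀^l q²(k² + k² tan²(km)) dm, while ∫c(|f|)² = ∫₀^l q² k²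
tan²(k M(q)) dm with M(q(m)) ≤ m. What survives is k²∫f² ≤ ∫|f'|² plus two nonnegative remainders
(`sharp_inequality`).

A minimizer of the Rayleigh quotient exists by the direct method. The bound sup |f|² ≤ L∫|f'|² makes
energy convergence uniform, so boundary conditions at ends survive in the limit
(`memH10_of_tendsto`).

Equality kills the remainders: level sets are null and the variation is exactly Lebesgue measure
(`level_and_variation_of_eq`). Then the volume of {|f| ≤ |f(x)|} is a one-Lipschitz function of x
whose range fills (0, L). Such a map has no length to waste, so it is injective and isometric
(`EdgeLipschitz.isometry`), and only one vertex or end can sit at 0. Conversely, the sine of the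
interval coordinate attains the bound. -/

namespace MetricGraph

/-! ### Edge coordinates: L² and H¹ of the graph over a single measure space -/

/-- The disjoint union of one real line for each edge. -/
abbrev Lines (E : Type*) : Type _ := (_ : E) × ℝ

theorem measurable_lines_iff {E α : Type*} [MeasurableSpace α] {f : Lines E → α} :
    Measurable f ↔ ∀ e, Measurable fun t : ℝ => f ⟨e, t⟩ := by
  constructor
  · intro h e s hs
    have := h hs
    exact (MeasurableSpace.measurableSet_iInf.1 this) e
  · intro h s hs
    exact MeasurableSpace.measurableSet_iInf.2 fun e => h e hs

/-- The line that belongs to the edge `e`. -/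
abbrev line {E : Type*} (e : E) (t : ℝ) : Lines E := ⟨e, t⟩

theorem measurableSet_lines_iff {E : Type*} {s : Set (Lines E)} :
    MeasurableSet s ↔ ∀ e, MeasurableSet (line e ⁻¹' s) :=
  MeasurableSpace.measurableSet_iInf

theorem line_injective {E : Type*} (e : E) : Function.Injective (line e) :=
  fun _ _ h => eq_of_heq (Sigma.mk.inj h).2

theorem measurable_line {E : Type*} (e : E) : Measurable (line e) :=
  measurable_lines_iff.1 measurable_id e

theorem measurableEmbedding_line {E : Type*} (e : E) : MeasurableEmbedding (line e) where
  injective := line_injective e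
  measurable := measurable_line e
  measurableSet_image' := by
    intro s hs
    rw [measurableSet_lines_iff]
    intro e'
    by_cases h : e = e'
    · subst h
      rwa [preimage_image_eq _ (line_injective e)]
    · convert MeasurableSet.empty
      ext t
      simp only [mem_preimage, mem_image, mem_empty_iff_false, iff_false]
      rintro ⟨x, _, hx⟩
      exact h (congrArg Sigma.fst hx)

variable {E : Type*} (G : MetricGraph E)

/-- Lebesgue measure on the disjoint union of the edges. -/
noncomputable def vol : Measure (Lines E) :=
  Measure.sum fun e => (volume.restrict (Icc 0 (G.length e))).map (line e)

/-- The point of the graph with given edge coordinates. -/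
noncomputable def toPoint (x : Lines E) : G.Point :=
  G.pt x.1 (projIcc 0 (G.length x.1) (G.length_pos x.1).le x.2)

/-- A function on the graph in edge coordinates. -/
noncomputable def lift (f : G.Point → ℝ) (x : Lines E) : ℝ := f (G.toPoint x)

/-- The derivative of a function on the graph in edge coordinates. -/
noncomputable def der (f : G.Point → ℝ) (x : Lines E) : ℝ := deriv (G.onEdge f x.1) x.2

variable {G}

theorem vol_apply [Countable E] (s : Set (Lines E)) :
    G.vol s = ∑' e, volume (line e ⁻¹' s ∩ Icc 0 (G.length e)) := by
  rw [vol, Measure.sum_apply_of_countable]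
  congr with e
  rw [(measurableEmbedding_line e).map_apply, Measure.restrict_apply' measurableSet_Icc]

theorem lintegral_vol (F : Lines E → ℝ≥0∞) :
    ∫⁻ x, F x ∂G.vol = ∑' e, ∫⁻ t in Icc 0 (G.length e), F ⟨e, t⟩ := by
  rw [vol, lintegral_sum_measure]
  congr with e
  rw [(measurableEmbedding_line e).lintegral_map]

theorem ae_vol_iff [Countable E] {p : Lines E → Prop} :
    (∀ᵐ x ∂G.vol, p x) ↔ ∀ e, ∀ᵐ t ∂volume.restrict (Icc 0 (G.length e)), p ⟨e, t⟩ := by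
  rw [vol, Measure.ae_sum_iff]
  exact forall_congr' fun e => (measurableEmbedding_line e).ae_map_iff

theorem aestronglyMeasurable_vol_iff [Countable E] {F : Lines E → ℝ} :
    AEStronglyMeasurable F G.vol ↔
      ∀ e, AEStronglyMeasurable (fun t => F ⟨e, t⟩) (volume.restrict (Icc 0 (G.length e))) := by
  rw [vol, aestronglyMeasurable_sum_measure_iff]
  exact forall_congr' fun e => (measurableEmbedding_line e).aestronglyMeasurable_map_iff

theorem integral_map_line (e : E) (F : Lines E → ℝ) :
    ∫ x, F x ∂(volume.restrict (Icc 0 (G.length e))).map (line e) =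
      ∫ t in (0 : ℝ)..G.length e, F ⟨e, t⟩ := by
  rw [(measurableEmbedding_line e).integral_map,
    intervalIntegral.integral_of_le (G.length_pos e).le, integral_Icc_eq_integral_Ioc]

theorem integrable_vol_iff [Countable E] {F : Lines E → ℝ} :
    Integrable F G.vol ↔ (∀ e, IntegrableOn (fun t => F ⟨e, t⟩) (Icc 0 (G.length e))) ∧
      Summable fun e => ∫ t in (0 : ℝ)..G.length e, ‖F ⟨e, t⟩‖ := by
  rw [vol, integrable_sum_measure_iff]
  refine and_congr (forall_congr' fun e =>
    (measurableEmbedding_line e).integrable_map_iff) ?_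
  exact summable_congr fun e => integral_map_line e fun x => ‖F x‖

theorem hasSum_integral_vol {F : Lines E → ℝ} (hF : Integrable F G.vol) :
    HasSum (fun e => ∫ t in (0 : ℝ)..G.length e, F ⟨e, t⟩) (∫ x, F x ∂G.vol) := by
  have h := hasSum_integral_measure hF
  simp only [integral_map_line] at h
  exact h

theorem memLp_two_vol_iff [Countable E] {F : Lines E → ℝ} :
    MemLp F 2 G.vol ↔
      (∀ e, MemLp (fun t => F ⟨e, t⟩) 2 (volume.restrict (Icc 0 (G.length e)))) ∧
      Summable fun e => ∫ t in (0 : ℝ)..G.length e, F ⟨e, t⟩ ^ 2 := by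
  constructor
  · intro h
    have h1 := aestronglyMeasurable_vol_iff.1 h.1
    have h2 := integrable_vol_iff.1 ((memLp_two_iff_integrable_sq h.1).1 h)
    refine ⟨fun e => (memLp_two_iff_integrable_sq (h1 e)).2 (h2.1 e), ?_⟩
    simpa using h2.2
  · rintro ⟨h1, h2⟩
    have hm : AEStronglyMeasurable F G.vol := aestronglyMeasurable_vol_iff.2 fun e => (h1 e).1
    refine (memLp_two_iff_integrable_sq hm).2 (integrable_vol_iff.2 ⟨fun e => ?_, ?_⟩)
    · exact (memLp_two_iff_integrable_sq (h1 e).1).1 (h1 e)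
    · simpa using h2

theorem vol_univ [Countable E] {L : ℝ} (hL : HasSum G.length L) :
    G.vol univ = ENNReal.ofReal L := by
  rw [vol_apply]
  simp only [preimage_univ, univ_inter, Real.volume_Icc, sub_zero]
  rw [← ENNReal.ofReal_tsum_of_nonneg (fun e => (G.length_pos e).le) hL.summable, hL.tsum_eq]

theorem isFiniteMeasure_vol [Countable E] {L : ℝ} (hL : HasSum G.length L) :
    IsFiniteMeasure G.vol :=
  ⟨by rw [vol_univ hL]; exact ENNReal.ofReal_lt_top⟩

theorem memL2_iff [Countable E] {g : G.Point → ℝ} : G.MemL2 g ↔ MemLp (G.lift g) 2 G.vol :=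
  (memLp_two_vol_iff (F := G.lift g)).symm

theorem innerL2_eq {f g : G.Point → ℝ} (hf : MemLp (G.lift f) 2 G.vol)
    (hg : MemLp (G.lift g) 2 G.vol) : G.innerL2 f g = ∫ x, G.lift f x * G.lift g x ∂G.vol :=
  (hasSum_integral_vol (hf.integrable_mul hg)).tsum_eq

theorem dirichletForm_eq {f g : G.Point → ℝ} (hf : MemLp (G.der f) 2 G.vol)
    (hg : MemLp (G.der g) 2 G.vol) :
    G.dirichletForm f g = ∫ x, G.der f x * G.der g x ∂G.vol :=
  (hasSum_integral_vol (hf.integrable_mul hg)).tsum_eq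

/-- Splits the joint summability condition into two L² memberships. Square integrability of f on a
single edge is automatic, by continuity on a compact interval. -/
theorem memH1_iff [Countable E] {f : G.Point → ℝ} : G.MemH1 f ↔ Continuous f ∧
    (∀ e, AbsolutelyContinuousOnInterval (G.onEdge f e) 0 (G.length e)) ∧
    MemLp (G.lift f) 2 G.vol ∧ MemLp (G.der f) 2 G.vol := by
  have key : ∀ e, AbsolutelyContinuousOnInterval (G.onEdge f e) 0 (G.length e) →
      MemLp (G.onEdge f e) 2 (volume.restrict (Icc 0 (G.length e))) := by
    intro e h
    have hc := h.continuousOn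
    rw [uIcc_of_le (G.length_pos e).le] at hc
    have hm := hc.aestronglyMeasurable (μ := volume) measurableSet_Icc
    exact (memLp_two_iff_integrable_sq hm).2 ((hc.pow 2).integrableOn_Icc)
  constructor
  · rintro ⟨h1, h2, h3⟩
    have hi1 : ∀ e, IntervalIntegrable (fun t => G.onEdge f e t ^ 2) volume 0 (G.length e) :=
      fun e => (intervalIntegrable_iff_integrableOn_Icc_of_le (G.length_pos e).le).2
        (key e (h2 e).1).integrable_sq
    have hi2 : ∀ e, IntervalIntegrable (fun t => deriv (G.onEdge f e) t ^ 2) volume 0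
        (G.length e) :=
      fun e => (intervalIntegrable_iff_integrableOn_Icc_of_le (G.length_pos e).le).2
        (h2 e).2.integrable_sq
    have hn : ∀ (e : E) (F : ℝ → ℝ), 0 ≤ ∫ t in (0 : ℝ)..G.length e, F t ^ 2 := fun e F =>
      intervalIntegral.integral_nonneg (G.length_pos e).le fun t _ => sq_nonneg _
    have h4 : Summable fun e => (∫ t in (0 : ℝ)..G.length e, G.onEdge f e t ^ 2) +
        ∫ t in (0 : ℝ)..G.length e, deriv (G.onEdge f e) t ^ 2 := by
      refine h3.congr fun e => ?_
      rw [intervalIntegral.integral_add (hi1 e) (hi2 e)]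
    refine ⟨h1, fun e => (h2 e).1, memLp_two_vol_iff.2 ⟨fun e => key e (h2 e).1, ?_⟩,
      memLp_two_vol_iff.2 ⟨fun e => (h2 e).2, ?_⟩⟩
    · exact Summable.of_nonneg_of_le (fun e => hn e _)
        (fun e => le_add_of_nonneg_right (hn e _)) h4
    · exact Summable.of_nonneg_of_le (fun e => hn e _)
        (fun e => le_add_of_nonneg_left (hn e _)) h4
  · rintro ⟨h1, h2, h3, h4⟩
    have h3' := memLp_two_vol_iff.1 h3
    have h4' := memLp_two_vol_iff.1 h4
    refine ⟨h1, fun e => ⟨h2 e, h4'.1 e⟩, (h3'.2.add h4'.2).congr fun e => ?_⟩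
    rw [← intervalIntegral.integral_add]
    · rfl
    · exact (intervalIntegrable_iff_integrableOn_Icc_of_le (G.length_pos e).le).2
        (h3'.1 e).integrable_sq
    · exact (intervalIntegrable_iff_integrableOn_Icc_of_le (G.length_pos e).le).2
        (h4'.1 e).integrable_sq

/-- Almost everywhere on the edges, a function that is absolutely continuous on the edges is
differentiable. -/
theorem ae_hasDerivAt [Countable E] {f : G.Point → ℝ}
    (hf : ∀ e, AbsolutelyContinuousOnInterval (G.onEdge f e) 0 (G.length e)) :
    ∀ᵐ x ∂G.vol, HasDerivAt (G.onEdge f x.1) (G.der f x) x.2 := by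
  rw [ae_vol_iff]
  intro e
  rw [ae_restrict_iff' measurableSet_Icc]
  filter_upwards [(hf e).ae_differentiableAt] with t ht h
  rw [uIcc_of_le (G.length_pos e).le] at ht
  exact (ht h).hasDerivAt

end MetricGraph

/-! ### Ends as filters -/

namespace EndSeq

variable {X : Type*} [TopologicalSpace X] (A : EndSeq X)

theorem antitone : Antitone A.U := antitone_nat_of_succ_le A.mono

theorem hasBasis_filter : A.filter.HasBasis (fun _ : ℕ => True) A.U :=
  hasBasis_iInf_principal (directed_of_isDirected_le A.antitone)

theorem mem_filter (n : ℕ) : A.U n ∈ A.filter := A.hasBasis_filter.mem_of_mem trivial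

theorem neBot_filter : A.filter.NeBot :=
  A.hasBasis_filter.neBot_iff.2 fun {i} _ => (A.isConnected i).nonempty

/-- Cantor's intersection argument: the closures of the `U n` decrease to the empty set, so one of
them misses K. Thus a function with compact support vanishes near every end. -/
theorem compl_mem_filter {K : Set X} (hK : IsCompact K) : Kᶜ ∈ A.filter := by
  obtain ⟨n, hn⟩ := hK.elim_directed_family_closed (fun n => closure (A.U n))
    (fun n => isClosed_closure) (by rw [A.iInter_closure, inter_empty])
    (directed_of_isDirected_le fun m n h => closure_mono (A.antitone h))
  refine mem_of_superset (A.mem_filter n) fun x hx hxK => ?_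
  exact (hn.subset ⟨hxK, subset_closure hx⟩ : x ∈ (∅ : Set X))

end EndSeq

namespace TopEnd

variable {X : Type*} [TopologicalSpace X]

theorem neBot_filter (γ : TopEnd X) : γ.filter.NeBot :=
  Quotient.inductionOn (s := EndSeq.setoid X) γ fun A => A.neBot_filter

theorem compl_mem_filter (γ : TopEnd X) {K : Set X} (hK : IsCompact K) : Kᶜ ∈ γ.filter :=
  Quotient.inductionOn (s := EndSeq.setoid X) γ fun A => A.compl_mem_filter hK

end TopEnd

/-! ### Topology of the graph and Lipschitz functions -/

namespace MetricGraph

variable {E : Type*} {G : MetricGraph E}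

theorem exists_pt_eq (x : G.Point) : ∃ e t, G.pt e t = x :=
  Quotient.inductionOn (s := G.pointSetoid) x fun p => ⟨p.1, p.2, rfl⟩

theorem edist_le_of_chain {x y : G.Point} {c : ℝ≥0} (h : G.Chain x y c) : edist x y ≤ c :=
  iInf₂_le c h

theorem edist_pt_le (e : E) (s t : Icc (0 : ℝ) (G.length e)) :
    edist (G.pt e s) (G.pt e t) ≤ edist s t := by
  have := edist_le_of_chain (Chain.cons e s t _ 0 (Chain.nil (G.pt e t)))
  rwa [add_zero, ← edist_nndist] at this

theorem continuous_pt (e : E) : Continuous (G.pt e) :=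
  (LipschitzWith.of_edist_le (edist_pt_le e)).continuous

theorem toPoint_line (e : E) (t : Icc (0 : ℝ) (G.length e)) :
    G.toPoint (line e t) = G.pt e t := by
  simp [toPoint, projIcc_val]

theorem exists_toPoint_eq (x : G.Point) :
    ∃ e, ∃ t ∈ Icc 0 (G.length e), G.toPoint (line e t) = x := by
  obtain ⟨e, t, rfl⟩ := exists_pt_eq x
  exact ⟨e, t, t.2, toPoint_line e t⟩

theorem continuous_toPoint_line (e : E) : Continuous fun t => G.toPoint (line e t) :=
  by
  change Continuous (G.pt e ∘ projIcc 0 (G.length e) (G.length_pos e).le)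
  exact (continuous_pt e).comp continuous_projIcc

theorem continuous_onEdge {f : G.Point → ℝ} (hf : Continuous f) (e : E) :
    Continuous (G.onEdge f e) :=
  hf.comp (continuous_toPoint_line e)

theorem measurable_lift {f : G.Point → ℝ} (hf : Continuous f) : Measurable (G.lift f) :=
  measurable_lines_iff.2 fun e => (continuous_onEdge hf e).measurable

theorem Connected.exists_chain (hconn : G.Connected) (x y : G.Point) : ∃ c, G.Chain x y c := by
  by_contra! h
  exact hconn x y (by simp [edist, h])

/-- A chain is covered by finitely many edges, consecutive ones sharing a point, and each edge is a
continuous image of an interval. -/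
theorem Connected.preconnectedSpace (hconn : G.Connected) : PreconnectedSpace G.Point := by
  refine ⟨isPreconnected_of_forall_pair ?_⟩
  rintro x - y -
  suffices H : ∃ t, x ∈ t ∧ y ∈ t ∧ IsPreconnected t by
    obtain ⟨t, h1, h2, h3⟩ := H
    exact ⟨t, subset_univ _, h1, h2, h3⟩
  obtain ⟨c, h⟩ := hconn.exists_chain x y
  induction h with
  | nil x => exact ⟨{x}, rfl, rfl, isPreconnected_singleton⟩
  | cons e s t y c _ ih =>
    obtain ⟨u, h1, h2, h3⟩ := ih
    have : PreconnectedSpace (Icc (0 : ℝ) (G.length e)) :=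
      Subtype.preconnectedSpace isPreconnected_Icc
    refine ⟨range (G.pt e) ∪ u, Or.inl ⟨s, rfl⟩, Or.inr h2, ?_⟩
    exact IsPreconnected.union (G.pt e t) ⟨t, rfl⟩ h1
      (isPreconnected_range (continuous_pt e)) h3

/-- A function is Lipschitz on every edge. -/
def EdgeLipschitz (K : ℝ≥0) (f : G.Point → ℝ) : Prop :=
  ∀ e (s t : Icc (0 : ℝ) (G.length e)), |f (G.pt e s) - f (G.pt e t)| ≤ K * |(s : ℝ) - t|

theorem EdgeLipschitz.abs_sub_le_of_chain {K : ℝ≥0} {f : G.Point → ℝ} (hf : EdgeLipschitz K f)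
    {x y : G.Point} {c : ℝ≥0} (h : G.Chain x y c) : |f x - f y| ≤ K * c := by
  induction h with
  | nil x => simp
  | cons e s t y c _ ih =>
    have h1 := hf e s t
    have h2 : ((nndist s t : ℝ≥0) : ℝ) = |(s : ℝ) - t| := rfl
    rw [NNReal.coe_add, h2, mul_add]
    exact (abs_sub_le _ _ _).trans (add_le_add h1 ih)

theorem EdgeLipschitz.lipschitzWith {K : ℝ≥0} {f : G.Point → ℝ} (hf : EdgeLipschitz K f)
    (hconn : G.Connected) : LipschitzWith K f := by
  intro x y
  -- The factor K passes into the infimum only if K ≠ 0: the inner infimum over a failing condition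
  -- is ∞, and 0 · ∞ = 0.
  rcases eq_or_ne K 0 with rfl | hK
  · obtain ⟨c, hc⟩ := hconn.exists_chain x y
    have h0 := hf.abs_sub_le_of_chain hc
    simp only [NNReal.coe_zero, zero_mul, abs_nonpos_iff] at h0
    simp [sub_eq_zero.1 h0]
  · change _ ≤ (K : ℝ≥0∞) * ⨅ (c : ℝ≥0) (_ : G.Chain x y c), (c : ℝ≥0∞)
    have hK' : (K : ℝ≥0∞) ≠ 0 := by simpa using hK
    simp only [ENNReal.mul_iInf_of_ne hK' ENNReal.coe_ne_top]
    refine le_iInf₂ fun c hc => ?_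
    rw [← ENNReal.coe_mul, edist_nndist, ENNReal.coe_le_coe, ← NNReal.coe_le_coe, coe_nndist]
    exact hf.abs_sub_le_of_chain hc

theorem EdgeLipschitz.lipschitzWith_onEdge {K : ℝ≥0} {f : G.Point → ℝ} (hf : EdgeLipschitz K f)
    (e : E) : LipschitzWith K (G.onEdge f e) := by
  have h1 : LipschitzWith K fun t => f (G.pt e t) := LipschitzWith.of_dist_le_mul fun s t => hf e s t
  have h2 := h1.comp (LipschitzWith.projIcc (G.length_pos e).le)
  rwa [mul_one] at h2

theorem edgeLipschitz_of_lipschitzWith {K : ℝ≥0} {f : G.Point → ℝ} (hf : LipschitzWith K f) :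
    EdgeLipschitz K f := by
  intro e s t
  have h := (hf.comp (LipschitzWith.of_edist_le (edist_pt_le e))).dist_le_mul s t
  rwa [mul_one] at h

/-- A function of Lipschitz constant one on the edges does not increase volume. -/
theorem EdgeLipschitz.volume_image_le [Countable E] {f : G.Point → ℝ} (hf : EdgeLipschitz 1 f)
    (A : Set G.Point) : volume (f '' A) ≤ G.vol (G.toPoint ⁻¹' A) := by
  have h1 : f '' A ⊆ ⋃ e, G.onEdge f e '' (line e ⁻¹' (G.toPoint ⁻¹' A) ∩ Icc 0 (G.length e)) := by
    rintro _ ⟨x, hx, rfl⟩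
    obtain ⟨e, t, ht, rfl⟩ := exists_toPoint_eq x
    exact mem_iUnion.2 ⟨e, t, ⟨hx, ht⟩, rfl⟩
  refine (measure_mono h1).trans ((measure_iUnion_le _).trans ?_)
  rw [vol_apply]
  refine ENNReal.tsum_le_tsum fun e => ?_
  -- One-dimensional Hausdorff measure is Lebesgue measure on the line and does not grow under
  -- one-Lipschitz maps; no measurability of A is needed.
  have h2 := ((hf.lipschitzWith_onEdge e).lipschitzOnWith
    (s := line e ⁻¹' (G.toPoint ⁻¹' A) ∩ Icc 0 (G.length e))).hausdorffMeasure_image_le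
    (d := 1) zero_le_one
  simpa [hausdorffMeasure_real] using h2

end MetricGraph

/-! ### Variation and the coarea inequality -/

theorem AbsolutelyContinuousOnInterval.of_dist_le {f g : ℝ → ℝ} {a b : ℝ}
    (hf : AbsolutelyContinuousOnInterval f a b) (h : ∀ x y, dist (g x) (g y) ≤ dist (f x) (f y)) :
    AbsolutelyContinuousOnInterval g a b := by
  rw [absolutelyContinuousOnInterval_iff] at hf ⊢
  intro ε hε
  obtain ⟨δ, hδ, H⟩ := hf ε hε
  exact ⟨δ, hδ, fun I hI hI' => (Finset.sum_le_sum fun i _ => h _ _).trans_lt (H I hI hI')⟩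

theorem HasDerivAt.norm_le_of_dist_le {f g : ℝ → ℝ} {f' g' x : ℝ} (hf : HasDerivAt f f' x)
    (hg : HasDerivAt g g' x) (h : ∀ y, dist (g y) (g x) ≤ dist (f y) (f x)) : ‖g'‖ ≤ ‖f'‖ := by
  refine le_of_tendsto_of_tendsto' hg.tendsto_slope.norm hf.tendsto_slope.norm fun y => ?_
  rw [slope_def_field, slope_def_field, norm_div, norm_div]
  exact div_le_div_of_nonneg_right (by simpa [Real.dist_eq] using h y) (norm_nonneg _)

/-- The image lies between the minimum and the maximum, and their difference is the integral of the
derivative between the points where they are attained. -/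
theorem AbsolutelyContinuousOnInterval.volume_image_le {w : ℝ → ℝ} {s t : ℝ} (hst : s ≤ t)
    (hw : AbsolutelyContinuousOnInterval w s t) :
    volume (w '' Icc s t) ≤ ∫⁻ x in Icc s t, ‖deriv w x‖ₑ := by
  have hc : ContinuousOn w (Icc s t) := by simpa [uIcc_of_le hst] using hw.continuousOn
  obtain ⟨x₁, hx₁, hmin⟩ := isCompact_Icc.exists_isMinOn (nonempty_Icc.2 hst) hc
  obtain ⟨x₂, hx₂, hmax⟩ := isCompact_Icc.exists_isMaxOn (nonempty_Icc.2 hst) hc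
  have h1 : w '' Icc s t ⊆ Icc (w x₁) (w x₂) := by
    rintro _ ⟨x, hx, rfl⟩
    exact ⟨hmin hx, hmax hx⟩
  have hsub : uIcc x₁ x₂ ⊆ uIcc s t := by
    rw [uIcc_of_le hst]
    exact OrdConnected.uIcc_subset ordConnected_Icc hx₁ hx₂
  have h2 := (hw.mono hsub).integral_deriv_eq_sub
  calc volume (w '' Icc s t) ≤ ENNReal.ofReal (w x₂ - w x₁) := by
        rw [← Real.volume_Icc]; exact measure_mono h1
    _ ≤ ‖∫ x in x₁..x₂, deriv w x‖ₑ := by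
        rw [h2]
        exact Real.ofReal_le_enorm _
    _ ≤ ∫⁻ x in uIoc x₁ x₂, ‖deriv w x‖ₑ := by
        rw [← ofReal_norm, intervalIntegral.norm_integral_eq_norm_integral_uIoc, ofReal_norm]
        exact enorm_integral_le_lintegral_enorm _
    _ ≤ ∫⁻ x in Icc s t, ‖deriv w x‖ₑ := by
        refine lintegral_mono_set (uIoc_subset_uIcc.trans ?_)
        rwa [uIcc_of_le hst] at hsub

/-- The image of an interval under `Θ ∘ f` is controlled by the variation of `f` over the set
where `Θ ∘ f` is not locally constant. -/
theorem AbsolutelyContinuousOnInterval.volume_image_comp_le {f Θ : ℝ → ℝ} {C : Set ℝ} {s t : ℝ}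
    (hst : s ≤ t) (hf : AbsolutelyContinuousOnInterval f s t)
    (hΘ : ∀ y z, |Θ y - Θ z| ≤ |y - z|) (hC : ∀ y ∉ C, ∀ᶠ z in 𝓝 y, Θ z = Θ y) :
    volume ((fun x => Θ (f x)) '' Icc s t) ≤
      ∫⁻ x in Icc s t, (f ⁻¹' C).indicator (fun x => ‖deriv f x‖ₑ) x := by
  have hw : AbsolutelyContinuousOnInterval (fun x => Θ (f x)) s t :=
    hf.of_dist_le fun x y => hΘ _ _
  refine (hw.volume_image_le hst).trans (lintegral_mono_ae ?_)
  rw [ae_restrict_iff' measurableSet_Icc]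
  filter_upwards [hf.ae_differentiableAt, hw.ae_differentiableAt] with x h1 h2 hx
  rw [uIcc_of_le hst] at h1 h2
  have h3 := (h1 hx).hasDerivAt
  have h4 := (h2 hx).hasDerivAt
  by_cases hxC : f x ∈ C
  · rw [indicator_of_mem (by exact hxC)]
    exact enorm_le_iff_norm_le.2 (h3.norm_le_of_dist_le h4 fun y => hΘ _ _)
  · rw [indicator_of_notMem (by exact hxC)]
    -- Off C the composition is locally constant, so its derivative vanishes and nothing has to be
    -- paid.
    have h5 : (fun x => Θ (f x)) =ᶠ[𝓝 x] fun _ => Θ (f x) :=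
      h3.continuousAt.eventually (hC _ hxC)
    rw [h5.deriv_eq]
    simp

/-- Truncation of the absolute value to `[a, b]`. -/
def absClamp (a b y : ℝ) : ℝ := max a (min b |y|)

theorem abs_absClamp_sub_le (a b y z : ℝ) : |absClamp a b y - absClamp a b z| ≤ |y - z| := by
  unfold absClamp
  refine (abs_max_sub_max_le_max _ _ _ _).trans (max_le (by simp) ?_)
  refine (abs_min_sub_min_le_max _ _ _ _).trans (max_le (by simp) ?_)
  exact abs_abs_sub_abs_le _ _

theorem absClamp_of_mem {a b y : ℝ} (h : |y| ∈ Icc a b) : absClamp a b y = |y| := by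
  rw [absClamp, min_eq_right h.2, max_eq_right h.1]

theorem eventually_absClamp_eq {a b y : ℝ} (h : y ∉ {y | |y| ∈ Icc a b}) :
    ∀ᶠ z in 𝓝 y, absClamp a b z = absClamp a b y := by
  rcases lt_or_ge |y| a with h1 | h1
  · filter_upwards [continuous_abs.continuousAt.eventually (gt_mem_nhds h1)] with z hz
    rw [absClamp, absClamp, max_eq_left ((min_le_right _ _).trans hz.le),
      max_eq_left ((min_le_right _ _).trans h1.le)]
  · have h2 : b < |y| := by
      by_contra! h2
      exact h ⟨h1, h2⟩
    filter_upwards [continuous_abs.continuousAt.eventually (lt_mem_nhds h2)] with z hz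
    rw [absClamp, absClamp, min_eq_left hz.le, min_eq_left h2.le]

/-- A finite measure that gives every compact subinterval of `(0, S)` at least its length dominates
Lebesgue measure there. -/
theorem restrict_Ioo_le_of_forall_Icc {ρ : Measure ℝ} [IsFiniteMeasure ρ] {S : ℝ}
    (h : ∀ a b, 0 < a → a ≤ b → b < S → ENNReal.ofReal (b - a) ≤ ρ (Icc a b)) :
    volume.restrict (Ioo 0 S) ≤ ρ := by
  -- The absolutely continuous part of ρ suffices: by Besicovitch differentiation its density at
  -- almost every x is the limit of ρ(ball)/vol(ball), and each such quotient is at least one for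
  -- small radii.
  refine le_trans ?_ (Measure.withDensity_rnDeriv_le ρ volume)
  refine le_trans ?_ (Measure.restrict_le_self (s := Ioo 0 S))
  rw [restrict_withDensity measurableSet_Ioo]
  nth_rewrite 1 [← withDensity_one (μ := volume.restrict (Ioo 0 S))]
  refine withDensity_mono ?_
  rw [EventuallyLE, ae_restrict_iff' measurableSet_Ioo]
  filter_upwards [Besicovitch.ae_tendsto_rnDeriv ρ volume] with x hx hxS
  refine ge_of_tendsto hx ?_
  have h1 : ∀ᶠ r in 𝓝[>] (0 : ℝ), r < x ∧ r < S - x :=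
    (eventually_nhdsWithin_of_eventually_nhds (gt_mem_nhds hxS.1)).and
      (eventually_nhdsWithin_of_eventually_nhds (gt_mem_nhds (sub_pos.2 hxS.2)))
  filter_upwards [h1, self_mem_nhdsWithin] with r hr hr0
  have hr0 : 0 < r := hr0
  rw [Real.volume_closedBall, Real.closedBall_eq_Icc, Pi.one_apply,
    ENNReal.le_div_iff_mul_le (Or.inl (by simpa using hr0)) (Or.inl ENNReal.ofReal_ne_top), one_mul]
  have := h (x - r) (x + r) (by linarith) (by linarith) (by linarith)
  convert this using 2
  ring

namespace MetricGraph

variable {E : Type*} {G : MetricGraph E}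

/-- The total variation of `f`, distributed over the values of `|f|`. -/
noncomputable def variation (G : MetricGraph E) (f : G.Point → ℝ) : Measure ℝ :=
  (G.vol.withDensity fun x => ‖G.der f x‖ₑ).map fun x => |G.lift f x|

/-- Sums the estimate on one edge over all edges. With a truncation for Θ it yields the coarea
inequality, with the identity the bound of the supremum by the total variation. -/
theorem volume_range_comp_le [Countable E] {f : G.Point → ℝ} {Θ : ℝ → ℝ} {C : Set ℝ}
    (hf : ∀ e, AbsolutelyContinuousOnInterval (G.onEdge f e) 0 (G.length e))
    (hΘ : ∀ y z, |Θ y - Θ z| ≤ |y - z|) (hC : ∀ y ∉ C, ∀ᶠ z in 𝓝 y, Θ z = Θ y) :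
    volume (range fun x => Θ (f x)) ≤
      ∫⁻ x, (G.lift f ⁻¹' C).indicator (fun x => ‖G.der f x‖ₑ) x ∂G.vol := by
  have h1 : (range fun x => Θ (f x)) ⊆
      ⋃ e, (fun t => Θ (G.onEdge f e t)) '' Icc 0 (G.length e) := by
    rintro _ ⟨x, rfl⟩
    obtain ⟨e, t, ht, rfl⟩ := exists_toPoint_eq x
    exact mem_iUnion.2 ⟨e, t, ht, rfl⟩
  refine (measure_mono h1).trans ((measure_iUnion_le _).trans ?_)
  rw [lintegral_vol]
  exact ENNReal.tsum_le_tsum fun e => (hf e).volume_image_comp_le (G.length_pos e).le hΘ hC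

theorem variation_apply {f : G.Point → ℝ} (hf : Continuous f) {A : Set ℝ} (hA : MeasurableSet A) :
    G.variation f A = ∫⁻ x in {x | |G.lift f x| ∈ A}, ‖G.der f x‖ₑ ∂G.vol := by
  have hm : Measurable fun x => |G.lift f x| := (measurable_lift hf).abs
  rw [variation, Measure.map_apply hm hA, withDensity_apply _ (hm hA)]
  rfl

theorem isFiniteMeasure_variation {f : G.Point → ℝ} (hf : Integrable (G.der f) G.vol) :
    IsFiniteMeasure (G.variation f) := by
  have : IsFiniteMeasure (G.vol.withDensity fun x => ‖G.der f x‖ₑ) :=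
    isFiniteMeasure_withDensity hf.2.ne
  exact Measure.isFiniteMeasure_map _ _

/-- The coarea inequality: if `|f|` takes all values in `(0, S)`, then its variation dominates
Lebesgue measure on `(0, S)`. -/
theorem restrict_Ioo_le_variation [Countable E] {f : G.Point → ℝ} (hf : Continuous f)
    (hac : ∀ e, AbsolutelyContinuousOnInterval (G.onEdge f e) 0 (G.length e))
    (hd : Integrable (G.der f) G.vol) {S : ℝ} (hS : Ioo 0 S ⊆ range fun x => |f x|) :
    volume.restrict (Ioo 0 S) ≤ G.variation f := by
  have := isFiniteMeasure_variation hd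
  refine restrict_Ioo_le_of_forall_Icc fun a b ha hab hb => ?_
  -- The truncation of |f| to [a, b] still covers [a, b], but varies only where |f| lies in [a, b].
  have h1 := volume_range_comp_le hac (abs_absClamp_sub_le a b)
    (C := {y | |y| ∈ Icc a b}) fun y hy => eventually_absClamp_eq hy
  have h2 : Icc a b ⊆ range fun x => absClamp a b (f x) := by
    intro y hy
    obtain ⟨x, hx⟩ := hS ⟨ha.trans_le hy.1, hy.2.trans_lt hb⟩
    have hx : |f x| = y := hx
    exact ⟨x, by simp only; rw [absClamp_of_mem (hx ▸ hy), hx]⟩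
  rw [← Real.volume_Icc, variation_apply hf measurableSet_Icc]
  refine (measure_mono h2).trans (h1.trans ?_)
  rw [lintegral_indicator]
  · rfl
  · exact (measurable_lift hf).abs measurableSet_Icc

end MetricGraph

/-! ### Energy bounds and the form domain -/

/-- Cauchy–Schwarz against the constant one, read off from ∫(V|g| − m)² ≥ 0. The case V = 0 is
separate because a factor V is cancelled. -/
theorem MeasureTheory.MemLp.sq_integral_abs_le {α : Type*} [MeasurableSpace α] {μ : Measure α}
    [IsFiniteMeasure μ] {g : α → ℝ} (hg : MemLp g 2 μ) :
    (∫ x, |g x| ∂μ) ^ 2 ≤ μ.real univ * ∫ x, g x ^ 2 ∂μ := by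
  have h1 : Integrable (fun x => |g x|) μ := (hg.integrable one_le_two).abs
  have h2 := hg.integrable_sq
  set m := ∫ x, |g x| ∂μ
  set V := μ.real univ
  have h3 : 0 ≤ ∫ x, (V * |g x| - m) ^ 2 ∂μ := integral_nonneg fun x => sq_nonneg _
  have h4 : ∫ x, (V * |g x| - m) ^ 2 ∂μ = V ^ 2 * (∫ x, g x ^ 2 ∂μ) - 2 * V * m * m + V * m ^ 2 := by
    have : ∀ x, (V * |g x| - m) ^ 2 = V ^ 2 * g x ^ 2 - 2 * V * m * |g x| + m ^ 2 := fun x => by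
      rw [← sq_abs (g x)]; ring
    simp_rw [this]
    have h5 : Integrable (fun x => V ^ 2 * g x ^ 2 - 2 * V * m * |g x|) μ :=
      (h2.const_mul _).sub (h1.const_mul _)
    rw [integral_add h5 (integrable_const _),
      integral_sub (h2.const_mul _) (h1.const_mul _), integral_const_mul, integral_const_mul,
      integral_const, smul_eq_mul]
  have hV : 0 ≤ V := measureReal_nonneg
  rcases hV.eq_or_lt with hV0 | hV0
  · have hμ : μ = 0 := by
      rw [← Measure.measure_univ_eq_zero, ← measureReal_eq_zero_iff]
      exact hV0.symm
    simp [m, hμ]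
  · have h5 : 0 ≤ V * (V * (∫ x, g x ^ 2 ∂μ) - m ^ 2) := by rw [h4] at h3; linarith
    have := nonneg_of_mul_nonneg_right h5 hV0
    linarith

theorem MeasureTheory.MemLp.norm_toLp_sq {α : Type*} [MeasurableSpace α] {μ : Measure α}
    {g : α → ℝ} (hg : MemLp g 2 μ) : ‖hg.toLp g‖ ^ 2 = ∫ x, g x ^ 2 ∂μ := by
  rw [← real_inner_self_eq_norm_sq, L2.inner_def]
  refine integral_congr_ae ?_
  filter_upwards [hg.coeFn_toLp] with x hx
  simp [hx, sq]

namespace MetricGraph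

variable {E : Type*} {G : MetricGraph E} {D : Set (G.Vertex ⊕ G.End)}

theorem integral_mono_vol_line [Countable E] {F : Lines E → ℝ} (hF : Integrable F G.vol) (h0 : 0 ≤ F)
    (e : E) {s : Set ℝ} (hs : s ⊆ Icc 0 (G.length e)) :
    ∫ t in s, F ⟨e, t⟩ ≤ ∫ x, F x ∂G.vol := by
  have h1 := hasSum_integral_vol hF
  have h2 := h1.summable.le_tsum e fun e' _ =>
    intervalIntegral.integral_nonneg (G.length_pos e').le fun t _ => h0 ⟨e', t⟩
  rw [h1.tsum_eq, intervalIntegral.integral_of_le (G.length_pos e).le,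
    ← integral_Icc_eq_integral_Ioc] at h2
  refine le_trans ?_ h2
  exact setIntegral_mono_set ((integrable_vol_iff.1 hF).1 e)
    (Eventually.of_forall fun t => h0 ⟨e, t⟩) (Eventually.of_forall hs)

theorem sq_sub_le_of_eq_integral [Countable E] {g : Lines E → ℝ} (hg : MemLp g 2 G.vol) {e : E}
    {s t : ℝ} (hs : s ∈ Icc 0 (G.length e)) (ht : t ∈ Icc 0 (G.length e)) :
    (∫ x in s..t, g ⟨e, x⟩) ^ 2 ≤ |t - s| * ∫ x, g x ^ 2 ∂G.vol := by
  have hsub : uIoc s t ⊆ Icc 0 (G.length e) :=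
    uIoc_subset_uIcc.trans (ordConnected_Icc.uIcc_subset hs ht)
  have h1 : MemLp (fun x => g ⟨e, x⟩) 2 (volume.restrict (uIoc s t)) :=
    ((memLp_two_vol_iff.1 hg).1 e).mono_measure (Measure.restrict_mono_set _ hsub)
  have h2 : |∫ x in s..t, g ⟨e, x⟩| ≤ ∫ x in uIoc s t, |g ⟨e, x⟩| := by
    rw [intervalIntegral.abs_integral_eq_abs_integral_uIoc]
    exact abs_integral_le_integral_abs
  have h3 : IsFiniteMeasure (volume.restrict (uIoc s t)) :=
    ⟨by rw [Measure.restrict_apply_univ, uIoc, Real.volume_Ioc]; exact ENNReal.ofReal_lt_top⟩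
  have h4 := h1.sq_integral_abs_le
  have h5 : (volume.restrict (uIoc s t)).real univ = |t - s| := by
    rw [measureReal_restrict_apply_univ, uIoc, Real.volume_real_Ioc_of_le min_le_max,
      max_sub_min_eq_abs]
  rw [h5] at h4
  calc (∫ x in s..t, g ⟨e, x⟩) ^ 2 = |∫ x in s..t, g ⟨e, x⟩| ^ 2 := (sq_abs _).symm
    _ ≤ _ := pow_le_pow_left₀ (abs_nonneg _) h2 2
    _ ≤ _ := h4
    _ ≤ _ := mul_le_mul_of_nonneg_left
      (integral_mono_vol_line hg.integrable_sq (fun x => sq_nonneg _) e hsub) (abs_nonneg _)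

theorem onEdge_projIcc (f : G.Point → ℝ) (e : E) (t : ℝ) :
    G.onEdge f e (projIcc 0 (G.length e) (G.length_pos e).le t) = G.onEdge f e t := by
  simp [onEdge]

/-- Functions in `H¹` are Hölder continuous along the edges. -/
theorem sq_onEdge_sub_le [Countable E] {f : G.Point → ℝ}
    (hf : ∀ e, AbsolutelyContinuousOnInterval (G.onEdge f e) 0 (G.length e))
    (hd : MemLp (G.der f) 2 G.vol) (e : E) (s t : ℝ) :
    (G.onEdge f e t - G.onEdge f e s) ^ 2 ≤ |t - s| * ∫ x, G.der f x ^ 2 ∂G.vol := by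
  rw [← onEdge_projIcc f e t, ← onEdge_projIcc f e s]
  set s' := projIcc 0 (G.length e) (G.length_pos e).le s
  set t' := projIcc 0 (G.length e) (G.length_pos e).le t
  have h1 : uIcc (s' : ℝ) t' ⊆ uIcc 0 (G.length e) := by
    rw [uIcc_of_le (G.length_pos e).le]
    exact ordConnected_Icc.uIcc_subset s'.2 t'.2
  rw [← ((hf e).mono h1).integral_deriv_eq_sub]
  refine (sq_sub_le_of_eq_integral hd s'.2 t'.2).trans ?_
  refine mul_le_mul_of_nonneg_right ?_ (integral_nonneg fun x => sq_nonneg _)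
  exact abs_projIcc_sub_projIcc (G.length_pos e).le

/-- At an end a value is only a limit. Membership in the closure of the range is what vertices and
ends have in common, and all that the intermediate value arguments need. -/
theorem HasValueAt.mem_closure_range {f : G.Point → ℝ} {p : G.Vertex ⊕ G.End} {c : ℝ}
    (h : G.HasValueAt f p c) : c ∈ closure (range f) := by
  rcases p with v | γ
  · exact subset_closure ⟨_, h⟩
  · have := γ.neBot_filter
    exact mem_closure_of_tendsto h (Eventually.of_forall fun x => ⟨x, rfl⟩)

theorem Connected.Ioo_subset_range (hconn : G.Connected) {f : G.Point → ℝ} (hf : Continuous f)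
    {a b : ℝ} (ha : a ∈ closure (range f)) (hb : b ∈ closure (range f)) : Ioo a b ⊆ range f := by
  have := hconn.preconnectedSpace
  have h1 := (isPreconnected_range hf).ordConnected
  intro y hy
  obtain ⟨_, h2, x₁, rfl⟩ := mem_closure_iff_nhds.1 ha _ (Iio_mem_nhds hy.1)
  obtain ⟨_, h3, x₂, rfl⟩ := mem_closure_iff_nhds.1 hb _ (Ioi_mem_nhds hy.2)
  exact h1.out ⟨x₁, rfl⟩ ⟨x₂, rfl⟩ ⟨le_of_lt h2, le_of_lt h3⟩

/-- The range is connected and accumulates at 0, so its length is at least |f x|; on the other hand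
its length is at most the total variation. No path to the Dirichlet vertex or end has to be chosen.
-/
theorem abs_le_integral_abs_der [Countable E] (hconn : G.Connected) {f : G.Point → ℝ}
    (hf : Continuous f)
    (hac : ∀ e, AbsolutelyContinuousOnInterval (G.onEdge f e) 0 (G.length e))
    (hd : Integrable (G.der f) G.vol) (h0 : 0 ∈ closure (range f)) (x : G.Point) :
    |f x| ≤ ∫ x, |G.der f x| ∂G.vol := by
  have h1 : volume (range f) ≤ ∫⁻ x, ‖G.der f x‖ₑ ∂G.vol := by
    have := volume_range_comp_le (Θ := id) (C := univ) hac (fun y z => le_rfl)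
      (fun y hy => absurd (mem_univ y) hy)
    simpa using! this
  have hx : f x ∈ closure (range f) := subset_closure ⟨x, rfl⟩
  have h2 : ENNReal.ofReal |f x| ≤ volume (range f) := by
    rcases le_total 0 (f x) with h | h
    · rw [abs_of_nonneg h, ← sub_zero (f x), ← Real.volume_Ioo]
      exact measure_mono (hconn.Ioo_subset_range hf h0 hx)
    · rw [abs_of_nonpos h, ← zero_sub (f x), ← Real.volume_Ioo]
      exact measure_mono (hconn.Ioo_subset_range hf hx h0)
  rw [← ENNReal.ofReal_le_ofReal_iff (integral_nonneg fun x => abs_nonneg _),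
    ofReal_integral_eq_lintegral_ofReal hd.abs (Eventually.of_forall fun x => abs_nonneg _)]
  simpa only [← Real.enorm_eq_ofReal_abs] using h2.trans h1

/-- Together with Cauchy–Schwarz, the variation bound becomes a uniform bound by the energy. This is
the compactness input for the direct method. -/
theorem sq_le_length_mul [Countable E] (hconn : G.Connected) {L : ℝ} (hL : HasSum G.length L)
    (hLpos : 0 < L) {f : G.Point → ℝ} (hf : Continuous f)
    (hac : ∀ e, AbsolutelyContinuousOnInterval (G.onEdge f e) 0 (G.length e))
    (hd : MemLp (G.der f) 2 G.vol) (h0 : 0 ∈ closure (range f)) (x : G.Point) :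
    f x ^ 2 ≤ L * ∫ x, G.der f x ^ 2 ∂G.vol := by
  have := isFiniteMeasure_vol hL
  have h1 := abs_le_integral_abs_der hconn hf hac (hd.integrable one_le_two) h0 x
  have h2 := hd.sq_integral_abs_le
  rw [measureReal_def, vol_univ hL, ENNReal.toReal_ofReal hLpos.le] at h2
  rw [← sq_abs]
  exact (pow_le_pow_left₀ (abs_nonneg _) h1 2).trans h2

theorem der_add_smul_ae [Countable E] {f g : G.Point → ℝ}
    (hf : ∀ e, AbsolutelyContinuousOnInterval (G.onEdge f e) 0 (G.length e))
    (hg : ∀ e, AbsolutelyContinuousOnInterval (G.onEdge g e) 0 (G.length e)) (c : ℝ) :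
    G.der (fun x => f x + c * g x) =ᵐ[G.vol] fun x => G.der f x + c * G.der g x := by
  filter_upwards [ae_hasDerivAt hf, ae_hasDerivAt hg] with x h1 h2
  exact (h1.add (h2.const_mul c)).deriv

theorem HasValueAt.add_smul {f g : G.Point → ℝ} {p : G.Vertex ⊕ G.End} {a b : ℝ}
    (hf : G.HasValueAt f p a) (hg : G.HasValueAt g p b) (c : ℝ) :
    G.HasValueAt (fun x => f x + c * g x) p (a + c * b) := by
  rcases p with v | γ
  · change _ = _ at hf hg
    change f _ + c * g _ = _
    rw [hf, hg]
  · exact Tendsto.add hf (Tendsto.const_mul c hg)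

theorem MemH10.continuous {f : G.Point → ℝ} (hf : G.MemH10 D f) : Continuous f := hf.1.1

theorem MemH10.ac {f : G.Point → ℝ} (hf : G.MemH10 D f) (e : E) :
    AbsolutelyContinuousOnInterval (G.onEdge f e) 0 (G.length e) := (hf.1.2.1 e).1

theorem MemH10.memLp_lift [Countable E] {f : G.Point → ℝ} (hf : G.MemH10 D f) :
    MemLp (G.lift f) 2 G.vol := (memH1_iff.1 hf.1).2.2.1

theorem MemH10.memLp_der [Countable E] {f : G.Point → ℝ} (hf : G.MemH10 D f) :
    MemLp (G.der f) 2 G.vol := (memH1_iff.1 hf.1).2.2.2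

theorem MemH10.add_smul [Countable E] {f g : G.Point → ℝ} (hf : G.MemH10 D f)
    (hg : G.MemH10 D g) (c : ℝ) : G.MemH10 D fun x => f x + c * g x := by
  refine ⟨memH1_iff.2 ⟨hf.continuous.add (hg.continuous.const_mul c), fun e => ?_, ?_, ?_⟩, ?_⟩
  · exact (hf.ac e).add ((hg.ac e).const_mul c)
  · exact hf.memLp_lift.add (hg.memLp_lift.const_mul c)
  · exact (memLp_congr_ae (der_add_smul_ae hf.ac hg.ac c)).2
      (hf.memLp_der.add (hg.memLp_der.const_mul c))
  · intro p hp
    simpa using (hf.2 p hp).add_smul (hg.2 p hp) c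

theorem memH10_zero : G.MemH10 D fun _ => 0 := by
  have h : ∀ e, G.onEdge (fun _ => 0) e = fun _ => 0 := fun e => rfl
  refine ⟨⟨continuous_const, fun e => ⟨?_, ?_⟩, ?_⟩, fun p _ => ?_⟩
  · exact (LipschitzWith.const (α := ℝ) (0 : ℝ)).lipschitzOnWith.absolutelyContinuousOnInterval
  · simp [h]
  · simp [h]
  · rcases p with v | γ
    · rfl
    · exact tendsto_const_nhds

theorem MemH10.const_mul [Countable E] {f : G.Point → ℝ} (hf : G.MemH10 D f) (c : ℝ) :
    G.MemH10 D fun x => c * f x := by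
  simpa using memH10_zero.add_smul hf c

theorem MemH10.sq_le [Countable E] (hconn : G.Connected) {L : ℝ} (hL : HasSum G.length L)
    (hLpos : 0 < L) (hD : D.Nonempty) {f : G.Point → ℝ} (hf : G.MemH10 D f) (x : G.Point) :
    f x ^ 2 ≤ L * ∫ x, G.der f x ^ 2 ∂G.vol := by
  obtain ⟨p, hp⟩ := hD
  exact sq_le_length_mul hconn hL hLpos hf.continuous hf.ac hf.memLp_der
    (hf.2 p hp).mem_closure_range x

end MetricGraph

/-! ### Test functions and the Rayleigh quotient -/

namespace MetricGraph

variable {E : Type*} {G : MetricGraph E} {D : Set (G.Vertex ⊕ G.End)}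

theorem measurable_der (f : G.Point → ℝ) : Measurable (G.der f) :=
  measurable_lines_iff.2 fun e => measurable_deriv (G.onEdge f e)

theorem EdgeLipschitz.abs_der_le {K : ℝ≥0} {f : G.Point → ℝ} (hf : EdgeLipschitz K f)
    (x : Lines E) : |G.der f x| ≤ K :=
  norm_deriv_le_of_lipschitz (hf.lipschitzWith_onEdge x.1)

theorem EdgeLipschitz.ac {K : ℝ≥0} {f : G.Point → ℝ} (hf : EdgeLipschitz K f) (e : E) :
    AbsolutelyContinuousOnInterval (G.onEdge f e) 0 (G.length e) :=
  (hf.lipschitzWith_onEdge e).lipschitzOnWith.absolutelyContinuousOnInterval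

theorem EdgeLipschitz.memH1 [Countable E] {K : ℝ≥0} {f : G.Point → ℝ} (hf : EdgeLipschitz K f)
    (hconn : G.Connected) [IsFiniteMeasure G.vol] {B : ℝ} (hB : ∀ x, |f x| ≤ B) : G.MemH1 f := by
  have hc := (hf.lipschitzWith hconn).continuous
  refine memH1_iff.2 ⟨hc, hf.ac, ?_, ?_⟩
  · exact MemLp.of_bound (measurable_lift hc).aestronglyMeasurable B
      (Eventually.of_forall fun x => hB _)
  · exact MemLp.of_bound (measurable_der f).aestronglyMeasurable K
      (Eventually.of_forall fun x => hf.abs_der_le x)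

open Classical in
/-- A function supported on a single edge, where it is a quadratic polynomial. -/
noncomputable def bump (G : MetricGraph E) (e₀ : E) (x : G.Point) : ℝ :=
  Quotient.lift (s := G.pointSetoid)
    (fun p : G.PrePoint => if p.1 = e₀ then (p.2 : ℝ) * (G.length p.1 - p.2) else 0)
    (by
      have key : ∀ a : E × Bool, (if (G.endpoint a).1 = e₀ then
          ((G.endpoint a).2 : ℝ) * (G.length (G.endpoint a).1 - (G.endpoint a).2) else 0) = 0 := by
        rintro ⟨e, b⟩
        cases b <;> simp [endpoint]
      rintro p q (rfl | ⟨a, b, rfl, rfl, -⟩)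
      · rfl
      · exact (key a).trans (key b).symm) x

theorem bump_pt_self (e : E) (t : Icc (0 : ℝ) (G.length e)) :
    G.bump e (G.pt e t) = t * (G.length e - t) :=
  if_pos rfl

theorem bump_pt_of_ne {e e₀ : E} (h : e ≠ e₀) (t : Icc (0 : ℝ) (G.length e)) :
    G.bump e₀ (G.pt e t) = 0 :=
  if_neg h

theorem bump_endpoint (e₀ : E) (a : E × Bool) :
    G.bump e₀ (Quotient.mk G.pointSetoid (G.endpoint a)) = 0 := by
  obtain ⟨e, b⟩ := a
  have key : ∀ t : Icc (0 : ℝ) (G.length e), (t : ℝ) * (G.length e - t) = 0 →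
      G.bump e₀ (G.pt e t) = 0 := by
    intro t ht
    by_cases he : e = e₀
    · subst he
      rw [bump_pt_self, ht]
    · exact bump_pt_of_ne he _
  cases b
  · exact key ⟨0, le_rfl, (G.length_pos e).le⟩ (zero_mul _)
  · exact key ⟨G.length e, (G.length_pos e).le, le_rfl⟩ (by simp)

theorem edgeLipschitz_bump (e₀ : E) :
    EdgeLipschitz (G.length e₀).toNNReal (G.bump e₀) := by
  intro e s t
  by_cases h : e = e₀
  · subst h
    rw [bump_pt_self, bump_pt_self, Real.coe_toNNReal _ (G.length_pos e).le]
    have h1 : (s : ℝ) * (G.length e - s) - t * (G.length e - t) =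
      (G.length e - s - t) * (s - t) := by ring
    rw [h1, abs_mul]
    refine mul_le_mul_of_nonneg_right ?_ (abs_nonneg _)
    rw [abs_le]
    constructor <;> linarith [s.2.1, s.2.2, t.2.1, t.2.2]
  · rw [bump_pt_of_ne h, bump_pt_of_ne h, sub_self, abs_zero]
    positivity

/-- Shows that the form domain is nontrivial for every choice of D: the function vanishes at all
vertices, and its supporting edge is compact, hence invisible near every end. -/
theorem memH10_bump [Countable E] (hconn : G.Connected) [IsFiniteMeasure G.vol] (e₀ : E) :
    G.MemH10 D (G.bump e₀) := by
  refine ⟨(edgeLipschitz_bump e₀).memH1 hconn (B := G.length e₀ ^ 2) fun x => ?_, fun p _ => ?_⟩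
  · obtain ⟨e, t, rfl⟩ := exists_pt_eq x
    by_cases h : e = e₀
    · subst h
      rw [bump_pt_self, abs_le]
      constructor <;> nlinarith [t.2.1, t.2.2]
    · rw [bump_pt_of_ne h, abs_zero]
      positivity
  · rcases p with v | γ
    · exact Quotient.inductionOn (s := G.glue) v fun a => bump_endpoint e₀ a
    · refine tendsto_const_nhds.congr' ?_
      filter_upwards [γ.compl_mem_filter (isCompact_range (continuous_pt e₀))] with x hx
      obtain ⟨e, t, rfl⟩ := exists_pt_eq x
      refine (bump_pt_of_ne ?_ t).symm
      rintro rfl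
      exact hx ⟨t, rfl⟩

/-- A continuous function that vanishes almost everywhere on a nondegenerate interval vanishes on
all of it. -/
theorem integral_lift_sq_pos [Countable E] {f : G.Point → ℝ} (hf : Continuous f)
    (h2 : MemLp (G.lift f) 2 G.vol) (h0 : f ≠ 0) : 0 < ∫ x, G.lift f x ^ 2 ∂G.vol := by
  refine lt_of_le_of_ne (integral_nonneg fun x => sq_nonneg _) fun h => h0 ?_
  have h3 := (integral_eq_zero_iff_of_nonneg (fun x => sq_nonneg _) h2.integrable_sq).1 h.symm
  have h4 := ae_vol_iff.1 h3
  funext x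
  obtain ⟨e, t, ht, rfl⟩ := exists_toPoint_eq x
  have h5 : G.onEdge f e =ᵐ[volume.restrict (Icc 0 (G.length e))] fun _ => 0 := by
    filter_upwards [h4 e] with t ht
    exact pow_eq_zero_iff (two_ne_zero) |>.1 ht
  exact Measure.eqOn_Icc_of_ae_eq volume (G.length_pos e).ne h5
    (continuous_onEdge hf e).continuousOn continuousOn_const ht

theorem bump_ne_zero (e₀ : E) : G.bump e₀ ≠ 0 := by
  intro h
  have hp := G.length_pos e₀
  have h1 := congrFun h (G.pt e₀ ⟨G.length e₀ / 2, by constructor <;> linarith⟩)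
  rw [bump_pt_self, Pi.zero_apply] at h1
  simp only at h1
  nlinarith

/-- The infimum of the Rayleigh quotient. -/
noncomputable def rayleighInf (G : MetricGraph E) (D : Set (G.Vertex ⊕ G.End)) : ℝ :=
  sInf {c | ∃ f, G.MemH10 D f ∧ ∫ x, G.lift f x ^ 2 ∂G.vol = 1 ∧
    ∫ x, G.der f x ^ 2 ∂G.vol = c}

theorem integral_der_const_mul_sq [Countable E] {f : G.Point → ℝ} (c : ℝ) :
    ∫ x, G.der (fun x => c * f x) x ^ 2 ∂G.vol = c ^ 2 * ∫ x, G.der f x ^ 2 ∂G.vol := by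
  rw [← integral_const_mul]
  refine integral_congr_ae (Eventually.of_forall fun x => ?_)
  have : G.der (fun x => c * f x) x = c * G.der f x := deriv_const_mul_field c
  simp only [this, mul_pow]

theorem exists_normalized [Countable E] {f : G.Point → ℝ} (hf : G.MemH10 D f) (h0 : f ≠ 0) :
    ∃ g, G.MemH10 D g ∧ ∫ x, G.lift g x ^ 2 ∂G.vol = 1 ∧
      ∫ x, G.der g x ^ 2 ∂G.vol = (∫ x, G.der f x ^ 2 ∂G.vol) / ∫ x, G.lift f x ^ 2 ∂G.vol := by
  have hN := integral_lift_sq_pos hf.continuous hf.memLp_lift h0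
  set N := ∫ x, G.lift f x ^ 2 ∂G.vol
  have hs : (√N)⁻¹ ^ 2 = N⁻¹ := by rw [inv_pow, Real.sq_sqrt hN.le]
  refine ⟨fun x => (√N)⁻¹ * f x, hf.const_mul _, ?_, ?_⟩
  · have : ∀ x, G.lift (fun x => (√N)⁻¹ * f x) x ^ 2 = N⁻¹ * G.lift f x ^ 2 := fun x => by
      rw [← hs, ← mul_pow]; rfl
    simp_rw [this]
    rw [integral_const_mul, inv_mul_cancel₀ hN.ne']
  · rw [integral_der_const_mul_sq, hs, inv_mul_eq_div]

theorem rayleighInf_mul_le [Countable E] {f : G.Point → ℝ} (hf : G.MemH10 D f) :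
    G.rayleighInf D * ∫ x, G.lift f x ^ 2 ∂G.vol ≤ ∫ x, G.der f x ^ 2 ∂G.vol := by
  by_cases h0 : f = 0
  · subst h0
    simp only [lift, Pi.zero_apply]
    simpa using integral_nonneg fun x => sq_nonneg _
  · obtain ⟨g, hg, h1, h2⟩ := exists_normalized hf h0
    rw [← le_div_iff₀ (integral_lift_sq_pos hf.continuous hf.memLp_lift h0), ← h2]
    exact csInf_le ⟨0, by rintro _ ⟨f, -, -, rfl⟩; exact integral_nonneg fun x => sq_nonneg _⟩
      ⟨g, hg, h1, rfl⟩

theorem rayleighInf_nonneg : 0 ≤ G.rayleighInf D :=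
  Real.sInf_nonneg (by rintro _ ⟨f, -, -, rfl⟩; exact integral_nonneg fun x => sq_nonneg _)

end MetricGraph

/-! ### Existence of a ground state by the direct method -/

theorem AbsolutelyContinuousOnInterval.congr_of_eqOn {f g : ℝ → ℝ} {a b : ℝ}
    (hf : AbsolutelyContinuousOnInterval f a b) (h : EqOn f g (uIcc a b)) :
    AbsolutelyContinuousOnInterval g a b := by
  rw [absolutelyContinuousOnInterval_iff] at hf ⊢
  intro ε hε
  obtain ⟨δ, hδ, H⟩ := hf ε hε
  refine ⟨δ, hδ, fun I hI hI' => ?_⟩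
  refine (Finset.sum_congr rfl fun i hi => ?_).trans_lt (H I hI hI')
  rw [h (hI.1 i hi).1, h (hI.1 i hi).2]

theorem MeasureTheory.MemLp.integral_sq_add_smul {α : Type*} [MeasurableSpace α] {μ : Measure α}
    {g k : α → ℝ} (hg : MemLp g 2 μ) (hk : MemLp k 2 μ) (c : ℝ) :
    ∫ x, (g x + c * k x) ^ 2 ∂μ =
      ∫ x, g x ^ 2 ∂μ + (2 * c * ∫ x, g x * k x ∂μ + c ^ 2 * ∫ x, k x ^ 2 ∂μ) := by
  have h1 : Integrable (fun x => 2 * c * (g x * k x)) μ := (hg.integrable_mul hk).const_mul (2 * c)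
  have h2 : Integrable (fun x => c ^ 2 * k x ^ 2) μ := hk.integrable_sq.const_mul (c ^ 2)
  have h3 : Integrable (fun x => 2 * c * (g x * k x) + c ^ 2 * k x ^ 2) μ := h1.add h2
  rw [← integral_const_mul, ← integral_const_mul, ← integral_add h1 h2,
    ← integral_add hg.integrable_sq h3]
  exact integral_congr_ae (Eventually.of_forall fun x => by ring)

theorem MeasureTheory.MemLp.integral_parallelogram {α : Type*} [MeasurableSpace α] {μ : Measure α}
    {g h : α → ℝ} (hg : MemLp g 2 μ) (hh : MemLp h 2 μ) :
    ∫ x, (g x + h x) ^ 2 ∂μ + ∫ x, (g x - h x) ^ 2 ∂μ =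
      2 * ∫ x, g x ^ 2 ∂μ + 2 * ∫ x, h x ^ 2 ∂μ := by
  have h1 := hg.integral_sq_add_smul hh 1
  have h2 := hg.integral_sq_add_smul hh (-1)
  simp only [one_mul, neg_one_mul, ← sub_eq_add_neg] at h1 h2
  rw [h1, h2]
  ring

namespace MetricGraph

variable {E : Type*} {G : MetricGraph E} {D : Set (G.Vertex ⊕ G.End)}

/-- A sequence that is bounded in energy has a subsequence that converges pointwise. -/
theorem exists_subseq_tendsto [Countable E] (hconn : G.Connected) {L : ℝ}
    (hL : HasSum G.length L) (hLpos : 0 < L) (hD : D.Nonempty) {f : ℕ → G.Point → ℝ}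
    (hf : ∀ n, G.MemH10 D (f n)) {C : ℝ} (hC : ∀ n, ∫ x, G.der (f n) x ^ 2 ∂G.vol ≤ C) :
    ∃ φ : ℕ → ℕ, StrictMono φ ∧ ∀ x, ∃ y, Tendsto (fun n => f (φ n) x) atTop (𝓝 y) := by
  have hB : ∀ n x, f n x ∈ Icc (-√(L * C)) (√(L * C)) := fun n x =>
    abs_le.1 (Real.abs_le_sqrt (((hf n).sq_le hconn hL hLpos hD x).trans
      (mul_le_mul_of_nonneg_left (hC n) hLpos.le)))
  -- The diagonal argument: a countable product of compact intervals, one for each edge and rational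
  -- parameter, is sequentially compact.
  obtain ⟨y, -, φ, hφ, hy⟩ := (isCompact_univ_pi fun _ : E × ℚ =>
    isCompact_Icc (a := -√(L * C)) (b := √(L * C))).tendsto_subseq
    (x := fun n (p : E × ℚ) => G.onEdge (f n) p.1 p.2) fun n p _ => hB n _
  refine ⟨φ, hφ, fun x => cauchySeq_tendsto_of_complete ?_⟩
  obtain ⟨e, t, -, rfl⟩ := exists_toPoint_eq x
  have hC0 : 0 ≤ C := (integral_nonneg fun x => sq_nonneg _).trans (hC 0)
  rw [Metric.cauchySeq_iff]
  intro ε hε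
  -- At distance at most (ε/3)²/(C + 1), Hölder continuity of exponent 1/2 changes every f n by at
  -- most ε/3; adding 1 avoids dividing by zero. The rational q may lie beyond the edge, which is
  -- harmless since `onEdge` is constant there.
  obtain ⟨q, hq1, hq2⟩ := exists_rat_btwn
    (show t < t + (ε / 3) ^ 2 / (C + 1) by linarith [show 0 < (ε / 3) ^ 2 / (C + 1) by positivity])
  have hq : ∀ n, |G.onEdge (f n) e t - G.onEdge (f n) e q| ≤ ε / 3 := by
    intro n
    refine abs_le_of_sq_le_sq ?_ (by positivity)
    refine (sq_onEdge_sub_le (hf n).ac (hf n).memLp_der e q t).trans ?_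
    have h1 : |t - (q : ℝ)| ≤ (ε / 3) ^ 2 / (C + 1) := by
      rw [abs_le]; constructor <;> linarith
    refine (mul_le_mul h1 ((hC n).trans (by linarith : C ≤ C + 1))
      (integral_nonneg fun x => sq_nonneg _) (by positivity)).trans_eq ?_
    field_simp
  have hcau : CauchySeq fun n => G.onEdge (f (φ n)) e q :=
    ((tendsto_pi_nhds.1 hy) (e, q)).cauchySeq
  obtain ⟨N, hN⟩ := Metric.cauchySeq_iff.1 hcau (ε / 3) (by positivity)
  refine ⟨N, fun m hm n hn => ?_⟩
  have h1 := hN m hm n hn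
  rw [Real.dist_eq] at h1 ⊢
  change |G.onEdge (f (φ m)) e t - G.onEdge (f (φ n)) e t| < ε
  have h2 := hq (φ m)
  have h3 := hq (φ n)
  rw [abs_le] at h2 h3
  rw [abs_lt] at h1 ⊢
  constructor <;> linarith [h1.1, h1.2, h2.1, h2.2, h3.1, h3.2]

theorem integral_der_sub_sq [Countable E] {f g : G.Point → ℝ} (hf : G.MemH10 D f)
    (hg : G.MemH10 D g) :
    ∫ x, G.der (fun x => f x + -1 * g x) x ^ 2 ∂G.vol =
      ∫ x, (G.der f x - G.der g x) ^ 2 ∂G.vol := by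
  refine integral_congr_ae ?_
  filter_upwards [der_add_smul_ae hf.ac hg.ac (-1)] with x hx
  rw [hx]
  ring

/-- The form domain is complete. -/
theorem memH10_of_tendsto [Countable E] (hconn : G.Connected) {L : ℝ}
    (hL : HasSum G.length L) (hLpos : 0 < L) (hD : D.Nonempty) {f : ℕ → G.Point → ℝ}
    (hf : ∀ n, G.MemH10 D (f n)) {F : G.Point → ℝ}
    (hF : ∀ x, Tendsto (fun n => f n x) atTop (𝓝 (F x))) {a : ℕ → ℝ} (ha : Tendsto a atTop (𝓝 0))
    (hcau : ∀ n m, ∫ x, (G.der (f n) x - G.der (f m) x) ^ 2 ∂G.vol ≤ a n + a m) :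
    G.MemH10 D F ∧ Tendsto (fun n => ∫ x, G.der (f n) x ^ 2 ∂G.vol) atTop
      (𝓝 (∫ x, G.der F x ^ 2 ∂G.vol)) := by
  have hfin := isFiniteMeasure_vol hL
  -- the derivatives converge in `L²`
  have hdist : ∀ n m, dist ((hf n).memLp_der.toLp _) ((hf m).memLp_der.toLp _) ^ 2 ≤
      a n + a m := by
    intro n m
    rw [dist_eq_norm, ← MemLp.toLp_sub, MemLp.norm_toLp_sq]
    exact hcau n m
  have hcauchy : CauchySeq fun n => (hf n).memLp_der.toLp (G.der (f n)) := by
    rw [Metric.cauchySeq_iff]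
    intro ε hε
    obtain ⟨N, hN⟩ := eventually_atTop.1 (ha.eventually (gt_mem_nhds
      (show 0 < ε ^ 2 / 2 by positivity)))
    refine ⟨N, fun m hm n hn => lt_of_pow_lt_pow_left₀ 2 hε.le ?_⟩
    linarith [hdist m n, hN m hm, hN n hn]
  obtain ⟨g, hg⟩ := cauchySeq_tendsto_of_complete hcauchy
  have hgL : MemLp g 2 G.vol := Lp.memLp g
  have hconv : Tendsto (fun n => ∫ x, (G.der (f n) x - g x) ^ 2 ∂G.vol) atTop (𝓝 0) := by
    have h1 : Tendsto (fun n => ‖(hf n).memLp_der.toLp (G.der (f n)) - g‖ ^ 2) atTop (𝓝 0) := by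
      simpa using (tendsto_iff_norm_sub_tendsto_zero.1 hg).pow 2
    refine h1.congr fun n => ?_
    have h2 : (hf n).memLp_der.toLp (G.der (f n)) - g =
        ((hf n).memLp_der.sub hgL).toLp _ := by
      rw [MemLp.toLp_sub (hf n).memLp_der hgL, Lp.toLp_coeFn]
    rw [h2, MemLp.norm_toLp_sq]
    rfl
  -- the functions converge uniformly
  have hunif : ∀ n x, (f n x - F x) ^ 2 ≤ L * a n := by
    intro n x
    -- Let m tend to infinity in the sup bound for f n − f m.
    have h1 : Tendsto (fun m => (f n x - f m x) ^ 2) atTop (𝓝 ((f n x - F x) ^ 2)) :=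
      (tendsto_const_nhds.sub (hF x)).pow 2
    have h2 : Tendsto (fun m => L * (a n + a m)) atTop (𝓝 (L * (a n + 0))) :=
      (tendsto_const_nhds.add ha).const_mul L
    rw [add_zero] at h2
    refine le_of_tendsto_of_tendsto' h1 h2 fun m => ?_
    have h3 := ((hf n).add_smul (hf m) (-1)).sq_le hconn hL hLpos hD x
    rw [integral_der_sub_sq (hf n) (hf m)] at h3
    refine le_trans (le_of_eq (by ring)) (h3.trans ?_)
    exact mul_le_mul_of_nonneg_left (hcau n m) hLpos.le
  have hunif' : ∀ ε > 0, ∀ᶠ n in atTop, ∀ x, |F x - f n x| < ε := by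
    intro ε hε
    filter_upwards [ha.eventually (gt_mem_nhds (show 0 < ε ^ 2 / L by positivity))] with n hn x
    refine abs_lt_of_sq_lt_sq ?_ hε.le
    rw [lt_div_iff₀ hLpos] at hn
    linarith [hunif n x, sub_sq_comm (F x) (f n x)]
  have htu : TendstoUniformly f F atTop :=
    Metric.tendstoUniformly_iff.2 fun ε hε => hunif' ε hε
  have hFc : Continuous F := htu.continuous (Frequently.of_forall fun n => (hf n).continuous)
  have hFB : ∀ p ∈ D, G.HasValueAt F p 0 := by
    rintro (v | γ) hp
    · refine tendsto_nhds_unique (hF _) (tendsto_const_nhds.congr fun n => ?_)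
      exact ((hf n).2 _ hp).symm
    -- Pointwise convergence does not see the ends; uniform convergence permits exchanging the two
    -- limits.
    · refine Metric.tendsto_nhds.2 fun ε hε => ?_
      obtain ⟨n, hn⟩ := (hunif' (ε / 2) (by positivity)).exists
      have h1 : Tendsto (f n) γ.filter (𝓝 0) := (hf n).2 _ hp
      filter_upwards [Metric.tendsto_nhds.1 h1 (ε / 2) (by positivity)] with x hx
      have h2 := hn x
      rw [Real.dist_eq, sub_zero, abs_lt] at *
      constructor <;> linarith [h2.1, h2.2, hx.1, hx.2]
  -- the limit is a primitive of the limit of the derivatives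
  have hint : ∀ e, IntervalIntegrable (fun t => g ⟨e, t⟩) volume 0 (G.length e) := fun e =>
    (intervalIntegrable_iff_integrableOn_Icc_of_le (G.length_pos e).le).2
      ((integrable_vol_iff.1 (hgL.integrable one_le_two)).1 e)
  have hprim : ∀ e, ∀ t ∈ Icc 0 (G.length e),
      G.onEdge F e t = G.onEdge F e 0 + ∫ x in (0 : ℝ)..t, g ⟨e, x⟩ := by
    intro e t ht
    have h0 : (0 : ℝ) ∈ Icc 0 (G.length e) := ⟨le_rfl, (G.length_pos e).le⟩
    have hsub : uIcc 0 t ⊆ uIcc 0 (G.length e) := by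
      rw [uIcc_of_le ht.1, uIcc_of_le (G.length_pos e).le]
      exact Icc_subset_Icc_right ht.2
    have h1 : Tendsto (fun n => G.onEdge (f n) e t - G.onEdge (f n) e 0) atTop
        (𝓝 (G.onEdge F e t - G.onEdge F e 0)) := (hF _).sub (hF _)
    have h2 : Tendsto (fun n => (G.onEdge (f n) e t - G.onEdge (f n) e 0) -
        ∫ x in (0 : ℝ)..t, g ⟨e, x⟩) atTop (𝓝 0) := by
      have h3 : Tendsto (fun n => |t - 0| * ∫ x, (G.der (f n) x - g x) ^ 2 ∂G.vol) atTop
          (𝓝 (|t - 0| * 0)) := hconv.const_mul _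
      rw [mul_zero] at h3
      have h4 : Tendsto (fun n => ((G.onEdge (f n) e t - G.onEdge (f n) e 0) -
          ∫ x in (0 : ℝ)..t, g ⟨e, x⟩) ^ 2) atTop (𝓝 0) := by
        refine squeeze_zero (fun n => sq_nonneg _) (fun n => ?_) h3
        have h5 := ((hf n).ac e).mono hsub
        rw [← h5.integral_deriv_eq_sub, ← intervalIntegral.integral_sub
          h5.intervalIntegrable_deriv ((hint e).mono_set hsub)]
        exact sq_sub_le_of_eq_integral ((hf n).memLp_der.sub hgL) h0 ht
      have h6 := h4.sqrt
      simp only [Real.sqrt_sq_eq_abs, Real.sqrt_zero] at h6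
      exact (tendsto_zero_iff_abs_tendsto_zero _).2 h6
    have h3 := tendsto_nhds_unique h2 (h1.sub_const _)
    linarith
  have hac : ∀ e, AbsolutelyContinuousOnInterval (G.onEdge F e) 0 (G.length e) := by
    intro e
    have h1 := (hint e).absolutelyContinuousOnInterval_intervalIntegral left_mem_uIcc
    have h2 : AbsolutelyContinuousOnInterval (fun _ : ℝ => G.onEdge F e 0) 0 (G.length e) :=
      (LipschitzWith.const (α := ℝ) (G.onEdge F e 0)).lipschitzOnWith.absolutelyContinuousOnInterval
    refine (h2.add h1).congr_of_eqOn fun t ht => ?_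
    rw [uIcc_of_le (G.length_pos e).le] at ht
    exact (hprim e t ht).symm
  have hder : G.der F =ᵐ[G.vol] g := by
    refine ae_vol_iff.2 fun e => ?_
    rw [ae_restrict_iff' measurableSet_Icc]
    -- The primitive formula holds only on the edge, so the two endpoints, a null set, are excluded
    -- before differentiating.
    have hne : ∀ c : ℝ, ∀ᵐ t, t ≠ c := fun c => by simp [ae_iff, measure_singleton]
    filter_upwards [(hint e).ae_hasDerivAt_integral, hne 0, hne (G.length e)] with t h1 h2 h3 ht
    have h4 : t ∈ Ioo 0 (G.length e) := ⟨lt_of_le_of_ne ht.1 h2.symm, lt_of_le_of_ne ht.2 h3⟩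
    rw [uIcc_of_le (G.length_pos e).le] at h1
    have h5 := (h1 ht 0 ⟨le_rfl, (G.length_pos e).le⟩).const_add (G.onEdge F e 0)
    refine (h5.congr_of_eventuallyEq ?_).deriv
    filter_upwards [Ioo_mem_nhds h4.1 h4.2] with s hs
    exact hprim e s (Ioo_subset_Icc_self hs)
  have hFd : MemLp (G.der F) 2 G.vol := (memLp_congr_ae hder).2 hgL
  have hFb : MemLp (G.lift F) 2 G.vol := by
    refine MemLp.of_bound (measurable_lift hFc).aestronglyMeasurable
      (√(L * ∫ x, G.der F x ^ 2 ∂G.vol)) (Eventually.of_forall fun x => ?_)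
    obtain ⟨p, hp⟩ := hD
    exact Real.abs_le_sqrt
      (sq_le_length_mul hconn hL hLpos hFc hac hFd (hFB p hp).mem_closure_range _)
  refine ⟨⟨memH1_iff.2 ⟨hFc, hac, hFb, hFd⟩, hFB⟩, ?_⟩
  have h1 := hg.norm.pow 2
  simp only [MemLp.norm_toLp_sq] at h1
  convert h1 using 2
  rw [← hFd.norm_toLp_sq]
  congr 2
  rw [MemLp.toLp_eq_toLp_iff hFd hgL |>.2 hder, Lp.toLp_coeFn]

/-- The infimum of the Rayleigh quotient is attained. -/
theorem exists_minimizer [Countable E] [Nonempty E] (hconn : G.Connected) {L : ℝ}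
    (hL : HasSum G.length L) (hLpos : 0 < L) (hD : D.Nonempty) :
    ∃ f, G.MemH10 D f ∧ ∫ x, G.lift f x ^ 2 ∂G.vol = 1 ∧
      ∫ x, G.der f x ^ 2 ∂G.vol = G.rayleighInf D := by
  have hfin := isFiniteMeasure_vol hL
  set lam := G.rayleighInf D with hlam
  have hlam0 : 0 ≤ lam := rayleighInf_nonneg
  have hne : {c | ∃ f, G.MemH10 D f ∧ ∫ x, G.lift f x ^ 2 ∂G.vol = 1 ∧
      ∫ x, G.der f x ^ 2 ∂G.vol = c}.Nonempty := by
    obtain ⟨e₀⟩ := ‹Nonempty E›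
    obtain ⟨g, h1, h2, -⟩ := exists_normalized (D := D) (memH10_bump hconn e₀) (bump_ne_zero e₀)
    exact ⟨_, g, h1, h2, rfl⟩
  obtain ⟨u, -, hu, hmem⟩ := exists_seq_tendsto_sInf hne
    ⟨0, by rintro _ ⟨f, -, -, rfl⟩; exact integral_nonneg fun x => sq_nonneg _⟩
  choose f₀ hf₀ hN₀ hQ₀ using hmem
  obtain ⟨C, hC⟩ := hu.bddAbove_range
  have hC₀ : ∀ n, ∫ x, G.der (f₀ n) x ^ 2 ∂G.vol ≤ C := fun n => by
    rw [hQ₀]; exact hC ⟨n, rfl⟩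
  obtain ⟨φ, hφ, hy⟩ := exists_subseq_tendsto hconn hL hLpos hD hf₀ hC₀
  choose F hF using hy
  set f : ℕ → G.Point → ℝ := fun n => f₀ (φ n) with hfdef
  have hf : ∀ n, G.MemH10 D (f n) := fun n => hf₀ _
  have hN : ∀ n, ∫ x, G.lift (f n) x ^ 2 ∂G.vol = 1 := fun n => hN₀ _
  have hQ : Tendsto (fun n => ∫ x, G.der (f n) x ^ 2 ∂G.vol) atTop (𝓝 lam) := by
    simp only [hfdef, hQ₀]
    exact hu.comp hφ.tendsto_atTop
  have hB : ∀ n x, |f n x| ≤ √(L * C) := fun n x =>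
    Real.abs_le_sqrt (((hf n).sq_le hconn hL hLpos hD x).trans
      (mul_le_mul_of_nonneg_left (hC₀ _) hLpos.le))
  have hFB : ∀ x, |F x| ≤ √(L * C) := fun x =>
    le_of_tendsto (hF x).abs (Eventually.of_forall fun n => hB n x)
  have hFm : AEStronglyMeasurable (G.lift F) G.vol :=
    aestronglyMeasurable_of_tendsto_ae (u := atTop) (f := fun n => G.lift (f n))
      (fun n => (measurable_lift (hf n).continuous).aestronglyMeasurable)
      (Eventually.of_forall fun x => hF _)
  have hFL : MemLp (G.lift F) 2 G.vol :=
    MemLp.of_bound hFm (√(L * C)) (Eventually.of_forall fun x => hFB _)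
  -- convergence in `L²`
  have hL2 : Tendsto (fun n => ∫ x, (G.lift (f n) x - G.lift F x) ^ 2 ∂G.vol) atTop (𝓝 0) := by
    rw [← integral_zero (Lines E) ℝ (μ := G.vol)]
    refine tendsto_integral_of_dominated_convergence (fun _ => (√(L * C) + √(L * C)) ^ 2)
      (fun n => (((measurable_lift (hf n).continuous).aestronglyMeasurable.sub hFm).pow 2))
      (integrable_const _) (fun n => Eventually.of_forall fun x => ?_)
      (Eventually.of_forall fun x => ?_)
    · rw [norm_pow]
      exact pow_le_pow_left₀ (norm_nonneg _)
        ((norm_sub_le _ _).trans (add_le_add (hB _ _) (hFB _))) 2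
    · simpa using! ((hF (G.toPoint x)).sub_const (F (G.toPoint x))).pow 2
  have hFN : ∫ x, G.lift F x ^ 2 ∂G.vol = 1 := by
    refine tendsto_nhds_unique (tendsto_integral_of_dominated_convergence
      (F := fun n x => G.lift (f n) x ^ 2) (fun _ => √(L * C) ^ 2)
      (fun n => (measurable_lift (hf n).continuous).aestronglyMeasurable.pow 2)
      (integrable_const _) (fun n => Eventually.of_forall fun x => ?_)
      (Eventually.of_forall fun x => (hF (G.toPoint x)).pow 2)) ?_
    · rw [norm_pow]
      exact pow_le_pow_left₀ (norm_nonneg _) (hB _ _) 2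
    · simp only [hN]
      exact tendsto_const_nhds
  -- The parallelogram identity. The energy of f n + f m is at least λ times its squared norm, which
  -- is 4 minus the squared norm of f n − f m. Hence f n and f m, both of nearly minimal energy and
  -- close in L², have close derivatives.
  have hcau : ∀ n m, ∫ x, (G.der (f n) x - G.der (f m) x) ^ 2 ∂G.vol ≤
      (2 * (∫ x, G.der (f n) x ^ 2 ∂G.vol - lam) +
        2 * lam * ∫ x, (G.lift (f n) x - G.lift F x) ^ 2 ∂G.vol) +
      (2 * (∫ x, G.der (f m) x ^ 2 ∂G.vol - lam) +
        2 * lam * ∫ x, (G.lift (f m) x - G.lift F x) ^ 2 ∂G.vol) := by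
    intro n m
    have h1 := (hf n).memLp_der.integral_parallelogram (hf m).memLp_der
    have h2 := (hf n).memLp_lift.integral_parallelogram (hf m).memLp_lift
    have h3 := rayleighInf_mul_le ((hf n).add_smul (hf m) 1)
    have h4 : ∫ x, G.der (fun x => f n x + 1 * f m x) x ^ 2 ∂G.vol =
        ∫ x, (G.der (f n) x + G.der (f m) x) ^ 2 ∂G.vol := by
      refine integral_congr_ae ?_
      filter_upwards [der_add_smul_ae (hf n).ac (hf m).ac 1] with x hx
      rw [hx, one_mul]
    have h5 : ∫ x, G.lift (fun x => f n x + 1 * f m x) x ^ 2 ∂G.vol =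
        ∫ x, (G.lift (f n) x + G.lift (f m) x) ^ 2 ∂G.vol := by
      simp only [lift, one_mul]
    have h6 : ∫ x, (G.lift (f n) x - G.lift (f m) x) ^ 2 ∂G.vol ≤
        2 * ∫ x, (G.lift (f n) x - G.lift F x) ^ 2 ∂G.vol +
          2 * ∫ x, (G.lift (f m) x - G.lift F x) ^ 2 ∂G.vol := by
      have h7 := ((hf n).memLp_lift.sub hFL).integral_parallelogram ((hf m).memLp_lift.sub hFL)
      simp only [Pi.sub_apply, sub_sub_sub_cancel_right] at h7
      have h8 : 0 ≤ ∫ x, (G.lift (f n) x - G.lift F x + (G.lift (f m) x - G.lift F x)) ^ 2 ∂G.vol :=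
        integral_nonneg fun x => sq_nonneg _
      linarith
    rw [h4, h5, ← hlam] at h3
    rw [hN, hN] at h2
    have h7 := mul_le_mul_of_nonneg_left h6 hlam0
    have h8 : lam * ∫ x, (G.lift (f n) x + G.lift (f m) x) ^ 2 ∂G.vol =
        4 * lam - lam * ∫ x, (G.lift (f n) x - G.lift (f m) x) ^ 2 ∂G.vol := by
      rw [eq_sub_iff_add_eq, ← mul_add, h2]; ring
    linarith
  have ha : Tendsto (fun n => 2 * (∫ x, G.der (f n) x ^ 2 ∂G.vol - lam) +
      2 * lam * ∫ x, (G.lift (f n) x - G.lift F x) ^ 2 ∂G.vol) atTop (𝓝 0) := by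
    simpa using ((hQ.sub_const lam).const_mul 2).add (hL2.const_mul (2 * lam))
  obtain ⟨h1, h2⟩ := memH10_of_tendsto hconn hL hLpos hD hf hF ha hcau
  exact ⟨F, h1, hFN, tendsto_nhds_unique h2 hQ⟩

theorem memLp_lift_const_mul {f : G.Point → ℝ} (hf : MemLp (G.lift f) 2 G.vol) (c : ℝ) :
    MemLp (G.lift fun x => c * f x) 2 G.vol :=
  MemLp.const_mul hf c

/-- A minimizer of the Rayleigh quotient is an eigenfunction. -/
theorem isLeast_rayleighInf [Countable E] [Nonempty E] (hconn : G.Connected) {L : ℝ}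
    (hL : HasSum G.length L) (hLpos : 0 < L) (hD : D.Nonempty) :
    IsLeast (G.mixedEigenvalues D) (G.rayleighInf D) := by
  constructor
  · obtain ⟨f, hf, hN, hQ⟩ := exists_minimizer hconn hL hLpos hD
    refine ⟨f, ?_, hf, ?_, fun h hh => ?_⟩
    · rintro rfl
      simp [lift] at hN
    · exact memL2_iff.2 (memLp_lift_const_mul hf.memLp_lift _)
    · rw [dirichletForm_eq hf.memLp_der hh.memLp_der,
        innerL2_eq (memLp_lift_const_mul hf.memLp_lift _) hh.memLp_lift]
      have h1 : ∀ x, G.lift (fun x => G.rayleighInf D * f x) x * G.lift h x =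
          G.rayleighInf D * (G.lift f x * G.lift h x) := fun x => mul_assoc _ _ _
      simp only [h1]
      rw [integral_const_mul]
      set lam := G.rayleighInf D
      set B := ∫ x, G.der f x * G.der h x ∂G.vol
      set I := ∫ x, G.lift f x * G.lift h x ∂G.vol
      -- First variation: energy minus λ times squared norm is nonnegative at f + c h and zero at c
      -- = 0, so the linear coefficient of this quadratic polynomial in c has to vanish.
      have key : ∀ c : ℝ, 0 ≤ 2 * c * (B - lam * I) +
          c ^ 2 * (∫ x, G.der h x ^ 2 ∂G.vol - lam * ∫ x, G.lift h x ^ 2 ∂G.vol) := by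
        intro c
        have h2 := rayleighInf_mul_le (hf.add_smul hh c)
        have h3 : ∫ x, G.der (fun x => f x + c * h x) x ^ 2 ∂G.vol =
            ∫ x, (G.der f x + c * G.der h x) ^ 2 ∂G.vol := by
          refine integral_congr_ae ?_
          filter_upwards [der_add_smul_ae hf.ac hh.ac c] with x hx
          rw [hx]
        have h4 : ∫ x, G.lift (fun x => f x + c * h x) x ^ 2 ∂G.vol =
            ∫ x, (G.lift f x + c * G.lift h x) ^ 2 ∂G.vol := rfl
        rw [h3, h4, hf.memLp_der.integral_sq_add_smul hh.memLp_der,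
          hf.memLp_lift.integral_sq_add_smul hh.memLp_lift, hN, hQ] at h2
        linarith
      set R := ∫ x, G.der h x ^ 2 ∂G.vol - lam * ∫ x, G.lift h x ^ 2 ∂G.vol
      by_contra hne
      have hne : B - lam * I ≠ 0 := sub_ne_zero.2 hne
      have hsq : 0 < (B - lam * I) ^ 2 := by positivity
      have hR : 0 < |R| + 1 := by positivity
      -- A step against the sign of the linear coefficient, short enough for the quadratic term not
      -- to compensate: R < 2(|R| + 1).
      have h5 := key (-(B - lam * I) / (|R| + 1))
      have h6 : 2 * (-(B - lam * I) / (|R| + 1)) * (B - lam * I) +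
          (-(B - lam * I) / (|R| + 1)) ^ 2 * R =
          (B - lam * I) ^ 2 * (R - 2 * (|R| + 1)) / (|R| + 1) ^ 2 := by
        field_simp
        ring
      rw [h6] at h5
      have h7 : (B - lam * I) ^ 2 * (R - 2 * (|R| + 1)) / (|R| + 1) ^ 2 < 0 := by
        refine div_neg_of_neg_of_pos (mul_neg_of_pos_of_neg hsq ?_) (by positivity)
        linarith [le_abs_self R, abs_nonneg R]
      linarith
  · rintro lam ⟨f, h0, hf, -, hw⟩
    have h1 := hw f hf
    rw [dirichletForm_eq hf.memLp_der hf.memLp_der,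
      innerL2_eq (memLp_lift_const_mul hf.memLp_lift _) hf.memLp_lift] at h1
    have h2 : ∀ x, G.lift (fun x => lam * f x) x * G.lift f x = lam * G.lift f x ^ 2 := fun x => by
      rw [sq, ← mul_assoc]; rfl
    simp only [h2, ← sq] at h1
    rw [integral_const_mul] at h1
    have h3 := rayleighInf_mul_le hf
    rw [h1] at h3
    exact le_of_mul_le_mul_right h3 (integral_lift_sq_pos hf.continuous hf.memLp_lift h0)

end MetricGraph

/-! ### Distribution function and decreasing rearrangement -/

section Rearrangement

variable {α : Type*} [MeasurableSpace α] (μ : Measure α) (u : α → ℝ)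

/-- The measure of the superlevel sets of a function. -/
noncomputable def tailMeasure (t : ℝ) : ℝ := μ.real {x | t < u x}

/-- The decreasing rearrangement of a nonnegative function. -/
noncomputable def decreasingRearrangement (m : ℝ) : ℝ :=
  sInf {t | 0 ≤ t ∧ tailMeasure μ u t ≤ max m 0}

variable {μ u}

theorem tailMeasure_nonneg (t : ℝ) : 0 ≤ tailMeasure μ u t := measureReal_nonneg

theorem tailMeasure_antitone [IsFiniteMeasure μ] : Antitone (tailMeasure μ u) :=
  fun _ _ h => measureReal_mono fun _ hx => lt_of_le_of_lt h hx

theorem tailMeasure_eq_zero {S : ℝ} (hS : ∀ x, u x ≤ S) : tailMeasure μ u S = 0 := by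
  have : {x | S < u x} = ∅ := eq_empty_of_forall_notMem fun x hx => not_lt.2 (hS x) hx
  rw [tailMeasure, this, measureReal_empty]

/-- Right continuity of the distribution function: {u > t} is the increasing union of the sets {u >
t + 1/(n+1)}. -/
theorem exists_gt_lt_tailMeasure [IsFiniteMeasure μ] {t m : ℝ} (h : m < tailMeasure μ u t) :
    ∃ t' > t, m < tailMeasure μ u t' := by
  have h1 : {x | t < u x} = ⋃ n : ℕ, {x | t + 1 / ((n : ℝ) + 1) < u x} := by
    ext x
    simp only [mem_ofPred_eq, mem_iUnion]
    constructor
    · intro hx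
      obtain ⟨n, hn⟩ := exists_nat_one_div_lt (sub_pos.2 hx)
      exact ⟨n, by linarith⟩
    · rintro ⟨n, hn⟩
      have : (0 : ℝ) < 1 / ((n : ℝ) + 1) := by positivity
      linarith
  have hmono : Monotone fun n : ℕ => {x | t + 1 / ((n : ℝ) + 1) < u x} := by
    intro a b hab x hx
    have : 1 / ((b : ℝ) + 1) ≤ 1 / ((a : ℝ) + 1) := one_div_le_one_div_of_le (by positivity)
      (by exact_mod_cast Nat.succ_le_succ hab)
    have hx : t + 1 / ((a : ℝ) + 1) < u x := hx
    change t + 1 / ((b : ℝ) + 1) < u x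
    linarith
  have h2 := tendsto_measure_iUnion_atTop (μ := μ) hmono
  rw [← h1] at h2
  have h3 := (ENNReal.tendsto_toReal (measure_ne_top μ _)).comp h2
  obtain ⟨n, hn⟩ := (h3.eventually (lt_mem_nhds h)).exists
  exact ⟨t + 1 / ((n : ℝ) + 1), by linarith [show (0 : ℝ) < 1 / ((n : ℝ) + 1) by positivity], hn⟩

theorem decreasingRearrangement_nonneg (m : ℝ) : 0 ≤ decreasingRearrangement μ u m :=
  Real.sInf_nonneg fun _ ht => ht.1

theorem bddBelow_rearrangement_set (m : ℝ) :
    BddBelow {t | 0 ≤ t ∧ tailMeasure μ u t ≤ max m 0} := ⟨0, fun _ ht => ht.1⟩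

theorem decreasingRearrangement_le {S : ℝ} (hS0 : 0 ≤ S) (hS : ∀ x, u x ≤ S) (m : ℝ) :
    decreasingRearrangement μ u m ≤ S :=
  csInf_le (bddBelow_rearrangement_set m)
    ⟨hS0, by rw [tailMeasure_eq_zero hS]; exact le_max_right _ _⟩

/-- The rearrangement is the generalized inverse of the distribution function. Right continuity is
what makes this an equivalence of strict inequalities, on which all later facts about the
rearrangement rest. -/
theorem lt_decreasingRearrangement_iff [IsFiniteMeasure μ] {S : ℝ} (hS0 : 0 ≤ S)
    (hS : ∀ x, u x ≤ S) {t m : ℝ} (ht : 0 ≤ t) (hm : 0 ≤ m) :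
    t < decreasingRearrangement μ u m ↔ m < tailMeasure μ u t := by
  constructor
  · intro h
    by_contra! h1
    exact not_lt.2 (csInf_le (bddBelow_rearrangement_set m) ⟨ht, h1.trans (le_max_left _ _)⟩) h
  · intro h
    obtain ⟨t', h1, h2⟩ := exists_gt_lt_tailMeasure h
    refine h1.trans_le (le_csInf ⟨S, hS0, ?_⟩ fun s hs => ?_)
    · rw [tailMeasure_eq_zero hS]; exact le_max_right _ _
    · by_contra! h3
      have h4 := hs.2
      rw [max_eq_left hm] at h4
      exact absurd (tailMeasure_antitone h3.le) (not_le.2 (h4.trans_lt h2))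

theorem measurable_decreasingRearrangement {S : ℝ} (hS0 : 0 ≤ S) (hS : ∀ x, u x ≤ S) :
    Measurable (decreasingRearrangement μ u) := by
  refine Antitone.measurable fun a b hab => ?_
  refine csInf_le_csInf (bddBelow_rearrangement_set b) ⟨S, hS0, ?_⟩ fun t ht =>
    ⟨ht.1, ht.2.trans (max_le_max_right _ hab)⟩
  rw [tailMeasure_eq_zero hS]; exact le_max_right _ _

theorem tailMeasure_decreasingRearrangement_le [IsFiniteMeasure μ] {S : ℝ} (hS0 : 0 ≤ S)
    (hS : ∀ x, u x ≤ S) {m : ℝ} (hm : 0 ≤ m) :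
    tailMeasure μ u (decreasingRearrangement μ u m) ≤ m := by
  by_contra! h
  exact lt_irrefl _ ((lt_decreasingRearrangement_iff hS0 hS
    (decreasingRearrangement_nonneg m) hm).2 h)

/-- Equimeasurability. By the inverse relation the preimage of (t, ∞) is the interval (0, M(t)),
where M is the distribution function, so both measures agree on these rays for t ≥ 0; neither
charges negative values. -/
theorem map_decreasingRearrangement [IsFiniteMeasure μ] {S : ℝ} (hS0 : 0 ≤ S)
    (hS : ∀ x, u x ≤ S) (hu : Measurable u) :
    (volume.restrict (Ioo 0 (tailMeasure μ u 0))).map (decreasingRearrangement μ u) =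
      (μ.restrict {x | 0 < u x}).map u := by
  have hq := measurable_decreasingRearrangement (μ := μ) hS0 hS
  have hkey : ∀ t, 0 ≤ t → (volume.restrict (Ioo 0 (tailMeasure μ u 0))).map
      (decreasingRearrangement μ u) (Ioi t) = (μ.restrict {x | 0 < u x}).map u (Ioi t) := by
    intro t ht
    rw [Measure.map_apply hq measurableSet_Ioi, Measure.map_apply hu measurableSet_Ioi,
      Measure.restrict_apply (hq measurableSet_Ioi), Measure.restrict_apply (hu measurableSet_Ioi)]
    have h1 : decreasingRearrangement μ u ⁻¹' Ioi t ∩ Ioo 0 (tailMeasure μ u 0) =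
        Ioo 0 (tailMeasure μ u t) := by
      ext m
      simp only [mem_inter_iff, mem_preimage, mem_Ioi, mem_Ioo]
      constructor
      · rintro ⟨h1, h2, -⟩
        exact ⟨h2, (lt_decreasingRearrangement_iff hS0 hS ht h2.le).1 h1⟩
      · rintro ⟨h1, h2⟩
        exact ⟨(lt_decreasingRearrangement_iff hS0 hS ht h1.le).2 h2, h1,
          h2.trans_le (tailMeasure_antitone ht)⟩
    have h2 : u ⁻¹' Ioi t ∩ {x | 0 < u x} = {x | t < u x} := by
      ext x
      exact ⟨fun h => h.1, fun h => ⟨h, lt_of_le_of_lt ht h⟩⟩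
    rw [h1, h2, Real.volume_Ioo, sub_zero, tailMeasure, ofReal_measureReal]
  have hfin1 : IsFiniteMeasure (volume.restrict (Ioo 0 (tailMeasure μ u 0))) :=
    ⟨by rw [Measure.restrict_apply_univ, Real.volume_Ioo]; exact ENNReal.ofReal_lt_top⟩
  have hfin2 := Measure.isFiniteMeasure_map (volume.restrict (Ioo 0 (tailMeasure μ u 0)))
    (decreasingRearrangement μ u)
  have hfin3 := Measure.isFiniteMeasure_map (μ.restrict {x | 0 < u x}) u
  refine Measure.ext_of_Iic _ _ fun t => ?_
  rcases lt_or_ge t 0 with ht | ht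
  · rw [Measure.map_apply hq measurableSet_Iic, Measure.map_apply hu measurableSet_Iic,
      Measure.restrict_apply (hu measurableSet_Iic)]
    have h1 : decreasingRearrangement μ u ⁻¹' Iic t = ∅ :=
      eq_empty_of_forall_notMem fun m hm =>
        not_le.2 (ht.trans_le (decreasingRearrangement_nonneg m)) hm
    have h2 : u ⁻¹' Iic t ∩ {x | 0 < u x} = ∅ :=
      eq_empty_of_forall_notMem fun x hx => not_le.2 (ht.trans hx.2) hx.1
    rw [h1, h2, measure_empty, measure_empty]
  · rw [← compl_Ioi, measure_compl measurableSet_Ioi (measure_ne_top _ _),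
      measure_compl measurableSet_Ioi (measure_ne_top _ _), hkey t ht]
    congr 1
    rw [Measure.map_apply hq MeasurableSet.univ, Measure.map_apply hu MeasurableSet.univ,
      preimage_univ, preimage_univ, Measure.restrict_apply_univ, Measure.restrict_apply_univ,
      Real.volume_Ioo, sub_zero, tailMeasure, ofReal_measureReal]

/-- The condition F 0 = 0 accounts for the set {u = 0}, which the rearrangement on (0, M(0)) does
not see. -/
theorem lintegral_decreasingRearrangement [IsFiniteMeasure μ] {S : ℝ} (hS0 : 0 ≤ S)
    (hS : ∀ x, u x ≤ S) (hu : Measurable u) (hu0 : ∀ x, 0 ≤ u x) {F : ℝ → ℝ≥0∞}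
    (hF : Measurable F) (hF0 : F 0 = 0) :
    ∫⁻ m in Ioo 0 (tailMeasure μ u 0), F (decreasingRearrangement μ u m) =
      ∫⁻ x, F (u x) ∂μ := by
  rw [← lintegral_map hF (measurable_decreasingRearrangement hS0 hS),
    map_decreasingRearrangement hS0 hS hu, lintegral_map hF hu,
    ← lintegral_indicator (show MeasurableSet {x | 0 < u x} from hu measurableSet_Ioi)]
  refine lintegral_congr fun x => ?_
  by_cases hx : 0 < u x
  · exact indicator_of_mem (by exact hx) _
  · rw [indicator_of_notMem (by exact hx), le_antisymm (not_lt.1 hx) (hu0 x), hF0]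

end Rearrangement

/-! ### The calibrated sharp inequality -/

theorem ENNReal.two_mul_mul_le_sq_add_sq (a b : ℝ≥0∞) : 2 * (a * b) ≤ a ^ 2 + b ^ 2 := by
  by_cases ha : a = ⊤
  · simp [ha]
  by_cases hb : b = ⊤
  · simp [hb]
  lift a to ℝ≥0 using ha
  lift b to ℝ≥0 using hb
  norm_cast
  rw [← mul_assoc]
  exact two_mul_le_add_sq a b

/-- From tan x − tan y = tan(x − y)(1 + tan x tan y) and tan z ≥ z. This quantitative monotonicity
produces the remainder that detects plateaus. -/
theorem Real.sub_le_tan_sub_tan {x y : ℝ} (hy : 0 ≤ y) (hyx : y ≤ x) (hx : x < Real.pi / 2) :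
    x - y ≤ Real.tan x - Real.tan y := by
  have hcx : 0 < Real.cos x := Real.cos_pos_of_mem_Ioo ⟨by linarith [Real.pi_pos], hx⟩
  have hcy : 0 < Real.cos y := Real.cos_pos_of_mem_Ioo ⟨by linarith [Real.pi_pos], by linarith⟩
  have hc : 0 < Real.cos (x - y) :=
    Real.cos_pos_of_mem_Ioo ⟨by linarith [Real.pi_pos], by linarith⟩
  have h1 : Real.tan x - Real.tan y = Real.tan (x - y) * (1 + Real.tan x * Real.tan y) := by
    have h2 : Real.cos (x - y) = Real.cos x * Real.cos y * (1 + Real.tan x * Real.tan y) := by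
      rw [Real.cos_sub, Real.tan_eq_sin_div_cos, Real.tan_eq_sin_div_cos]
      field_simp
    have h3 : Real.sin (x - y) = Real.cos x * Real.cos y * (Real.tan x - Real.tan y) := by
      rw [Real.sin_sub, Real.tan_eq_sin_div_cos, Real.tan_eq_sin_div_cos]
      field_simp
    have h4 : Real.tan (x - y) * Real.cos (x - y) = Real.sin (x - y) :=
      Real.tan_mul_cos hc.ne'
    rw [h2, h3] at h4
    have h5 : Real.cos x * Real.cos y ≠ 0 := by positivity
    apply mul_left_cancel₀ h5
    rw [← h4]
    ring
  have h2 := Real.le_tan (sub_nonneg.2 hyx) (by linarith : x - y < Real.pi / 2)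
  have h3 : 0 ≤ Real.tan x := (hy.trans hyx).trans (Real.le_tan (hy.trans hyx) hx)
  have h4 : 0 ≤ Real.tan y := hy.trans (Real.le_tan hy (by linarith))
  rw [h1]
  nlinarith [mul_nonneg h3 h4]

theorem Real.measurable_tan : Measurable Real.tan := by
  have : Real.tan = fun x => Real.sin x / Real.cos x := funext Real.tan_eq_sin_div_cos
  rw [this]
  exact Real.measurable_sin.div Real.measurable_cos

/-- The Riccati equation g' = k² + g² for g(m) = k tan(km), integrated. It is the reason for
choosing the tangent as calibration. -/
theorem lintegral_Ioo_sq_add_tan_sq {k M : ℝ} (hk : 0 ≤ k) (hM : 0 ≤ M)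
    (hkM : k * M < Real.pi / 2) :
    ∫⁻ m in Ioo 0 M, ENNReal.ofReal (k ^ 2 + (k * Real.tan (k * m)) ^ 2) =
      ENNReal.ofReal (k * Real.tan (k * M)) := by
  have hcos : ∀ m ∈ uIcc 0 M, 0 < Real.cos (k * m) := by
    intro m hm
    rw [uIcc_of_le hM] at hm
    have h1 : k * m ≤ k * M := mul_le_mul_of_nonneg_left hm.2 hk
    have h2 : 0 ≤ k * m := mul_nonneg hk hm.1
    exact Real.cos_pos_of_mem_Ioo ⟨by linarith [Real.pi_pos], by linarith⟩
  have hder : ∀ m ∈ uIcc 0 M, HasDerivAt (fun m => k * Real.tan (k * m))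
      (k ^ 2 + (k * Real.tan (k * m)) ^ 2) m := by
    intro m hm
    have hc := (hcos m hm).ne'
    have h1 := ((Real.hasDerivAt_tan hc).comp m ((hasDerivAt_id m).const_mul k)).const_mul k
    refine h1.congr_deriv ?_
    rw [Real.tan_eq_sin_div_cos]
    field_simp
    rw [Real.cos_sq_add_sin_sq, mul_one]
  have hcont : ContinuousOn (fun m => k ^ 2 + (k * Real.tan (k * m)) ^ 2) (uIcc 0 M) := by
    refine continuousOn_const.add ((ContinuousOn.pow ?_ 2))
    exact fun m hm => (hder m hm).continuousAt.continuousWithinAt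
  have h1 := intervalIntegral.integral_eq_sub_of_hasDerivAt hder hcont.intervalIntegrable
  rw [mul_zero, Real.tan_zero, mul_zero, sub_zero, intervalIntegral.integral_of_le hM,
    integral_Ioc_eq_integral_Ioo] at h1
  rw [← h1, ofReal_integral_eq_lintegral_ofReal]
  · have := hcont.integrableOn_uIcc (μ := volume)
    rw [uIcc_of_le hM] at this
    exact this.mono_set Ioo_subset_Icc_self
  · exact Eventually.of_forall fun m => by positivity

theorem lintegral_Ioo_two_mul {q : ℝ} (hq : 0 ≤ q) :
    ∫⁻ t in Ioo 0 q, ENNReal.ofReal (2 * t) = ENNReal.ofReal (q ^ 2) := by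
  have h1 : ∫ t in (0 : ℝ)..q, 2 * t = q ^ 2 := by
    rw [intervalIntegral.integral_const_mul, integral_id]
    ring
  rw [intervalIntegral.integral_of_le hq, integral_Ioc_eq_integral_Ioo] at h1
  rw [← h1, ofReal_integral_eq_lintegral_ofReal]
  · exact ((continuous_const.mul continuous_id).integrableOn_Icc (a := 0) (b := q)).mono_set
      Ioo_subset_Icc_self
  · filter_upwards [ae_restrict_mem measurableSet_Ioo] with t ht
    have := ht.1
    change 0 ≤ 2 * t
    linarith

section Rearrangement

variable {α : Type*} [MeasurableSpace α] {μ : Measure α} {u : α → ℝ} [IsFiniteMeasure μ]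

theorem mul_tailMeasure_lt {k : ℝ} (hk : 0 ≤ k) (hkl : k * tailMeasure μ u 0 < Real.pi / 2) {t : ℝ}
    (ht : 0 ≤ t) : k * tailMeasure μ u t < Real.pi / 2 :=
  (mul_le_mul_of_nonneg_left (tailMeasure_antitone ht) hk).trans_lt hkl

/-- Tonelli for 2t (k² + k² tan²(km)) over the region under the graph of the distribution function,
described as m < M(t) or as t < q(m). The inner integral over m is given by the Riccati equation,
the one over t is q(m)². -/
theorem lintegral_two_mul_tan_tailMeasure {S : ℝ} (hS0 : 0 ≤ S) (hS : ∀ x, u x ≤ S) {k : ℝ}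
    (hk : 0 ≤ k) (hkl : k * tailMeasure μ u 0 < Real.pi / 2) :
    ∫⁻ t in Ioo 0 S, 2 * ENNReal.ofReal (t * (k * Real.tan (k * tailMeasure μ u t))) =
      ∫⁻ m in Ioo 0 (tailMeasure μ u 0), ENNReal.ofReal (decreasingRearrangement μ u m ^ 2 *
        (k ^ 2 + (k * Real.tan (k * m)) ^ 2)) := by
  set l := tailMeasure μ u 0
  have hM : Measurable (tailMeasure μ u) := tailMeasure_antitone.measurable
  have hset : MeasurableSet {p : ℝ × ℝ | p.2 < tailMeasure μ u p.1} :=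
    measurableSet_lt measurable_snd (hM.comp measurable_fst)
  have hT : Measurable fun m : ℝ => ENNReal.ofReal (k ^ 2 + (k * Real.tan (k * m)) ^ 2) :=
    (((Real.measurable_tan.comp (measurable_id.const_mul k)).const_mul k).pow_const 2
      |>.const_add _).ennreal_ofReal
  have h2t : Measurable fun t : ℝ => ENNReal.ofReal (2 * t) :=
    (measurable_id.const_mul (2 : ℝ)).ennreal_ofReal
  set H : ℝ → ℝ → ℝ≥0∞ := fun t m => {p : ℝ × ℝ | p.2 < tailMeasure μ u p.1}.indicator
    (fun p => ENNReal.ofReal (2 * p.1) * ENNReal.ofReal (k ^ 2 + (k * Real.tan (k * p.2)) ^ 2))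
    (t, m) with hH
  have hHm : Measurable (Function.uncurry H) :=
    ((h2t.comp measurable_fst).mul (hT.comp measurable_snd)).indicator hset
  have h1 : ∀ t ∈ Ioo 0 S, ∫⁻ m in Ioo 0 l, H t m =
      2 * ENNReal.ofReal (t * (k * Real.tan (k * tailMeasure μ u t))) := by
    intro t ht
    have h2 : ∀ m, H t m = (Iio (tailMeasure μ u t)).indicator (fun m => ENNReal.ofReal (2 * t) *
        ENNReal.ofReal (k ^ 2 + (k * Real.tan (k * m)) ^ 2)) m := fun m => rfl
    simp only [h2]
    rw [setLIntegral_indicator measurableSet_Iio]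
    have h3 : Iio (tailMeasure μ u t) ∩ Ioo 0 l = Ioo 0 (tailMeasure μ u t) := by
      ext m
      have := tailMeasure_antitone (μ := μ) (u := u) ht.1.le
      exact ⟨fun h => ⟨h.2.1, h.1⟩, fun h => ⟨h.2, h.1, h.2.trans_le this⟩⟩
    rw [h3, lintegral_const_mul _ hT, lintegral_Ioo_sq_add_tan_sq hk (tailMeasure_nonneg t)
      (mul_tailMeasure_lt hk hkl ht.1.le), ← ENNReal.ofReal_mul (by linarith [ht.1]), mul_assoc,
      ENNReal.ofReal_mul (by norm_num), ENNReal.ofReal_ofNat]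
  have h2 : ∀ m ∈ Ioo 0 l, ∫⁻ t in Ioo 0 S, H t m = ENNReal.ofReal
      (decreasingRearrangement μ u m ^ 2 * (k ^ 2 + (k * Real.tan (k * m)) ^ 2)) := by
    intro m hm
    set q := decreasingRearrangement μ u m
    have hq : 0 ≤ q := decreasingRearrangement_nonneg m
    have h3 : ∀ t ∈ Ioo 0 S, H t m = (Iio q).indicator (fun t => ENNReal.ofReal (2 * t) *
        ENNReal.ofReal (k ^ 2 + (k * Real.tan (k * m)) ^ 2)) t := by
      intro t ht
      have h4 : t < q ↔ m < tailMeasure μ u t :=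
        lt_decreasingRearrangement_iff hS0 hS ht.1.le hm.1.le
      by_cases h5 : t < q
      · rw [indicator_of_mem (show t ∈ Iio q from h5), hH]
        exact indicator_of_mem
          (show (t, m) ∈ {p : ℝ × ℝ | p.2 < tailMeasure μ u p.1} from h4.1 h5) _
      · rw [indicator_of_notMem (show t ∉ Iio q from h5), hH]
        have h6 : (t, m) ∉ {p : ℝ × ℝ | p.2 < tailMeasure μ u p.1} := fun h => h5 (h4.2 h)
        exact indicator_of_notMem h6 _
    rw [setLIntegral_congr_fun measurableSet_Ioo h3, setLIntegral_indicator measurableSet_Iio]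
    have h4 : Iio q ∩ Ioo 0 S = Ioo 0 q := by
      ext t
      have := decreasingRearrangement_le (μ := μ) hS0 hS m
      exact ⟨fun h => ⟨h.2.1, h.1⟩, fun h => ⟨h.2, h.1, h.2.trans_le this⟩⟩
    rw [h4, lintegral_mul_const _ h2t, lintegral_Ioo_two_mul hq, ENNReal.ofReal_mul (sq_nonneg _)]
  rw [← setLIntegral_congr_fun measurableSet_Ioo h1, ← setLIntegral_congr_fun measurableSet_Ioo h2]
  exact lintegral_lintegral_swap hHm.aemeasurable

/-- Young's inequality with the calibration c(t) = t · k tan(k M(t)). The term ∫c(u)² appears on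
both sides and is cancelled, which requires it to be finite; this is why k M(0) stays strictly below
π/2, where the tangent is bounded. -/
theorem sharp_inequality_of_lt {S : ℝ} (hS0 : 0 ≤ S) (hS : ∀ x, u x ≤ S) (hu : Measurable u)
    (hu0 : ∀ x, 0 ≤ u x) {w : α → ℝ≥0∞} (hw : AEMeasurable w μ) {σ : Measure ℝ}
    (hσ : (μ.withDensity w).map u = volume.restrict (Ioo 0 S) + σ) {k : ℝ} (hk : 0 ≤ k)
    (hkl : k * tailMeasure μ u 0 < Real.pi / 2) :
    ENNReal.ofReal (k ^ 2) * ∫⁻ x, ENNReal.ofReal (u x ^ 2) ∂μ +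
      ENNReal.ofReal (k ^ 4) * (∫⁻ m in Ioo 0 (tailMeasure μ u 0),
        ENNReal.ofReal (decreasingRearrangement μ u m ^ 2 *
          (m - tailMeasure μ u (decreasingRearrangement μ u m)) ^ 2)) +
      2 * (ENNReal.ofReal (k ^ 2) * ∫⁻ t, ENNReal.ofReal (t * tailMeasure μ u t) ∂σ) ≤
      ∫⁻ x, w x ^ 2 ∂μ := by
  set l := tailMeasure μ u 0
  have hM : Measurable (tailMeasure μ u) := tailMeasure_antitone.measurable
  have hq : Measurable (decreasingRearrangement μ u) := measurable_decreasingRearrangement hS0 hS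
  have hT : Measurable fun m : ℝ => k * Real.tan (k * m) :=
    (Real.measurable_tan.comp (measurable_id.const_mul k)).const_mul k
  set c : ℝ → ℝ≥0∞ := fun t => ENNReal.ofReal (t * (k * Real.tan (k * tailMeasure μ u t))) with hc
  have hcm : Measurable c := (measurable_id.mul (hT.comp hM)).ennreal_ofReal
  have hTm : ∀ t, 0 ≤ t → k * tailMeasure μ u t ≤ Real.tan (k * tailMeasure μ u t) := fun t ht =>
    Real.le_tan (mul_nonneg hk (tailMeasure_nonneg t)) (mul_tailMeasure_lt hk hkl ht)
  have hT0 : ∀ t, 0 ≤ t → 0 ≤ Real.tan (k * tailMeasure μ u t) := fun t ht =>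
    (mul_nonneg hk (tailMeasure_nonneg t)).trans (hTm t ht)
  -- the term that cancels is finite
  have hfin : ∫⁻ x, c (u x) ^ 2 ∂μ ≠ ⊤ := by
    have hb : ∀ x, c (u x) ^ 2 ≤ ENNReal.ofReal (S * (k * Real.tan (k * l))) ^ 2 := by
      intro x
      refine pow_le_pow_left₀ bot_le (ENNReal.ofReal_le_ofReal ?_) 2
      refine mul_le_mul (hS x) (mul_le_mul_of_nonneg_left ?_ hk)
        (mul_nonneg hk (hT0 _ (hu0 x))) hS0
      have h1 : k * tailMeasure μ u (u x) ≤ k * l :=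
        mul_le_mul_of_nonneg_left (tailMeasure_antitone (hu0 x)) hk
      have h2 := Real.sub_le_tan_sub_tan (mul_nonneg hk (tailMeasure_nonneg (u x))) h1 hkl
      linarith
    refine ne_top_of_le_ne_top ?_ (lintegral_mono hb)
    rw [lintegral_const]
    exact ENNReal.mul_ne_top (ENNReal.pow_ne_top ENNReal.ofReal_ne_top) (measure_ne_top _ _)
  refine (ENNReal.add_le_add_iff_right hfin).1 ?_
  have h1 : 2 * ∫⁻ t, c t ∂(μ.withDensity w).map u ≤
      ∫⁻ x, w x ^ 2 ∂μ + ∫⁻ x, c (u x) ^ 2 ∂μ := by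
    have hcu : Measurable fun x => c (u x) := hcm.comp hu
    rw [lintegral_map hcm hu, lintegral_withDensity_eq_lintegral_mul₀ hw
      (g := fun x => c (u x)) (hcm.comp hu).aemeasurable,
      ← lintegral_const_mul'' _ (hw.mul (hcu.aemeasurable)),
      ← lintegral_add_right _ (hcu.pow_const 2)]
    exact lintegral_mono fun x => ENNReal.two_mul_mul_le_sq_add_sq _ _
  refine le_trans ?_ h1
  rw [hσ, lintegral_add_measure, mul_add, ← lintegral_const_mul _ hcm,
    lintegral_two_mul_tan_tailMeasure hS0 hS hk hkl]
  have h2 : ENNReal.ofReal (k ^ 2) * ∫⁻ t, ENNReal.ofReal (t * tailMeasure μ u t) ∂σ ≤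
      ∫⁻ t, c t ∂σ := by
    have hm : Measurable fun t => ENNReal.ofReal (t * tailMeasure μ u t) :=
      (measurable_id.mul hM).ennreal_ofReal
    rw [← lintegral_const_mul _ hm]
    refine lintegral_mono fun t => ?_
    rw [← ENNReal.ofReal_mul (sq_nonneg k)]
    -- Nothing confines σ to positive levels here; at the others `ENNReal.ofReal` truncates the
    -- integrand to zero.
    rcases le_total t 0 with ht | ht
    · have : k ^ 2 * (t * tailMeasure μ u t) ≤ 0 :=
        mul_nonpos_of_nonneg_of_nonpos (sq_nonneg k)
          (mul_nonpos_of_nonpos_of_nonneg ht (tailMeasure_nonneg t))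
      rw [ENNReal.ofReal_of_nonpos this]
      exact bot_le
    · refine ENNReal.ofReal_le_ofReal ?_
      have h3 := mul_le_mul_of_nonneg_left (mul_le_mul_of_nonneg_left (hTm t ht) hk) ht
      linarith
  have h3 : ENNReal.ofReal (k ^ 2) * ∫⁻ x, ENNReal.ofReal (u x ^ 2) ∂μ +
      ENNReal.ofReal (k ^ 4) * (∫⁻ m in Ioo 0 l,
        ENNReal.ofReal (decreasingRearrangement μ u m ^ 2 *
          (m - tailMeasure μ u (decreasingRearrangement μ u m)) ^ 2)) +
      ∫⁻ x, c (u x) ^ 2 ∂μ ≤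
      ∫⁻ m in Ioo 0 l, ENNReal.ofReal (decreasingRearrangement μ u m ^ 2 *
        (k ^ 2 + (k * Real.tan (k * m)) ^ 2)) := by
    have hm1 : Measurable fun t : ℝ => ENNReal.ofReal (t ^ 2) :=
      (measurable_id.pow_const 2).ennreal_ofReal
    have hm2 : Measurable fun m : ℝ => ENNReal.ofReal (decreasingRearrangement μ u m ^ 2 *
          (m - tailMeasure μ u (decreasingRearrangement μ u m)) ^ 2) :=
      ((hq.pow_const 2).mul ((measurable_id.sub (hM.comp hq)).pow_const 2)).ennreal_ofReal
    have hm3 : Measurable fun m : ℝ => ENNReal.ofReal (decreasingRearrangement μ u m ^ 2) :=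
      hm1.comp hq
    have hm4 : Measurable fun m : ℝ => c (decreasingRearrangement μ u m) := hcm.comp hq
    rw [← lintegral_decreasingRearrangement hS0 hS hu hu0 hm1 (by simp),
      ← lintegral_decreasingRearrangement hS0 hS hu hu0 (hcm.pow_const 2) (by simp [hc]),
      ← lintegral_const_mul _ hm3, ← lintegral_const_mul _ hm2,
      ← lintegral_add_right _ (hm2.const_mul _),
      ← lintegral_add_right _ (hm4.pow_const 2)]
    refine setLIntegral_mono' measurableSet_Ioo fun m hm => ?_
    set q := decreasingRearrangement μ u m
    have hq0 : 0 ≤ q := decreasingRearrangement_nonneg m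
    set a := tailMeasure μ u q
    have ha0 : 0 ≤ a := tailMeasure_nonneg q
    have ham : a ≤ m := tailMeasure_decreasingRearrangement_le hS0 hS hm.1.le
    have hkm : k * m < Real.pi / 2 := (mul_le_mul_of_nonneg_left hm.2.le hk).trans_lt hkl
    have h4 := Real.sub_le_tan_sub_tan (mul_nonneg hk ha0) (mul_le_mul_of_nonneg_left ham hk) hkm
    have h5 : 0 ≤ Real.tan (k * a) := hT0 q hq0
    change ENNReal.ofReal (k ^ 2) * ENNReal.ofReal (q ^ 2) + ENNReal.ofReal (k ^ 4) *
      ENNReal.ofReal (q ^ 2 * (m - a) ^ 2) + ENNReal.ofReal (q * (k * Real.tan (k * a))) ^ 2 ≤ _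
    rw [← ENNReal.ofReal_mul (by positivity), ← ENNReal.ofReal_mul (by positivity),
      ← ENNReal.ofReal_pow (by positivity), ← ENNReal.ofReal_add (by positivity) (by positivity),
      ← ENNReal.ofReal_add (by positivity) (by positivity)]
    refine ENNReal.ofReal_le_ofReal ?_
    -- Since tan(km) ≥ tan(ka) + k(m − a) with nonnegative summands, squaring and dropping the cross
    -- term leaves the plateau remainder.
    have h6 : Real.tan (k * a) ^ 2 + (k * (m - a)) ^ 2 ≤ Real.tan (k * m) ^ 2 := by
      have h7 : 0 ≤ k * (m - a) := mul_nonneg hk (sub_nonneg.2 ham)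
      have h8 : Real.tan (k * a) + k * (m - a) ≤ Real.tan (k * m) := by linarith
      have h9 := pow_le_pow_left₀ (by positivity) h8 2
      nlinarith [mul_nonneg h5 h7]
    have h7 := mul_le_mul_of_nonneg_left h6 (by positivity : 0 ≤ q ^ 2 * k ^ 2)
    linarith
  calc _ = (ENNReal.ofReal (k ^ 2) * ∫⁻ x, ENNReal.ofReal (u x ^ 2) ∂μ +
      ENNReal.ofReal (k ^ 4) * (∫⁻ m in Ioo 0 l,
        ENNReal.ofReal (decreasingRearrangement μ u m ^ 2 *
          (m - tailMeasure μ u (decreasingRearrangement μ u m)) ^ 2)) +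
      ∫⁻ x, c (u x) ^ 2 ∂μ) +
      2 * (ENNReal.ofReal (k ^ 2) * ∫⁻ t, ENNReal.ofReal (t * tailMeasure μ u t) ∂σ) := by ring
    _ ≤ _ := add_le_add h3 (mul_le_mul_right h2 2)

/-- The sharp Friedrichs inequality for a function whose variation dominates Lebesgue measure, with
the remainder terms that govern the case of equality. -/
theorem sharp_inequality {S : ℝ} (hS0 : 0 ≤ S) (hS : ∀ x, u x ≤ S) (hu : Measurable u)
    (hu0 : ∀ x, 0 ≤ u x) {w : α → ℝ≥0∞} (hw : AEMeasurable w μ) {σ : Measure ℝ}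
    (hσ : (μ.withDensity w).map u = volume.restrict (Ioo 0 S) + σ) {k : ℝ} (hk : 0 < k)
    (hkl : k * tailMeasure μ u 0 ≤ Real.pi / 2) (hwfin : ∫⁻ x, w x ^ 2 ∂μ ≠ ⊤) :
    ENNReal.ofReal (k ^ 2) * ∫⁻ x, ENNReal.ofReal (u x ^ 2) ∂μ +
      ENNReal.ofReal (k ^ 4) * (∫⁻ m in Ioo 0 (tailMeasure μ u 0),
        ENNReal.ofReal (decreasingRearrangement μ u m ^ 2 *
          (m - tailMeasure μ u (decreasingRearrangement μ u m)) ^ 2)) +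
      2 * (ENNReal.ofReal (k ^ 2) * ∫⁻ t, ENNReal.ofReal (t * tailMeasure μ u t) ∂σ) ≤
      ∫⁻ x, w x ^ 2 ∂μ := by
  have key : ∀ j, 0 ≤ j → j < k → _ := fun j hj hjk =>
    sharp_inequality_of_lt hS0 hS hu hu0 hw hσ hj (by
      rcases (tailMeasure_nonneg (μ := μ) (u := u) 0).eq_or_lt with h | h
      · rw [← h, mul_zero]; positivity
      · exact (mul_lt_mul_of_pos_right hjk h).trans_le hkl)
  set X := ∫⁻ x, ENNReal.ofReal (u x ^ 2) ∂μ
  set Y := ∫⁻ m in Ioo 0 (tailMeasure μ u 0),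
        ENNReal.ofReal (decreasingRearrangement μ u m ^ 2 *
          (m - tailMeasure μ u (decreasingRearrangement μ u m)) ^ 2)
  set Z := ∫⁻ t, ENNReal.ofReal (t * tailMeasure μ u t) ∂σ
  -- The single value k/2 already shows that the three integrals are finite; hence the left side is
  -- continuous in the parameter, which may then tend to k from below.
  have h0 := ne_top_of_le_ne_top hwfin (key (k / 2) (by positivity) (by linarith))
  obtain ⟨h1, h2⟩ := ENNReal.add_ne_top.1 h0
  obtain ⟨h3, h4⟩ := ENNReal.add_ne_top.1 h1
  have hfac : ∀ {j : ℝ} {A : ℝ≥0∞}, 0 < j → ENNReal.ofReal j * A ≠ ⊤ → A ≠ ⊤ := by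
    rintro j A hj h rfl
    exact h (ENNReal.mul_top (by simpa using hj))
  have hX : X ≠ ⊤ := hfac (by positivity) h3
  have hY : Y ≠ ⊤ := hfac (by positivity) h4
  have hZ : Z ≠ ⊤ := by
    refine hfac (j := (k / 2) ^ 2) (by positivity) fun h => h2 ?_
    rw [h]
    simp
  have hcont : Continuous fun j : ℝ => ENNReal.ofReal (j ^ 2) * X + ENNReal.ofReal (j ^ 4) * Y +
      2 * (ENNReal.ofReal (j ^ 2) * Z) := by
    have hp : ∀ n : ℕ, Continuous fun j : ℝ => ENNReal.ofReal (j ^ n) := fun n =>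
      ENNReal.continuous_ofReal.comp (continuous_pow n)
    exact (((ENNReal.continuous_mul_const hX).comp (hp 2)).add
      ((ENNReal.continuous_mul_const hY).comp (hp 4))).add
      ((ENNReal.continuous_const_mul (by simp)).comp
        ((ENNReal.continuous_mul_const hZ).comp (hp 2)))
  refine le_of_tendsto (hcont.continuousAt.tendsto.mono_left nhdsWithin_le_nhds :
    Tendsto _ (𝓝[<] k) _) ?_
  filter_upwards [Ioo_mem_nhdsLT hk] with j hj
  exact key j hj.1.le hj.2

end Rearrangement

section Rearrangement

variable {α : Type*} [MeasurableSpace α] {μ : Measure α} {u : α → ℝ} [IsFiniteMeasure μ]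

/-- A level set of measure δ > 0 makes the rearrangement equal to t on an interval of length δ to
the right of M(t). There m − M(q(m)) > 0, so the first remainder would be positive. -/
theorem measure_level_eq_zero {S : ℝ} (hS0 : 0 ≤ S) (hS : ∀ x, u x ≤ S) (hu : Measurable u)
    (hY : ∫⁻ m in Ioo 0 (tailMeasure μ u 0), ENNReal.ofReal (decreasingRearrangement μ u m ^ 2 *
      (m - tailMeasure μ u (decreasingRearrangement μ u m)) ^ 2) = 0) {t : ℝ} (ht : 0 < t) :
    μ {x | u x = t} = 0 := by
  by_contra hne
  have hδ : 0 < μ.real {x | u x = t} := by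
    rw [measureReal_def]
    exact ENNReal.toReal_pos hne (measure_ne_top _ _)
  set δ := μ.real {x | u x = t}
  have hM : Measurable (tailMeasure μ u) := tailMeasure_antitone.measurable
  have hq : Measurable (decreasingRearrangement μ u) := measurable_decreasingRearrangement hS0 hS
  have hsum : ∀ s < t, tailMeasure μ u t + δ ≤ tailMeasure μ u s := by
    intro s hs
    have hd : Disjoint {x | t < u x} {x | u x = t} :=
      disjoint_left.2 fun x hx hx' => (ne_of_gt hx) hx'
    rw [tailMeasure, ← measureReal_union hd (hu (measurableSet_singleton t))]
    exact measureReal_mono fun x hx => hx.elim (fun h => hs.trans h) fun h => hs.trans_eq h.symm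
  have hq' : ∀ m ∈ Ioo (tailMeasure μ u t) (tailMeasure μ u t + δ),
      decreasingRearrangement μ u m = t := by
    intro m hm
    have hm0 : 0 ≤ m := (tailMeasure_nonneg t).trans hm.1.le
    apply le_antisymm
    · by_contra! h
      exact not_lt.2 hm.1.le ((lt_decreasingRearrangement_iff hS0 hS ht.le hm0).1 h)
    · refine le_of_forall_lt fun s hs => ?_
      refine (le_max_left s 0).trans_lt ((lt_decreasingRearrangement_iff hS0 hS
        (le_max_right s 0) hm0).2 (hm.2.trans_le (hsum _ (max_lt hs ht))))
  have hm2 : Measurable fun m : ℝ => ENNReal.ofReal (decreasingRearrangement μ u m ^ 2 *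
      (m - tailMeasure μ u (decreasingRearrangement μ u m)) ^ 2) :=
    ((hq.pow_const 2).mul ((measurable_id.sub (hM.comp hq)).pow_const 2)).ennreal_ofReal
  have hae := (lintegral_eq_zero_iff hm2).1 hY
  have hsub : Ioo (tailMeasure μ u t) (tailMeasure μ u t + δ) ⊆ Ioo 0 (tailMeasure μ u 0) :=
    Ioo_subset_Ioo (tailMeasure_nonneg t) (hsum 0 ht)
  have hae' := ae_mono (Measure.restrict_mono_set volume hsub) hae
  have hfalse : ∀ᵐ m ∂volume.restrict (Ioo (tailMeasure μ u t) (tailMeasure μ u t + δ)), False := by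
    filter_upwards [hae', ae_restrict_mem measurableSet_Ioo] with m h1 h2
    rw [hq' m h2] at h1
    have h3 : 0 < t ^ 2 * (m - tailMeasure μ u t) ^ 2 :=
      mul_pos (by positivity) (pow_pos (sub_pos.2 h2.1) 2)
    exact absurd h1 (by simpa using h3)
  rw [ae_iff] at hfalse
  simp at hfalse
  linarith

end Rearrangement

/-! ### The sharp inequality on the graph and its case of equality -/

namespace MetricGraph

variable {E : Type*} {G : MetricGraph E} {D : Set (G.Vertex ⊕ G.End)}

theorem vol_preimage_pos [Countable E] {U : Set G.Point} (hU : IsOpen U) (hne : U.Nonempty) :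
    0 < G.vol (G.toPoint ⁻¹' U) := by
  obtain ⟨_, hx⟩ := hne
  obtain ⟨e, t, ht, rfl⟩ := exists_toPoint_eq ‹G.Point›
  have hV : IsOpen (line e ⁻¹' (G.toPoint ⁻¹' U)) := hU.preimage (continuous_toPoint_line e)
  rw [← closure_Ioo (G.length_pos e).ne] at ht
  obtain ⟨s, hs⟩ := mem_closure_iff.1 ht _ hV hx
  have h1 : 0 < volume (line e ⁻¹' (G.toPoint ⁻¹' U) ∩ Ioo 0 (G.length e)) :=
    (hV.inter isOpen_Ioo).measure_pos volume ⟨s, hs⟩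
  rw [vol_apply]
  refine h1.trans_le (le_trans (measure_mono ?_) (ENNReal.le_tsum e))
  exact inter_subset_inter_right _ Ioo_subset_Icc_self

/-- The supremum of the absolute value of a function. -/
noncomputable def supAbs (f : G.Point → ℝ) : ℝ := ⨆ x, |f x|

/-- The measure of the set where the absolute value of a function exceeds a level. -/
noncomputable def tailAbs (f : G.Point → ℝ) (t : ℝ) : ℝ :=
  tailMeasure G.vol (fun x => |G.lift f x|) t

theorem tailAbs_le [Countable E] {L : ℝ} (hL : HasSum G.length L) (hLpos : 0 < L)
    (f : G.Point → ℝ) (t : ℝ) : tailAbs f t ≤ L := by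
  have := isFiniteMeasure_vol hL
  refine (measureReal_mono (subset_univ _)).trans_eq ?_
  rw [measureReal_def, vol_univ hL, ENNReal.toReal_ofReal hLpos.le]

theorem MemH10.bddAbove [Countable E] (hconn : G.Connected) {L : ℝ} (hL : HasSum G.length L)
    (hLpos : 0 < L) (hD : D.Nonempty) {f : G.Point → ℝ} (hf : G.MemH10 D f) :
    BddAbove (range fun x => |f x|) :=
  ⟨_, by rintro _ ⟨x, rfl⟩; exact Real.abs_le_sqrt (hf.sq_le hconn hL hLpos hD x)⟩

theorem lt_supAbs_iff {f : G.Point → ℝ} (hb : BddAbove (range fun x => |f x|)) {t : ℝ}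
    [Nonempty G.Point] : t < supAbs f ↔ ∃ x, t < |f x| := lt_ciSup_iff hb

theorem tailAbs_pos [Countable E] {L : ℝ} (hL : HasSum G.length L) {f : G.Point → ℝ}
    (hf : Continuous f) {t : ℝ} {x : G.Point} (hx : t < |f x|) : 0 < tailAbs f t := by
  have := isFiniteMeasure_vol hL
  have h1 : IsOpen {x | t < |f x|} := isOpen_lt continuous_const hf.abs
  rw [tailAbs, tailMeasure, measureReal_def]
  exact ENNReal.toReal_pos (vol_preimage_pos h1 ⟨x, hx⟩).ne' (measure_ne_top _ _)

theorem Ioo_supAbs_subset_range [Countable E] (hconn : G.Connected) {f : G.Point → ℝ}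
    (hf : Continuous f) (h0 : 0 ∈ closure (range f)) (hb : BddAbove (range fun x => |f x|))
    [Nonempty G.Point] : Ioo 0 (supAbs f) ⊆ range fun x => |f x| := by
  refine hconn.Ioo_subset_range hf.abs ?_ ?_
  · have h1 := mem_closure_image continuous_abs.continuousAt h0
    rwa [abs_zero, ← range_comp] at h1
  · exact csSup_mem_closure (range_nonempty _) hb

theorem ofReal_integral_sq {α : Type*} [MeasurableSpace α] {μ : Measure α} {g : α → ℝ}
    (hg : MemLp g 2 μ) : ENNReal.ofReal (∫ x, g x ^ 2 ∂μ) = ∫⁻ x, ‖g x‖ₑ ^ 2 ∂μ := by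
  rw [ofReal_integral_eq_lintegral_ofReal hg.integrable_sq
    (Eventually.of_forall fun x => sq_nonneg _)]
  refine lintegral_congr fun x => ?_
  rw [Real.enorm_eq_ofReal_abs, ← ENNReal.ofReal_pow (abs_nonneg _), sq_abs]

theorem nonempty_point [Nonempty E] : Nonempty G.Point := by
  obtain ⟨e⟩ := ‹Nonempty E›
  exact ⟨G.toPoint (line e 0)⟩

/-- The sharp inequality on a graph, with remainder terms. -/
theorem exists_sharp_inequality [Countable E] [Nonempty E] (hconn : G.Connected) {L : ℝ}
    (hL : HasSum G.length L) (hLpos : 0 < L) (hD : D.Nonempty) {f : G.Point → ℝ}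
    (hf : G.MemH10 D f) : ∃ σ : Measure ℝ,
      G.variation f = volume.restrict (Ioo 0 (supAbs f)) + σ ∧
      ∀ k, 0 < k → k * tailAbs f 0 ≤ Real.pi / 2 →
        ENNReal.ofReal (k ^ 2 * ∫ x, G.lift f x ^ 2 ∂G.vol) +
        ENNReal.ofReal (k ^ 4) * (∫⁻ m in Ioo 0 (tailAbs f 0), ENNReal.ofReal
          (decreasingRearrangement G.vol (fun x => |G.lift f x|) m ^ 2 *
            (m - tailAbs f (decreasingRearrangement G.vol (fun x => |G.lift f x|) m)) ^ 2)) +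
        2 * (ENNReal.ofReal (k ^ 2) * ∫⁻ t, ENNReal.ofReal (t * tailAbs f t) ∂σ) ≤
        ENNReal.ofReal (∫ x, G.der f x ^ 2 ∂G.vol) := by
  have hfin := isFiniteMeasure_vol hL
  have hne : Nonempty G.Point := nonempty_point
  have hb := hf.bddAbove hconn hL hLpos hD
  have hdi : Integrable (G.der f) G.vol := hf.memLp_der.integrable one_le_two
  obtain ⟨p, hp⟩ := hD
  have hrange := Ioo_supAbs_subset_range hconn hf.continuous (hf.2 p hp).mem_closure_range hb
  have hle := restrict_Ioo_le_variation hf.continuous hf.ac hdi hrange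
  have hfin2 : IsFiniteMeasure (volume.restrict (Ioo 0 (supAbs f))) :=
    ⟨by rw [Measure.restrict_apply_univ, Real.volume_Ioo]; exact ENNReal.ofReal_lt_top⟩
  refine ⟨G.variation f - volume.restrict (Ioo 0 (supAbs f)), ?_, fun k hk hkl => ?_⟩
  · rw [add_comm, Measure.sub_add_cancel_of_le hle]
  · have hσ : (G.vol.withDensity fun x => ‖G.der f x‖ₑ).map (fun x => |G.lift f x|) =
        volume.restrict (Ioo 0 (supAbs f)) +
          (G.variation f - volume.restrict (Ioo 0 (supAbs f))) := by
      rw [add_comm, Measure.sub_add_cancel_of_le hle]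
      rfl
    have hS0 : 0 ≤ supAbs f := Real.iSup_nonneg fun x => abs_nonneg _
    have h1 := sharp_inequality hS0 (fun x => le_ciSup hb (G.toPoint x))
      (measurable_lift hf.continuous).abs (fun x => abs_nonneg _)
      (measurable_der f).enorm.aemeasurable hσ hk hkl
      (by rw [← ofReal_integral_sq hf.memLp_der]; exact ENNReal.ofReal_ne_top)
    rw [← ofReal_integral_sq hf.memLp_der] at h1
    rw [ENNReal.ofReal_mul (sq_nonneg k), ofReal_integral_sq hf.memLp_lift]
    have h2 : ∀ x, ‖G.lift f x‖ₑ ^ 2 = ENNReal.ofReal (|f (G.toPoint x)| ^ 2) := fun x => by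
      rw [Real.enorm_eq_ofReal_abs, ← ENNReal.ofReal_pow (abs_nonneg _)]
      rfl
    simp only [h2]
    exact h1

/-- The lower bound for the Dirichlet form. -/
theorem sq_mul_integral_le [Countable E] [Nonempty E] (hconn : G.Connected) {L : ℝ}
    (hL : HasSum G.length L) (hLpos : 0 < L) (hD : D.Nonempty) {f : G.Point → ℝ}
    (hf : G.MemH10 D f) {l : ℝ} (hl0 : 0 < l) (hl : tailAbs f 0 ≤ l) :
    (Real.pi / (2 * l)) ^ 2 * ∫ x, G.lift f x ^ 2 ∂G.vol ≤ ∫ x, G.der f x ^ 2 ∂G.vol := by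
  obtain ⟨σ, -, h⟩ := exists_sharp_inequality hconn hL hLpos hD hf
  have hk : 0 < Real.pi / (2 * l) := div_pos Real.pi_pos (by positivity)
  have h1 := h _ hk (by
    refine (mul_le_mul_of_nonneg_left hl hk.le).trans_eq ?_
    field_simp)
  rw [add_assoc] at h1
  exact (ENNReal.ofReal_le_ofReal_iff (integral_nonneg fun x => sq_nonneg _)).1
    (le_self_add.trans h1)

/-- If the lower bound is attained, then all level sets are null sets and the variation is equal to
Lebesgue measure. -/
theorem level_and_variation_of_eq [Countable E] [Nonempty E] (hconn : G.Connected) {L : ℝ}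
    (hL : HasSum G.length L) (hLpos : 0 < L) (hD : D.Nonempty) {f : G.Point → ℝ}
    (hf : G.MemH10 D f) (h0 : f ≠ 0)
    (heq : ∫ x, G.der f x ^ 2 ∂G.vol =
      (Real.pi / (2 * L)) ^ 2 * ∫ x, G.lift f x ^ 2 ∂G.vol) :
    tailAbs f 0 = L ∧ (∀ t, 0 ≤ t → G.vol {x | |G.lift f x| = t} = 0) ∧
      ∀ a b, 0 ≤ a → b ≤ supAbs f → G.variation f (Icc a b) ≤ ENNReal.ofReal (b - a) := by
  have hfin := isFiniteMeasure_vol hL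
  have hne : Nonempty G.Point := nonempty_point
  have hb := hf.bddAbove hconn hL hLpos hD
  have hN := integral_lift_sq_pos hf.continuous hf.memLp_lift h0
  have hu : Measurable fun x => |G.lift f x| := (measurable_lift hf.continuous).abs
  have hpi := Real.pi_pos
  -- If f vanished on a set of positive volume, the inequality with the smaller length M(0) would
  -- give a strictly better constant.
  have hl : tailAbs f 0 = L := by
    refine le_antisymm (tailAbs_le hL hLpos f 0) ?_
    by_contra! hlt
    obtain ⟨x, hx⟩ := Function.ne_iff.1 h0
    have hpos : 0 < tailAbs f 0 := tailAbs_pos hL hf.continuous (abs_pos.2 hx)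
    have h1 := sq_mul_integral_le hconn hL hLpos hD hf hpos le_rfl
    rw [heq] at h1
    have h2 := le_of_mul_le_mul_right h1 hN
    have h3 : Real.pi / (2 * L) < Real.pi / (2 * tailAbs f 0) :=
      div_lt_div_of_pos_left hpi (by positivity) (by linarith)
    exact absurd (pow_lt_pow_left₀ h3 (by positivity) two_ne_zero) (not_lt.2 h2)
  obtain ⟨σ, hσ, h⟩ := exists_sharp_inequality hconn hL hLpos hD hf
  have hk : 0 < Real.pi / (2 * L) := by positivity
  have h1 := h _ hk (by rw [hl]; exact le_of_eq (by field_simp))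
  rw [heq, add_assoc] at h1
  have h2 := (ENNReal.add_le_add_iff_left ENNReal.ofReal_ne_top).1 (h1.trans_eq (add_zero _).symm)
  obtain ⟨h3, h4⟩ := add_eq_zero.1 (le_antisymm h2 bot_le)
  have hY := (mul_eq_zero.1 h3).resolve_left (by simpa using by positivity)
  have hZ := (mul_eq_zero.1 ((mul_eq_zero.1 h4).resolve_left two_ne_zero)).resolve_left
    (by simpa using by positivity)
  have hS0 : 0 ≤ supAbs f := Real.iSup_nonneg fun x => abs_nonneg _
  have hlev : ∀ t, 0 ≤ t → G.vol {x | |G.lift f x| = t} = 0 := by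
    intro t ht
    rcases ht.eq_or_lt with rfl | ht
    -- The plateau remainder says nothing about level 0; there the claim is M(0) = L.
    · have h5 : {x | |G.lift f x| = 0} = {x | 0 < |G.lift f x|}ᶜ := by
        ext x
        simp
      rw [h5, measure_compl (show MeasurableSet {x | 0 < |G.lift f x|} from hu measurableSet_Ioi)
        (measure_ne_top _ _), vol_univ hL]
      have h6 : G.vol {x | 0 < |G.lift f x|} = ENNReal.ofReal L := by
        rw [← hl, tailAbs, tailMeasure, ofReal_measureReal]
      exact (congrArg _ h6).trans (tsub_self _)
    · exact measure_level_eq_zero hS0 (fun x => le_ciSup hb (G.toPoint x)) hu hY ht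
  -- The weight t M(t) in the second remainder is positive below the supremum, because nonempty open
  -- sets have positive volume.
  have hσ0 : σ (Ioo 0 (supAbs f)) = 0 := by
    have hM : Measurable fun t => ENNReal.ofReal (t * tailAbs f t) :=
      (measurable_id.mul
        (tailMeasure_antitone (μ := G.vol) (u := fun x => |G.lift f x|)).measurable).ennreal_ofReal
    have h5 := (lintegral_eq_zero_iff hM).1 hZ
    rw [EventuallyEq, ae_iff] at h5
    refine measure_mono_null (fun t ht => ?_) h5
    obtain ⟨x, hx⟩ := (lt_supAbs_iff hb).1 ht.2
    have := mul_pos ht.1 (tailAbs_pos hL hf.continuous hx)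
    simpa using this
  have hpt : ∀ t, 0 ≤ t → G.variation f {t} = 0 := by
    intro t ht
    rw [variation_apply hf.continuous (measurableSet_singleton t)]
    exact setLIntegral_measure_zero _ _ (hlev t ht)
  refine ⟨hl, hlev, fun a b ha hb' => ?_⟩
  rcases lt_or_ge b a with hab | hab
  · simp [Icc_eq_empty hab.not_ge]
  have h5 : Icc a b ⊆ Ioo a b ∪ ({a} ∪ {b}) := by
    intro t ht
    rcases ht.1.eq_or_lt with rfl | h6
    · exact Or.inr (Or.inl rfl)
    rcases ht.2.eq_or_lt with rfl | h7
    · exact Or.inr (Or.inr rfl)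
    exact Or.inl ⟨h6, h7⟩
  have h6 : G.variation f (Ioo a b) = ENNReal.ofReal (b - a) := by
    have h7 : Ioo a b ⊆ Ioo 0 (supAbs f) := Ioo_subset_Ioo ha hb'
    rw [hσ, Measure.add_apply, measure_mono_null h7 hσ0, add_zero,
      Measure.restrict_apply measurableSet_Ioo, inter_eq_left.2 h7, Real.volume_Ioo]
  refine (measure_mono h5).trans ((measure_union_le _ _).trans ?_)
  rw [h6, measure_union_null (hpt a ha) (hpt b (ha.trans hab)), add_zero]

end MetricGraph

/-! ### The sublevel volume as a coordinate in the case of equality -/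

namespace MetricGraph

variable {E : Type*} {G : MetricGraph E} {D : Set (G.Vertex ⊕ G.End)}

theorem line_preimage_image (e : E) (A : Set ℝ) : line e ⁻¹' (line e '' A) = A :=
  preimage_image_eq _ (line_injective e)

theorem line_preimage_image_of_ne {e e' : E} (h : e' ≠ e) (A : Set ℝ) :
    line e' ⁻¹' (line e '' A) = ∅ := by
  ext t
  simp only [mem_preimage, mem_image, mem_empty_iff_false, iff_false]
  rintro ⟨x, _, hx⟩
  exact h (congrArg Sigma.fst hx).symm

theorem vol_image_line_le [Countable E] (e : E) (A : Set ℝ) :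
    G.vol (line e '' A) ≤ volume A := by
  rw [vol_apply, tsum_eq_single e fun e' h => by rw [line_preimage_image_of_ne h]; simp,
    line_preimage_image]
  exact measure_mono inter_subset_left

/-- If an arc of an edge carries the whole variation of `f` between two levels and all level sets
are null sets, then no other point has values strictly between these levels. -/
theorem vol_diff_eq_zero [Countable E] {f : G.Point → ℝ} (hf : Continuous f)
    (hac : ∀ e, AbsolutelyContinuousOnInterval (G.onEdge f e) 0 (G.length e))
    (hlev : ∀ t, 0 ≤ t → G.vol {x | |G.lift f x| = t} = 0) {a b : ℝ} {W : Set (Lines E)}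
    (hW : MeasurableSet W) (hWc : ∀ e, IsClosed (line e ⁻¹' W))
    (h0 : ∫⁻ x in {x | |G.lift f x| ∈ Icc a b} \ W, ‖G.der f x‖ₑ ∂G.vol = 0) :
    G.vol ({x | |G.lift f x| ∈ Ioo a b} \ W) = 0 := by
  have hm : Measurable fun x => |G.lift f x| := (measurable_lift hf).abs
  have hC : MeasurableSet ({x | |G.lift f x| ∈ Icc a b} \ W) := MeasurableSet.diff (hm measurableSet_Icc) hW
  rw [lintegral_eq_zero_iff (measurable_der f).enorm, EventuallyEq, ae_restrict_iff' hC,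
    ae_vol_iff] at h0
  rw [vol_apply, ENNReal.tsum_eq_zero]
  intro e
  set V := ((fun x => |G.onEdge f e x|) ⁻¹' Ioo a b ∩ (line e ⁻¹' W)ᶜ) ∩ Ioo 0 (G.length e)
  have hV : IsOpen V :=
    ((isOpen_Ioo.preimage (continuous_onEdge hf e).abs).inter (hWc e).isOpen_compl).inter isOpen_Ioo
  -- On V the derivative vanishes almost everywhere, so f would be constant on a small interval and
  -- the corresponding level set would have positive volume.
  have hVe : V = ∅ := by
    by_contra! hne
    obtain ⟨x, hx⟩ := hne
    obtain ⟨r, hr, hrV⟩ := Metric.nhds_basis_closedBall.mem_iff.1 (hV.mem_nhds hx)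
    rw [Real.closedBall_eq_Icc] at hrV
    have hc : ∀ y ∈ Icc (x - r) (x + r), G.onEdge f e y = G.onEdge f e (x - r) := by
      intro y hy
      have hsub : uIcc (x - r) y ⊆ Icc (x - r) (x + r) := by
        rw [uIcc_of_le hy.1]
        exact Icc_subset_Icc_right hy.2
      have hsub2 : uIcc (x - r) y ⊆ uIcc 0 (G.length e) := by
        rw [uIcc_of_le (G.length_pos e).le]
        exact fun z hz => Ioo_subset_Icc_self (hrV (hsub hz)).2
      have h1 := ((hac e).mono hsub2).integral_deriv_eq_sub
      rw [intervalIntegral.integral_zero_ae] at h1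
      · linarith
      · have h2 := h0 e
        rw [ae_restrict_iff' measurableSet_Icc] at h2
        filter_upwards [h2] with z hz hzu
        have hz' := hrV (hsub (uIoc_subset_uIcc hzu))
        simpa using! hz (Ioo_subset_Icc_self hz'.2)
          ⟨Ioo_subset_Icc_self hz'.1.1, hz'.1.2⟩
    have h3 := hlev |G.onEdge f e (x - r)| (abs_nonneg _)
    rw [vol_apply, ENNReal.tsum_eq_zero] at h3
    have h4 : volume (Icc (x - r) (x + r)) ≤ 0 := by
      rw [← h3 e]
      exact measure_mono fun y hy =>
        ⟨congrArg abs (hc y hy), Ioo_subset_Icc_self (hrV hy).2⟩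
    rw [Real.volume_Icc, nonpos_iff_eq_zero, ENNReal.ofReal_eq_zero] at h4
    linarith
  have hsub : line e ⁻¹' ({x | |G.lift f x| ∈ Ioo a b} \ W) ∩ Icc 0 (G.length e) ⊆
      V ∪ ({0} ∪ {G.length e}) := by
    rintro y ⟨h1, h2⟩
    rcases h2.1.eq_or_lt with rfl | h3
    · exact Or.inr (Or.inl rfl)
    rcases h2.2.eq_or_lt with h4 | h4
    · exact Or.inr (Or.inr h4)
    exact Or.inl ⟨⟨h1.1, h1.2⟩, h3, h4⟩
  refine measure_mono_null hsub ?_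
  rw [hVe, empty_union]
  exact measure_union_null (by simp) (by simp)

/-- An arc on which |f| covers [a, b] already carries variation b − a, which is all there is. So
almost no point off the arc has a value in (a, b), and the volume is at most the length of the arc.
-/
theorem vol_Ioo_le [Countable E] {f : G.Point → ℝ} (hf : Continuous f)
    (hac : ∀ e, AbsolutelyContinuousOnInterval (G.onEdge f e) 0 (G.length e))
    (hlev : ∀ t, 0 ≤ t → G.vol {x | |G.lift f x| = t} = 0) {a b : ℝ}
    (hvar : G.variation f (Icc a b) ≤ ENNReal.ofReal (b - a)) {e : E} {s t : ℝ} (hst : s ≤ t)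
    (hsub : Icc s t ⊆ Icc 0 (G.length e))
    (himg : Icc a b ⊆ (fun x => |G.onEdge f e x|) '' Icc s t) :
    G.vol {x | |G.lift f x| ∈ Ioo a b} ≤ ENNReal.ofReal (t - s) := by
  have hm : Measurable fun x => |G.lift f x| := (measurable_lift hf).abs
  have hC : MeasurableSet {x | |G.lift f x| ∈ Icc a b} := hm measurableSet_Icc
  have hW : MeasurableSet (line e '' Icc s t) :=
    (measurableEmbedding_line e).measurableSet_image' measurableSet_Icc
  have h1 : ENNReal.ofReal (b - a) ≤
      ∫⁻ x in {x | |G.lift f x| ∈ Icc a b} ∩ line e '' Icc s t, ‖G.der f x‖ₑ ∂G.vol := by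
    have h2 : uIcc s t ⊆ uIcc 0 (G.length e) := by
      rwa [uIcc_of_le hst, uIcc_of_le (G.length_pos e).le]
    have h3 := ((hac e).mono h2).volume_image_comp_le hst (abs_absClamp_sub_le a b)
      (C := {y | |y| ∈ Icc a b}) fun y hy => eventually_absClamp_eq hy
    have h4 : Icc a b ⊆ (fun x => absClamp a b (G.onEdge f e x)) '' Icc s t := by
      intro y hy
      obtain ⟨x, hx, hxy⟩ := himg hy
      have hxy : |G.onEdge f e x| = y := hxy
      exact ⟨x, hx, by simp only; rw [absClamp_of_mem (hxy ▸ hy), hxy]⟩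
    rw [← Real.volume_Icc]
    refine (measure_mono h4).trans (h3.trans ?_)
    rw [← lintegral_indicator (hC.inter hW), lintegral_vol]
    refine le_trans (le_trans ?_ (lintegral_mono_set hsub)) (ENNReal.le_tsum e)
    refine setLIntegral_mono_ae' measurableSet_Icc (Eventually.of_forall fun x hx => ?_)
    by_cases h5 : |G.onEdge f e x| ∈ Icc a b
    · rw [indicator_of_mem (show x ∈ G.onEdge f e ⁻¹' {y | |y| ∈ Icc a b} from h5)]
      rw [indicator_of_mem]
      · rfl
      · exact ⟨h5, x, hx, rfl⟩
    · rw [indicator_of_notMem (show x ∉ G.onEdge f e ⁻¹' {y | |y| ∈ Icc a b} from h5)]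
      exact bot_le
  rw [variation_apply hf measurableSet_Icc,
    ← lintegral_inter_add_sdiff _ {x | |G.lift f x| ∈ Icc a b} hW] at hvar
  have h2 : ∫⁻ x in {x | |G.lift f x| ∈ Icc a b} \ line e '' Icc s t, ‖G.der f x‖ₑ ∂G.vol = 0 := by
    have h3 := (add_le_add_left h1 _).trans (hvar.trans_eq (add_zero _).symm)
    exact le_antisymm ((ENNReal.add_le_add_iff_left ENNReal.ofReal_ne_top).1 h3) bot_le
  have h3 := vol_diff_eq_zero hf hac hlev hW (fun e' => by
    by_cases h : e' = e
    · subst h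
      rw [line_preimage_image]
      exact isClosed_Icc
    · rw [line_preimage_image_of_ne h]
      exact isClosed_empty) h2
  calc G.vol {x | |G.lift f x| ∈ Ioo a b}
      ≤ G.vol (({x | |G.lift f x| ∈ Ioo a b} \ line e '' Icc s t) ∪ line e '' Icc s t) :=
        measure_mono (by rw [sdiff_union_self]; exact subset_union_left)
    _ ≤ _ := measure_union_le _ _
    _ ≤ ENNReal.ofReal (t - s) := by
        rw [h3, zero_add, ← Real.volume_Icc]
        exact vol_image_line_le e _

/-- The volume of the set where `|f|` does not exceed its value at the given point. -/
noncomputable def sublevelVol (f : G.Point → ℝ) (x : G.Point) : ℝ :=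
  tailAbs f 0 - tailAbs f |f x|

theorem tailAbs_antitone [Countable E] {L : ℝ} (hL : HasSum G.length L) (f : G.Point → ℝ) :
    Antitone (tailAbs f) := by
  have := isFiniteMeasure_vol hL
  exact tailMeasure_antitone (μ := G.vol) (u := fun x => |G.lift f x|)

/-- By the intermediate value theorem the arc from s to t covers all levels between its end values,
so the volume between these levels is at most |s − t|. Null level sets make open and closed
conditions interchangeable. -/
theorem edgeLipschitz_sublevelVol [Countable E] {L : ℝ} (hL : HasSum G.length L)
    {f : G.Point → ℝ} (hf : Continuous f)
    (hac : ∀ e, AbsolutelyContinuousOnInterval (G.onEdge f e) 0 (G.length e))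
    (hlev : ∀ t, 0 ≤ t → G.vol {x | |G.lift f x| = t} = 0)
    (hb : BddAbove (range fun x => |f x|))
    (hvar : ∀ a b, 0 ≤ a → b ≤ supAbs f → G.variation f (Icc a b) ≤ ENNReal.ofReal (b - a)) :
    EdgeLipschitz 1 (sublevelVol f) := by
  have := isFiniteMeasure_vol hL
  intro e s t
  rw [NNReal.coe_one, one_mul]
  wlog hst : s ≤ t generalizing s t
  · rw [abs_sub_comm, abs_sub_comm (s : ℝ)]
    exact this t s (le_of_not_ge hst)
  have hst' : (s : ℝ) ≤ t := hst
  have hanti := tailAbs_antitone hL f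
  set a := min |f (G.pt e s)| |f (G.pt e t)|
  set b := max |f (G.pt e s)| |f (G.pt e t)|
  have ha : 0 ≤ a := le_min (abs_nonneg _) (abs_nonneg _)
  have hbS : b ≤ supAbs f := max_le (le_ciSup hb _) (le_ciSup hb _)
  have h1 : |sublevelVol f (G.pt e s) - sublevelVol f (G.pt e t)| ≤ tailAbs f a - tailAbs f b := by
    simp only [sublevelVol]
    rw [sub_sub_sub_cancel_left]
    have h2 := hanti (min_le_left |f (G.pt e s)| |f (G.pt e t)|)
    have h3 := hanti (min_le_right |f (G.pt e s)| |f (G.pt e t)|)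
    have h4 := hanti (le_max_left |f (G.pt e s)| |f (G.pt e t)|)
    have h5 := hanti (le_max_right |f (G.pt e s)| |f (G.pt e t)|)
    exact abs_sub_le_iff.2 ⟨by linarith, by linarith⟩
  have h2 : tailAbs f a ≤ tailAbs f b + (t - s) := by
    have h3 : {x | a < |G.lift f x|} ⊆ {x | b < |G.lift f x|} ∪
        ({x | |G.lift f x| ∈ Ioo a b} ∪ {x | |G.lift f x| = b}) := by
      intro x hx
      rcases lt_trichotomy b |G.lift f x| with h | h | h
      · exact Or.inl h
      · exact Or.inr (Or.inr h.symm)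
      · exact Or.inr (Or.inl ⟨hx, h⟩)
    have himg : Icc a b ⊆ (fun x => |G.onEdge f e x|) '' Icc (s : ℝ) t := by
      have h4 := intermediate_value_uIcc (a := (s : ℝ)) (b := t)
        (continuous_onEdge hf e).abs.continuousOn
      rw [uIcc_of_le hst'] at h4
      simpa [onEdge, projIcc_val] using! h4
    have h5 := vol_Ioo_le hf hac hlev (hvar a b ha hbS) hst' (Icc_subset_Icc s.2.1 t.2.2) himg
    have h6 : G.vol.real {x | |G.lift f x| ∈ Ioo a b} ≤ t - s :=
      ENNReal.toReal_le_of_le_ofReal (sub_nonneg.2 hst') h5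
    have h7 : G.vol.real {x | |G.lift f x| = b} = 0 := by
      rw [measureReal_def, hlev b (ha.trans min_le_max), ENNReal.toReal_zero]
    calc tailAbs f a ≤ _ := measureReal_mono h3
      _ ≤ _ := measureReal_union_le _ _
      _ ≤ tailAbs f b + (t - s) := by
        refine add_le_add le_rfl ((measureReal_union_le _ _).trans ?_)
        rw [h7, add_zero]
        exact h6
  rw [abs_sub_comm (s : ℝ), abs_of_nonneg (sub_nonneg.2 hst')]
  linarith

/-- At an end this is right continuity of the distribution function at level 0. -/
theorem HasValueAt.sublevelVol [Countable E] {L : ℝ} (hL : HasSum G.length L) {f : G.Point → ℝ}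
    {p : G.Vertex ⊕ G.End} (h : G.HasValueAt f p 0) : G.HasValueAt (sublevelVol f) p 0 := by
  have := isFiniteMeasure_vol hL
  rcases p with v | γ
  · have h : f (G.vertexPoint v) = 0 := h
    change tailAbs f 0 - tailAbs f |f (G.vertexPoint v)| = 0
    rw [h, abs_zero, sub_self]
  · have h : Tendsto f γ.filter (𝓝 0) := h
    change Tendsto (fun x => tailAbs f 0 - tailAbs f |f x|) γ.filter (𝓝 0)
    have hanti := tailAbs_antitone hL f
    have h1 : Tendsto (fun x => |f x|) γ.filter (𝓝 0) := by simpa using h.abs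
    rw [Metric.tendsto_nhds]
    intro ε hε
    obtain ⟨t', ht', h2⟩ := exists_gt_lt_tailMeasure (μ := G.vol) (u := fun x => |G.lift f x|)
      (t := 0) (m := tailAbs f 0 - ε) (sub_lt_self _ hε)
    filter_upwards [h1.eventually (gt_mem_nhds ht')] with x hx
    have h3 : tailAbs f 0 - ε < tailAbs f t' := h2
    have h4 := hanti hx.le
    have h5 := hanti (abs_nonneg (f x))
    rw [Real.dist_eq, sub_zero, abs_of_nonneg (sub_nonneg.2 h5)]
    linarith

theorem sublevelVol_mem_Icc [Countable E] {L : ℝ} (hL : HasSum G.length L) (f : G.Point → ℝ)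
    (x : G.Point) : sublevelVol f x ∈ Icc 0 (tailAbs f 0) :=
  ⟨sub_nonneg.2 (tailAbs_antitone hL f (abs_nonneg _)), sub_le_self _ (tailMeasure_nonneg _)⟩

/-- As the level increases to the supremum, the superlevel sets shrink into the top level set, which
is null. -/
theorem tailAbs_mem_closure_range_sublevelVol [Countable E] {L : ℝ} (hL : HasSum G.length L)
    {f : G.Point → ℝ} (hf : Continuous f) [Nonempty G.Point]
    (hlev : ∀ t, 0 ≤ t → G.vol {x | |G.lift f x| = t} = 0)
    (hb : BddAbove (range fun x => |f x|)) :
    tailAbs f 0 ∈ closure (range (sublevelVol f)) := by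
  have hfin := isFiniteMeasure_vol hL
  have hanti := tailAbs_antitone hL f
  obtain ⟨u, hu1, hu2, hu3⟩ := exists_seq_strictMono_tendsto (supAbs f)
  have hm : Measurable fun x => |G.lift f x| := (measurable_lift hf).abs
  have h1 : Tendsto (fun n => tailAbs f (u n)) atTop (𝓝 0) := by
    have h2 : Tendsto (fun n => G.vol {x | u n < |G.lift f x|}) atTop
        (𝓝 (G.vol (⋂ n, {x | u n < |G.lift f x|}))) := by
      refine tendsto_measure_iInter_atTop (fun n => ?_) (fun m n hmn x hx => ?_)
        ⟨0, measure_ne_top _ _⟩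
      · exact (show MeasurableSet {x | u n < |G.lift f x|} from hm measurableSet_Ioi).nullMeasurableSet
      · exact (hu1.monotone hmn).trans_lt hx
    have h3 : G.vol (⋂ n, {x | u n < |G.lift f x|}) = 0 := by
      refine measure_mono_null (fun x hx => ?_)
        (hlev (supAbs f) (Real.iSup_nonneg fun x => abs_nonneg _))
      refine le_antisymm (le_ciSup hb (G.toPoint x)) ?_
      exact le_of_tendsto' hu3 fun n => le_of_lt (mem_iInter.1 hx n)
    rw [h3] at h2
    have := (ENNReal.tendsto_toReal ENNReal.zero_ne_top).comp h2
    simpa using! this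
  refine mem_closure_iff_nhds.2 fun N hN => ?_
  have h2 : Tendsto (fun n => tailAbs f 0 - tailAbs f (u n)) atTop (𝓝 (tailAbs f 0)) := by
    simpa using h1.const_sub (tailAbs f 0)
  obtain ⟨ε, hε, hN'⟩ := Metric.mem_nhds_iff.1 hN
  obtain ⟨n, hn⟩ := (h1.eventually (gt_mem_nhds hε)).exists
  obtain ⟨x, hx⟩ := (lt_supAbs_iff hb).1 (hu2 n)
  refine ⟨sublevelVol f x, hN' ?_, x, rfl⟩
  have h4 := hanti hx.le
  have h5 : 0 ≤ tailAbs f |f x| := tailMeasure_nonneg _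
  rw [Metric.mem_ball, Real.dist_eq, sublevelVol, sub_sub_cancel_left, abs_neg, abs_of_nonneg h5]
  linarith

/-- In the case of equality the graph has a one-Lipschitz function onto an interval whose length is
the total length of the graph. -/
theorem exists_edgeLipschitz_of_eq [Countable E] [Nonempty E] (hconn : G.Connected) {L : ℝ}
    (hL : HasSum G.length L) (hLpos : 0 < L) (hD : D.Nonempty) {f : G.Point → ℝ}
    (hf : G.MemH10 D f) (h0 : f ≠ 0)
    (heq : ∫ x, G.der f x ^ 2 ∂G.vol =
      (Real.pi / (2 * L)) ^ 2 * ∫ x, G.lift f x ^ 2 ∂G.vol) :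
    ∃ φ : G.Point → ℝ, EdgeLipschitz 1 φ ∧ Ioo 0 L ⊆ range φ ∧ range φ ⊆ Icc 0 L ∧
      ∀ p ∈ D, G.HasValueAt φ p 0 := by
  have hne : Nonempty G.Point := nonempty_point
  have hb := hf.bddAbove hconn hL hLpos hD
  obtain ⟨rfl, hlev, hvar⟩ := level_and_variation_of_eq hconn hL hLpos hD hf h0 heq
  have h1 := edgeLipschitz_sublevelVol hL hf.continuous hf.ac hlev hb hvar
  have h2 : ∀ p ∈ D, G.HasValueAt (sublevelVol f) p 0 := fun p hp => (hf.2 p hp).sublevelVol hL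
  refine ⟨sublevelVol f, h1, ?_, ?_, h2⟩
  · obtain ⟨p, hp⟩ := hD
    exact hconn.Ioo_subset_range (h1.lipschitzWith hconn).continuous (h2 p hp).mem_closure_range
      (tailAbs_mem_closure_range_sublevelVol hL hf.continuous hlev hb)
  · rintro _ ⟨x, rfl⟩
    exact sublevelVol_mem_Icc hL f x

end MetricGraph

/-! ### Rigidity of one-Lipschitz maps without loss of length -/

namespace MetricGraph

variable {E : Type*} {G : MetricGraph E} {D : Set (G.Vertex ⊕ G.End)}

/-- The intermediate value theorem on an edge. -/
theorem exists_pt_eq_of_mem_uIcc {φ : G.Point → ℝ} (hφ : Continuous φ) (e : E) (s t : Icc (0 : ℝ) (G.length e))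
    {y : ℝ} (hy : y ∈ uIcc (φ (G.pt e s)) (φ (G.pt e t))) :
    ∃ r : Icc (0 : ℝ) (G.length e), φ (G.pt e r) = y := by
  have : PreconnectedSpace (Icc (0 : ℝ) (G.length e)) :=
    Subtype.preconnectedSpace isPreconnected_Icc
  exact (isPreconnected_range (hφ.comp (continuous_pt e))).ordConnected.uIcc_subset
    ⟨s, rfl⟩ ⟨t, rfl⟩ hy

theorem Connected.lipschitzWith_toReal_edist (hconn : G.Connected) (x : G.Point) :
    LipschitzWith 1 fun z => (edist x z).toReal := by
  refine LipschitzWith.of_edist_le fun y z => ?_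
  rw [edist_dist, Real.dist_eq, ← ENNReal.ofReal_toReal (hconn y z)]
  refine ENNReal.ofReal_le_ofReal (abs_sub_le_iff.2 ⟨?_, ?_⟩)
  · rw [sub_le_iff_le_add', ← ENNReal.toReal_add (hconn _ _) (hconn _ _), edist_comm y z]
    exact ENNReal.toReal_mono (ENNReal.add_ne_top.2 ⟨hconn _ _, hconn _ _⟩)
      (edist_triangle _ _ _)
  · rw [sub_le_iff_le_add', ← ENNReal.toReal_add (hconn _ _) (hconn _ _)]
    exact ENNReal.toReal_mono (ENNReal.add_ne_top.2 ⟨hconn _ _, hconn _ _⟩)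
      (edist_triangle _ _ _)

section Rigidity

variable [Countable E] {L : ℝ} {φ : G.Point → ℝ}

/-- A one-Lipschitz function onto an interval whose length is the total length of the graph maps
the volume to Lebesgue measure. -/
theorem EdgeLipschitz.map_vol_eq (hφ : EdgeLipschitz 1 φ) (hconn : G.Connected)
    (hL : HasSum G.length L) (hrange : Ioo 0 L ⊆ range φ) :
    G.vol.map (G.lift φ) = volume.restrict (Ioo 0 L) := by
  have hfin := isFiniteMeasure_vol hL
  have hm : Measurable (G.lift φ) := measurable_lift (hφ.lipschitzWith hconn).continuous
  -- One-Lipschitz maps do not increase volume, so the push-forward dominates Lebesgue measure on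
  -- (0, L); both have total mass L and therefore coincide.
  have hle : volume.restrict (Ioo 0 L) ≤ G.vol.map (G.lift φ) := by
    refine Measure.le_iff.2 fun A hA => ?_
    rw [Measure.restrict_apply hA, Measure.map_apply hm hA]
    refine (measure_mono ?_).trans (hφ.volume_image_le (φ ⁻¹' A))
    rintro y ⟨hy, hy'⟩
    obtain ⟨x, rfl⟩ := hrange hy'
    exact ⟨x, hy, rfl⟩
  refine (Measure.eq_of_le_of_measure_univ_eq hle ?_).symm
  rw [Measure.restrict_apply_univ, Measure.map_apply hm MeasurableSet.univ, preimage_univ,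
    vol_univ hL, Real.volume_Ioo, sub_zero]

theorem EdgeLipschitz.vol_preimage_le (hφ : EdgeLipschitz 1 φ) (hconn : G.Connected)
    (hL : HasSum G.length L) (hrange : Ioo 0 L ⊆ range φ) {J : Set ℝ} (hJ : MeasurableSet J) :
    G.vol (G.lift φ ⁻¹' J) ≤ volume J := by
  have hm : Measurable (G.lift φ) := measurable_lift (hφ.lipschitzWith hconn).continuous
  rw [← Measure.map_apply hm hJ, hφ.map_vol_eq hconn hL hrange]
  exact Measure.restrict_apply_le _ _

/-- The arc from s to t lies over the interval [min φ, max φ] of its values, whose preimage has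
volume at most max − min. So the oscillation is at least t − s, and by the Lipschitz bound the
extrema can only sit at the two ends of the arc. -/
theorem EdgeLipschitz.abs_sub_eq (hφ : EdgeLipschitz 1 φ) (hconn : G.Connected)
    (hL : HasSum G.length L) (hrange : Ioo 0 L ⊆ range φ) (e : E)
    (s t : Icc (0 : ℝ) (G.length e)) : |φ (G.pt e s) - φ (G.pt e t)| = |(s : ℝ) - t| := by
  refine le_antisymm (by simpa using hφ e s t) ?_
  wlog hst : s ≤ t generalizing s t
  · rw [abs_sub_comm, abs_sub_comm (φ _)]
    exact this t s (le_of_not_ge hst)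
  have hst' : (s : ℝ) ≤ t := hst
  have hlip := hφ.lipschitzWith_onEdge e
  have hs : G.onEdge φ e s = φ (G.pt e s) := by simp [onEdge, projIcc_val]
  have ht : G.onEdge φ e t = φ (G.pt e t) := by simp [onEdge, projIcc_val]
  rw [← hs, ← ht]
  obtain ⟨x₁, h1, hmin⟩ := isCompact_Icc.exists_isMinOn (nonempty_Icc.2 hst')
    hlip.continuous.continuousOn
  obtain ⟨x₂, h2, hmax⟩ := isCompact_Icc.exists_isMaxOn (nonempty_Icc.2 hst')
    hlip.continuous.continuousOn
  have h3 : ENNReal.ofReal (t - s) ≤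
      ENNReal.ofReal (G.onEdge φ e x₂ - G.onEdge φ e x₁) := by
    rw [← Real.volume_Icc, ← Real.volume_Icc]
    refine le_trans ?_ (hφ.vol_preimage_le hconn hL hrange measurableSet_Icc)
    rw [vol_apply]
    refine le_trans (measure_mono ?_) (ENNReal.le_tsum e)
    exact fun x hx => ⟨⟨hmin hx, hmax hx⟩, s.2.1.trans hx.1, hx.2.trans t.2.2⟩
  have h5 : G.onEdge φ e x₂ - G.onEdge φ e x₁ ≤ |x₂ - x₁| := by
    have := hlip.dist_le_mul x₂ x₁
    rw [NNReal.coe_one, one_mul, Real.dist_eq, Real.dist_eq] at this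
    exact (le_abs_self _).trans this
  rcases hst'.eq_or_lt with h0 | h0
  · rw [h0, sub_self, abs_zero]
    exact abs_nonneg _
  have h4 : (t : ℝ) - s ≤ G.onEdge φ e x₂ - G.onEdge φ e x₁ := by
    rcases ENNReal.ofReal_le_ofReal_iff'.1 h3 with h | h
    · exact h
    · linarith
  rw [abs_sub_comm (s : ℝ), abs_of_nonneg (sub_nonneg.2 hst')]
  refine h4.trans ?_
  obtain ⟨h1l, h1r⟩ := h1
  obtain ⟨h2l, h2r⟩ := h2
  rcases abs_cases (x₂ - x₁) with ⟨h6, -⟩ | ⟨h6, -⟩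
  · rw [show x₁ = s by linarith, show x₂ = t by linarith, abs_sub_comm]
    exact le_abs_self _
  · rw [show x₁ = t by linarith, show x₂ = s by linarith]
    exact le_abs_self _

theorem EdgeLipschitz.pt_injective (hφ : EdgeLipschitz 1 φ) (hconn : G.Connected)
    (hL : HasSum G.length L) (hrange : Ioo 0 L ⊆ range φ) (e : E)
    {s t : Icc (0 : ℝ) (G.length e)} (h : φ (G.pt e s) = φ (G.pt e t)) : s = t := by
  have h1 := hφ.abs_sub_eq hconn hL hrange e s t
  rw [h, sub_self, abs_zero] at h1
  exact Subtype.ext (sub_eq_zero.1 (abs_eq_zero.1 h1.symm))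

/-- Two different edges over the same interval would give its preimage at least twice the length of
the interval. -/
theorem EdgeLipschitz.edge_unique (hφ : EdgeLipschitz 1 φ) (hconn : G.Connected)
    (hL : HasSum G.length L) (hrange : Ioo 0 L ⊆ range φ) {e e' : E} {c d : ℝ} (hcd : c < d)
    (h : Ioo c d ⊆ range fun s => φ (G.pt e s)) (h' : Ioo c d ⊆ range fun s => φ (G.pt e' s)) :
    e = e' := by
  classical
  by_contra hne
  have key : ∀ e, (Ioo c d ⊆ range fun s => φ (G.pt e s)) → ENNReal.ofReal (d - c) ≤
      volume (line e ⁻¹' (G.lift φ ⁻¹' Ioo c d) ∩ Icc 0 (G.length e)) := by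
    intro e h
    have h2 := ((hφ.lipschitzWith_onEdge e).lipschitzOnWith
      (s := line e ⁻¹' (G.lift φ ⁻¹' Ioo c d) ∩ Icc 0 (G.length e))).hausdorffMeasure_image_le
      (d := 1) zero_le_one
    simp only [hausdorffMeasure_real, ENNReal.coe_one, ENNReal.one_rpow, one_mul] at h2
    refine le_trans ?_ h2
    rw [← Real.volume_Ioo]
    refine measure_mono fun y hy => ?_
    obtain ⟨s, rfl⟩ := h hy
    have h3 : G.onEdge φ e s = φ (G.pt e s) := by simp [onEdge, projIcc_val]
    exact ⟨s, ⟨(congrArg (· ∈ Ioo c d) h3).mpr hy, s.2⟩, h3⟩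
  have h1 := hφ.vol_preimage_le hconn hL hrange (measurableSet_Ioo (a := c) (b := d))
  rw [vol_apply, Real.volume_Ioo] at h1
  have h2 := (ENNReal.sum_le_tsum {e, e'}).trans h1
  rw [Finset.sum_pair hne] at h2
  have h3 := (add_le_add (key e h) (key e' h')).trans h2
  rw [← ENNReal.ofReal_add (by linarith) (by linarith),
    ENNReal.ofReal_le_ofReal_iff (by linarith)] at h3
  linarith

/-- Two points with the same value that both lie on an edge with smaller values are equal. -/
theorem EdgeLipschitz.eq_of_lt (hφ : EdgeLipschitz 1 φ) (hconn : G.Connected)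
    (hL : HasSum G.length L) (hrange : Ioo 0 L ⊆ range φ) {e e' : E}
    {s s₁ : Icc (0 : ℝ) (G.length e)} {t t₁ : Icc (0 : ℝ) (G.length e')}
    (heq : φ (G.pt e s) = φ (G.pt e' t)) (hs : φ (G.pt e s₁) < φ (G.pt e s))
    (ht : φ (G.pt e' t₁) < φ (G.pt e' t)) : G.pt e s = G.pt e' t := by
  have hc := (hφ.lipschitzWith hconn).continuous
  -- Both edges cover an interval just below the common value.
  have he : e = e' := by
    refine hφ.edge_unique hconn hL hrange (c := max (φ (G.pt e s₁)) (φ (G.pt e' t₁)))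
      (d := φ (G.pt e s)) (max_lt hs (heq ▸ ht)) (fun y hy => ?_) fun y hy => ?_
    · refine exists_pt_eq_of_mem_uIcc hc e s₁ s ?_
      exact Icc_subset_uIcc ⟨(le_max_left _ _).trans hy.1.le, hy.2.le⟩
    · refine exists_pt_eq_of_mem_uIcc hc e' t₁ t ?_
      exact Icc_subset_uIcc ⟨(le_max_right _ _).trans hy.1.le, heq ▸ hy.2.le⟩
  subst he
  rw [hφ.pt_injective hconn hL hrange e heq]

/-- Two points with the same value that both lie on an edge with larger values are equal. -/
theorem EdgeLipschitz.eq_of_gt (hφ : EdgeLipschitz 1 φ) (hconn : G.Connected)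
    (hL : HasSum G.length L) (hrange : Ioo 0 L ⊆ range φ) {e e' : E}
    {s s₁ : Icc (0 : ℝ) (G.length e)} {t t₁ : Icc (0 : ℝ) (G.length e')}
    (heq : φ (G.pt e s) = φ (G.pt e' t)) (hs : φ (G.pt e s) < φ (G.pt e s₁))
    (ht : φ (G.pt e' t) < φ (G.pt e' t₁)) : G.pt e s = G.pt e' t := by
  have hc := (hφ.lipschitzWith hconn).continuous
  have he : e = e' := by
    refine hφ.edge_unique hconn hL hrange (d := min (φ (G.pt e s₁)) (φ (G.pt e' t₁)))
      (c := φ (G.pt e s)) (lt_min hs (heq ▸ ht)) (fun y hy => ?_) fun y hy => ?_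
    · refine exists_pt_eq_of_mem_uIcc hc e s s₁ ?_
      exact Icc_subset_uIcc ⟨hy.1.le, hy.2.le.trans (min_le_left _ _)⟩
    · refine exists_pt_eq_of_mem_uIcc hc e' t t₁ ?_
      exact Icc_subset_uIcc ⟨heq ▸ hy.1.le, hy.2.le.trans (min_le_right _ _)⟩
  subst he
  rw [hφ.pt_injective hconn hL hrange e heq]

/-- There cannot be one point with only smaller values next to it and another point with only
larger values next to it, at the same level. -/
theorem EdgeLipschitz.false_of_lt_of_gt (hφ : EdgeLipschitz 1 φ) (hconn : G.Connected)
    (hL : HasSum G.length L) (hrange : Ioo 0 L ⊆ range φ) {e e' : E}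
    {s s₁ : Icc (0 : ℝ) (G.length e)} {t t₁ : Icc (0 : ℝ) (G.length e')}
    (heq : φ (G.pt e s) = φ (G.pt e' t)) (hs : φ (G.pt e s₁) < φ (G.pt e s))
    (ht : φ (G.pt e' t) < φ (G.pt e' t₁)) (hne : G.pt e s ≠ G.pt e' t) : False := by
  have hc := (hφ.lipschitzWith hconn).continuous
  have hright : ∀ e₂ (r r₁ : Icc (0 : ℝ) (G.length e₂)), G.pt e₂ r = G.pt e s →
      ¬ φ (G.pt e s) < φ (G.pt e₂ r₁) := by
    intro e₂ r r₁ hr hlt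
    rw [← hr] at hlt hne heq
    exact hne (hφ.eq_of_gt hconn hL hrange heq hlt ht)
  -- The set consisting of this point and of all points with smaller values cannot be left along an
  -- edge: no edge ascends from the point, and any edge that reaches its level from below passes
  -- through it. A chain therefore never arrives at the other point.
  have hstep : ∀ e₂ (r r' : Icc (0 : ℝ) (G.length e₂)),
      (φ (G.pt e₂ r) < φ (G.pt e s) ∨ G.pt e₂ r = G.pt e s) →
      (φ (G.pt e₂ r') < φ (G.pt e s) ∨ G.pt e₂ r' = G.pt e s) := by
    intro e₂ r r' h
    rcases lt_trichotomy (φ (G.pt e₂ r')) (φ (G.pt e s)) with h1 | h1 | h1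
    · exact Or.inl h1
    · rcases h with h | h
      · exact Or.inr (hφ.eq_of_lt hconn hL hrange h1 (h1 ▸ h) hs)
      · refine Or.inr ?_
        rw [← hφ.pt_injective hconn hL hrange e₂ (h1.trans (congrArg φ h.symm)).symm, h]
    · exfalso
      rcases h with h | h
      · obtain ⟨w, hw⟩ := exists_pt_eq_of_mem_uIcc hc e₂ r r'
          (Icc_subset_uIcc ⟨h.le, h1.le⟩)
        exact hright e₂ w r' (hφ.eq_of_lt hconn hL hrange hw (hw ▸ h) hs) h1
      · exact hright e₂ r r' h h1
  have hchain : ∀ x y c, G.Chain x y c → (φ x < φ (G.pt e s) ∨ x = G.pt e s) →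
      (φ y < φ (G.pt e s) ∨ y = G.pt e s) := by
    intro x y c h
    induction h with
    | nil x => exact id
    | cons e₂ r r' y c _ ih => exact fun h => ih (hstep e₂ r r' h)
  obtain ⟨c, h⟩ := hconn.exists_chain (G.pt e s) (G.pt e' t)
  rcases hchain _ _ _ h (Or.inr rfl) with h1 | h1
  · exact h1.ne heq.symm
  · exact hne h1.symm

/-- Each point has a point with a different value on its edge. According to the signs of the two
differences, one of the three exclusion results applies. -/
theorem EdgeLipschitz.injective (hφ : EdgeLipschitz 1 φ) (hconn : G.Connected)
    (hL : HasSum G.length L) (hrange : Ioo 0 L ⊆ range φ) : Function.Injective φ := by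
  intro x y hxy
  obtain ⟨e, s, rfl⟩ := exists_pt_eq x
  obtain ⟨e', t, rfl⟩ := exists_pt_eq y
  by_contra hne
  have key : ∀ e (s : Icc (0 : ℝ) (G.length e)), ∃ s₁, φ (G.pt e s₁) ≠ φ (G.pt e s) := by
    intro e s
    by_contra! h
    have h0 := hφ.pt_injective hconn hL hrange e (h ⟨0, le_rfl, (G.length_pos e).le⟩)
    have h1 := hφ.pt_injective hconn hL hrange e (h ⟨_, (G.length_pos e).le, le_rfl⟩)
    exact (G.length_pos e).ne (congrArg Subtype.val (h0.trans h1.symm))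
  obtain ⟨s₁, hs⟩ := key e s
  obtain ⟨t₁, ht⟩ := key e' t
  rcases hs.lt_or_gt with hs | hs <;> rcases ht.lt_or_gt with ht | ht
  · exact hne (hφ.eq_of_lt hconn hL hrange hxy hs ht)
  · exact hφ.false_of_lt_of_gt hconn hL hrange hxy hs ht hne
  · exact hφ.false_of_lt_of_gt hconn hL hrange hxy.symm ht hs (Ne.symm hne)
  · exact hne (hφ.eq_of_gt hconn hL hrange hxy hs ht)

/-- The distance from x, itself one-Lipschitz, maps the slab {φ x < φ < φ y} onto a set containing
(0, d), by connectedness applied to its cutoff outside the slab. The slab has volume at most φ y − φ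
x, which therefore bounds d. -/
theorem EdgeLipschitz.toReal_edist_le (hφ : EdgeLipschitz 1 φ) (hconn : G.Connected)
    (hL : HasSum G.length L) (hrange : Ioo 0 L ⊆ range φ) {x y : G.Point} (hxy : φ x < φ y) :
    (edist x y).toReal ≤ φ y - φ x := by
  classical
  have hc := (hφ.lipschitzWith hconn).continuous
  have hinj := hφ.injective hconn hL hrange
  have hlip := hconn.lipschitzWith_toReal_edist x
  set d := (edist x y).toReal
  set g : G.Point → ℝ := fun z =>
    if φ z ≤ φ x then 0 else if φ y ≤ φ z then d else (edist x z).toReal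
  have hg : Continuous g := by
    -- By injectivity each switching level consists of one point, x or y, where the branches agree.
    refine Continuous.if_le continuous_const ?_ hc continuous_const fun z hz => ?_
    · refine Continuous.if_le continuous_const hlip.continuous continuous_const hc fun z hz => ?_
      rw [← hinj hz]
    · rw [hinj hz, if_neg hxy.not_ge, edist_self, ENNReal.toReal_zero]
  have hx : g x = 0 := if_pos le_rfl
  have hy : g y = d := by
    simp only [g]
    rw [if_neg hxy.not_ge, if_pos le_rfl]
  have h1 : Ioo 0 d ⊆ range g := hconn.Ioo_subset_range hg
    (subset_closure ⟨x, hx⟩) (subset_closure ⟨y, hy⟩)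
  have h2 : Ioo 0 d ⊆ (fun z => (edist x z).toReal) '' (φ ⁻¹' Ioo (φ x) (φ y)) := by
    intro r hr
    obtain ⟨z, rfl⟩ := h1 hr
    by_cases hz1 : φ z ≤ φ x
    · exact absurd (if_pos hz1) hr.1.ne'
    by_cases hz2 : φ y ≤ φ z
    · exact absurd ((if_neg hz1).trans (if_pos hz2)) hr.2.ne
    exact ⟨z, ⟨lt_of_not_ge hz1, lt_of_not_ge hz2⟩, ((if_neg hz1).trans (if_neg hz2)).symm⟩
  have h3 := (measure_mono h2).trans
    ((edgeLipschitz_of_lipschitzWith hlip).volume_image_le _)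
  have h4 : volume (Ioo 0 d) ≤ volume (Ioo (φ x) (φ y)) :=
    h3.trans (hφ.vol_preimage_le hconn hL hrange measurableSet_Ioo)
  rw [Real.volume_Ioo, Real.volume_Ioo, sub_zero,
    ENNReal.ofReal_le_ofReal_iff (sub_nonneg.2 hxy.le)] at h4
  exact h4

theorem EdgeLipschitz.isometry (hφ : EdgeLipschitz 1 φ) (hconn : G.Connected)
    (hL : HasSum G.length L) (hrange : Ioo 0 L ⊆ range φ) : Isometry φ := by
  intro x y
  refine le_antisymm (by simpa using hφ.lipschitzWith hconn x y) ?_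
  wlog h : φ x ≤ φ y generalizing x y
  · rw [edist_comm x, edist_comm (φ x)]
    exact this y x (le_of_not_ge h)
  rcases h.eq_or_lt with h | h
  · rw [hφ.injective hconn hL hrange h, edist_self]
    exact bot_le
  · have h1 := hφ.toReal_edist_le hconn hL hrange h
    rw [edist_dist, Real.dist_eq, abs_sub_comm, abs_of_pos (sub_pos.2 h),
      ← ENNReal.ofReal_toReal (hconn x y)]
    exact ENNReal.ofReal_le_ofReal h1

end Rigidity

/-! ### Uniqueness of the Dirichlet vertex or end -/

theorem vertexPoint_injective : Function.Injective G.vertexPoint := by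
  intro v w
  refine Quotient.inductionOn₂ (s₁ := G.glue) (s₂ := G.glue) v w fun a b h => ?_
  rcases Quotient.exact (s := G.pointSetoid) h with h | ⟨a', b', h1, h2, h3⟩
  · rw [G.endpoint_injective h]
  · rw [← G.endpoint_injective h1, ← G.endpoint_injective h2]
    exact Quotient.sound (s := G.glue) h3

/-- For an isometry, φ → φ x along the end means convergence to x itself; then x would lie in every
closure, whose intersection is empty. -/
theorem ne_zero_of_tendsto_end {φ : G.Point → ℝ} (hφ : Isometry φ) {γ : G.End}
    (h : Tendsto φ γ.filter (𝓝 0)) (x : G.Point) : φ x ≠ 0 := by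
  intro hx
  induction γ using Quotient.inductionOn (s := EndSeq.setoid G.Point) with | _ A
  have h1 : Tendsto id A.filter (𝓝 x) := by
    rw [hφ.isUniformInducing.isInducing.tendsto_nhds_iff]
    simpa [hx] using! h
  have := A.neBot_filter
  have h2 : x ∈ ⋂ n, closure (A.U n) :=
    mem_iInter.2 fun n => mem_closure_of_tendsto h1 (A.mem_filter n)
  rw [A.iInter_closure] at h2
  exact h2

/-- The image of `A.U n` is an interval accumulating at 0, so it contains (0, φ z] for any z in that
set. By injectivity every point with φ < φ z lies in `A.U n`, and these include some `B.U j`. -/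
theorem exists_subset_of_tendsto_end {φ : G.Point → ℝ} (hinj : Function.Injective φ)
    (hc : Continuous φ) (hpos : ∀ x, 0 < φ x) {A B : EndSeq G.Point}
    (hA : Tendsto φ A.filter (𝓝 0)) (hB : Tendsto φ B.filter (𝓝 0)) (n : ℕ) :
    ∃ j, B.U j ⊆ A.U n := by
  obtain ⟨z, hz⟩ := (A.isConnected n).nonempty
  have h1 := hB.eventually (gt_mem_nhds (hpos z))
  obtain ⟨j, -, hj⟩ := B.hasBasis_filter.eventually_iff.1 h1
  refine ⟨j, fun x hx => ?_⟩
  have hx : φ x < φ z := hj hx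
  have := A.neBot_filter
  obtain ⟨w, hw1, hw2⟩ := ((hA.eventually (gt_mem_nhds (hpos x))).and (A.mem_filter n)).exists
  have h2 := ((A.isConnected n).isPreconnected.image φ hc.continuousOn).ordConnected
  obtain ⟨y, hy, hyx⟩ := h2.out ⟨w, hw2, rfl⟩ ⟨z, hz, rfl⟩ ⟨le_of_lt hw1, hx.le⟩
  rwa [← hinj hyx]

/-- An isometry to an interval vanishes at one vertex or end at most. -/
theorem HasValueAt.unique {φ : G.Point → ℝ} (hφ : Isometry φ) (hinj : Function.Injective φ)
    (h0 : ∀ x, 0 ≤ φ x) {p q : G.Vertex ⊕ G.End} (hp : G.HasValueAt φ p 0)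
    (hq : G.HasValueAt φ q 0) : p = q := by
  rcases p with v | γ <;> rcases q with w | δ
  · have hp : φ (G.vertexPoint v) = 0 := hp
    have hq : φ (G.vertexPoint w) = 0 := hq
    rw [vertexPoint_injective (hinj (hp.trans hq.symm))]
  · exact absurd hp (ne_zero_of_tendsto_end hφ hq _)
  · exact absurd hq (ne_zero_of_tendsto_end hφ hp _)
  · have hpos : ∀ x, 0 < φ x := fun x =>
      (h0 x).lt_of_ne' (ne_zero_of_tendsto_end hφ hp x)
    induction γ using Quotient.inductionOn (s := EndSeq.setoid G.Point) with | _ A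
    induction δ using Quotient.inductionOn (s := EndSeq.setoid G.Point) with | _ B
    refine congrArg Sum.inr (Quotient.sound (s := EndSeq.setoid G.Point) ⟨?_, ?_⟩)
    · exact exists_subset_of_tendsto_end hinj hφ.continuous hpos hp hq
    · exact exists_subset_of_tendsto_end hinj hφ.continuous hpos hq hp

theorem EdgeLipschitz.isDirichletNeumannInterval [Countable E] {L : ℝ} {φ : G.Point → ℝ}
    (hφ : EdgeLipschitz 1 φ) (hconn : G.Connected) (hL : HasSum G.length L)
    (hrange : Ioo 0 L ⊆ range φ) (hrange' : range φ ⊆ Icc 0 L) (hD : D.Nonempty)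
    (h : ∀ p ∈ D, G.HasValueAt φ p 0) : G.IsDirichletNeumannInterval D L := by
  have hiso := hφ.isometry hconn hL hrange
  have hinj := hφ.injective hconn hL hrange
  obtain ⟨p, hp⟩ := hD
  refine ⟨range φ, ⟨Equiv.ofInjective φ hinj, hiso⟩, p, hrange, hrange', ?_, h p hp⟩
  refine subset_antisymm (fun q hq => ?_) (singleton_subset_iff.2 hp)
  exact HasValueAt.unique hiso hinj (fun x => (hrange' ⟨x, rfl⟩).1) (h q hq) (h p hp)

end MetricGraph

/-! ### The interval attains the bound -/

namespace MetricGraph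

variable {E : Type*} {G : MetricGraph E} {D : Set (G.Vertex ⊕ G.End)}

theorem integral_cos_sq_eq_integral_sin_sq {L : ℝ} (hL : 0 < L) :
    ∫ t in Ioo 0 L, Real.cos (Real.pi / (2 * L) * t) ^ 2 =
      ∫ t in Ioo 0 L, Real.sin (Real.pi / (2 * L) * t) ^ 2 := by
  have hk : Real.pi / (2 * L) ≠ 0 := by positivity
  have hkL : Real.pi / (2 * L) * L = Real.pi / 2 := by field_simp
  rw [← integral_Ioc_eq_integral_Ioo, ← integral_Ioc_eq_integral_Ioo,
    ← intervalIntegral.integral_of_le hL.le, ← intervalIntegral.integral_of_le hL.le,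
    intervalIntegral.integral_comp_mul_left (fun t => Real.cos t ^ 2) hk,
    intervalIntegral.integral_comp_mul_left (fun t => Real.sin t ^ 2) hk, hkL,
    integral_cos_sq, integral_sin_sq]
  simp

/-- The test function is sin(kφ) with φ the interval coordinate. Volume is carried to Lebesgue
measure and |φ'| ≤ 1, so its Rayleigh quotient is at most k² times the quotient of ∫cos² and ∫sin²
over a quarter period, which is one. -/
theorem IsDirichletNeumannInterval.rayleighInf_le [Countable E] [Nonempty E]
    (hconn : G.Connected) {L : ℝ} (hL : HasSum G.length L) (hLpos : 0 < L)
    (h : G.IsDirichletNeumannInterval D L) : G.rayleighInf D ≤ (Real.pi / (2 * L)) ^ 2 := by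
  have hfin := isFiniteMeasure_vol hL
  obtain ⟨I, Φ, p, hI, -, rfl, hp⟩ := h
  set φ : G.Point → ℝ := fun x => Φ x
  have hφl : LipschitzWith 1 φ := (isometry_subtype_coe.comp Φ.isometry).lipschitz
  have hφ : EdgeLipschitz 1 φ := edgeLipschitz_of_lipschitzWith hφl
  have hrange : Ioo 0 L ⊆ range φ := fun y hy =>
    ⟨Φ.symm ⟨y, hI hy⟩, by simp [φ]⟩
  have hmap := hφ.map_vol_eq hconn hL hrange
  have hm : Measurable (G.lift φ) := measurable_lift hφl.continuous
  set k := Real.pi / (2 * L)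
  have hk : 0 < k := div_pos Real.pi_pos (by positivity)
  set u : G.Point → ℝ := fun x => Real.sin (k * φ x)
  have hu : EdgeLipschitz k.toNNReal u := by
    intro e s t
    have h1 : |u (G.pt e s) - u (G.pt e t)| ≤ |k * φ (G.pt e s) - k * φ (G.pt e t)| := by
      have := Real.lipschitzWith_sin.dist_le_mul (k * φ (G.pt e s)) (k * φ (G.pt e t))
      simpa [Real.dist_eq] using this
    have h2 := hφ e s t
    rw [NNReal.coe_one, one_mul] at h2
    rw [Real.coe_toNNReal _ hk.le]
    refine h1.trans ?_
    rw [← mul_sub, abs_mul, abs_of_pos hk]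
    exact mul_le_mul_of_nonneg_left h2 hk.le
  have hu0 : ∀ q : G.Vertex ⊕ G.End, G.HasValueAt φ q 0 → G.HasValueAt u q 0 := by
    rintro (v | γ) hv
    · have hv : φ (G.vertexPoint v) = 0 := hv
      change Real.sin (k * φ (G.vertexPoint v)) = 0
      rw [hv, mul_zero, Real.sin_zero]
    · have hv : Tendsto φ γ.filter (𝓝 0) := hv
      have hs : Continuous fun y => Real.sin (k * y) := by fun_prop
      have := (hs.tendsto 0).comp hv
      rw [mul_zero, Real.sin_zero] at this
      exact this
  have hu1 : G.MemH10 {p} u :=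
    ⟨hu.memH1 hconn (B := 1) fun x => Real.abs_sin_le_one _, fun q hq => by
      rw [mem_singleton_iff.1 hq]
      exact hu0 p hp⟩
  have hne : u ≠ 0 := by
    have hy : L / 2 ∈ Ioo 0 L := ⟨by linarith, by linarith⟩
    obtain ⟨x, hx⟩ := hrange hy
    refine Function.ne_iff.2 ⟨x, ?_⟩
    have h1 : k * φ x = Real.pi / 4 := by
      rw [hx]
      simp only [k]
      field_simp
      norm_num
    simp only [u, h1, Real.sin_pi_div_four, Pi.zero_apply]
    positivity
  have hpos := integral_lift_sq_pos hu1.continuous hu1.memLp_lift hne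
  have hsin : ∫ x, G.lift u x ^ 2 ∂G.vol = ∫ t in Ioo 0 L, Real.sin (k * t) ^ 2 := by
    rw [← hmap, integral_map hm.aemeasurable (by fun_prop)]
    rfl
  have hcosi : Integrable (fun x => k ^ 2 * Real.cos (k * G.lift φ x) ^ 2) G.vol := by
    refine Integrable.of_bound (C := k ^ 2) ?_ (Eventually.of_forall fun x => ?_)
    · exact ((Real.measurable_cos.comp (hm.const_mul k)).pow_const 2).const_mul _
        |>.aestronglyMeasurable
    · rw [Real.norm_eq_abs, abs_of_nonneg (by positivity)]
      exact mul_le_of_le_one_right (sq_nonneg k) (Real.cos_sq_le_one _)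
  have hder : ∫ x, G.der u x ^ 2 ∂G.vol ≤ k ^ 2 * ∫ t in Ioo 0 L, Real.cos (k * t) ^ 2 := by
    rw [← hmap, integral_map hm.aemeasurable (by fun_prop), ← integral_const_mul]
    refine integral_mono_ae hu1.memLp_der.integrable_sq hcosi ?_
    filter_upwards [ae_hasDerivAt fun e => hφ.ac e] with x hx
    have h1 : HasDerivAt (G.onEdge u x.1) (Real.cos (k * G.lift φ x) * (k * G.der φ x)) x.2 :=
      (hx.const_mul k).sin
    have h2 : G.der u x = Real.cos (k * G.lift φ x) * (k * G.der φ x) := h1.deriv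
    have h3 : G.der φ x ^ 2 ≤ 1 := by
      have := hφ.abs_der_le x
      rw [NNReal.coe_one] at this
      rw [← sq_abs]
      exact pow_le_one₀ (abs_nonneg _) this
    simp only [h2]
    calc _ = k ^ 2 * Real.cos (k * G.lift φ x) ^ 2 * G.der φ x ^ 2 := by ring
      _ ≤ _ := mul_le_of_le_one_right (by positivity) h3
  have h1 := (rayleighInf_mul_le hu1).trans hder
  rw [integral_cos_sq_eq_integral_sin_sq hLpos, ← hsin] at h1
  exact le_of_mul_le_mul_right h1 hpos

end MetricGraph

/-! ### The theorem -/

theorem mainTheorem4 {E : Type*} [Countable E] (G : MetricGraph E)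
    (hfin : G.LocallyFinite) (hconn : G.Connected)
    (L : ℝ) (hLpos : 0 < L) (hL : HasSum G.length L)
    (D : Set (G.Vertex ⊕ G.End)) (hD : D.Nonempty) :
    ∃ lam : ℝ, IsLeast (G.mixedEigenvalues D) lam ∧
      Real.pi ^ 2 / (4 * L ^ 2) ≤ lam ∧
      (lam = Real.pi ^ 2 / (4 * L ^ 2) ↔ G.IsDirichletNeumannInterval D L) := by
  have hne : Nonempty E := by
    by_contra h
    rw [not_nonempty_iff] at h
    exact hLpos.ne (hasSum_empty.unique hL)
  have hk : Real.pi ^ 2 / (4 * L ^ 2) = (Real.pi / (2 * L)) ^ 2 := by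
    rw [div_pow, mul_pow]
    norm_num
  rw [hk]
  obtain ⟨f, hf, hf1, hf2⟩ := G.exists_minimizer hconn hL hLpos hD
  have hle : (Real.pi / (2 * L)) ^ 2 ≤ G.rayleighInf D := by
    have := MetricGraph.sq_mul_integral_le hconn hL hLpos hD hf hLpos
      (MetricGraph.tailAbs_le hL hLpos f 0)
    rwa [hf1, hf2, mul_one] at this
  refine ⟨G.rayleighInf D, MetricGraph.isLeast_rayleighInf hconn hL hLpos hD, hle,
    fun heq => ?_, fun h => le_antisymm (h.rayleighInf_le hconn hL hLpos) hle⟩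
  have hf0 : f ≠ 0 := by
    rintro rfl
    simp [MetricGraph.lift] at hf1
  obtain ⟨φ, h1, h2, h3, h4⟩ := MetricGraph.exists_edgeLipschitz_of_eq hconn hL hLpos hD hf hf0
    (by rw [hf2, hf1, mul_one, heq])
  exact h1.isDirichletNeumannInterval hconn hL h2 h3 hD h4
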